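/- Let $\mathfrak K$ be the category of diagrams of a knot $\mathcal K$, where $\mathcal K$ is a virtual knot, a flat (virtual) knot, a knot in the thickening of a closed connected oriented surface $S$ (for $S=S^2$: a classical knot), or a free homotopy class of closed curves on such a surface. The objects of $\mathfrak K$ are all diagrams of $\mathcal K$; in particular any two of them are connected by a chain of elementary morphisms, that is, isotopies, Reidemeister moves, detour moves (the latter only for virtual and flat knots), and their inverses. For a diagram $D$ let $\mathcal V(D)$ be its set of classical (non-virtual) crossings. An elementary morphism $f\colon D\to D'$ induces a bijection $f_*$ from a subset of $\mathcal V(D)$ onto a subset of $\mathcal V(D')$: it is defined on all crossings that do not disappear, and its image consists of all crossings that are not new. A weak parity on $\mathfrak K$ is a family of maps $\psi_D\colon\mathcal V(D)\to\mathbb Z_2=\{0,1\}$, $D\in\mathrm{ob}(\mathfrak K)$, such that * $(\Psi0)$ $\psi_D(v)=\psi_{D'}(f_*(v))$ for every elementary morphism $f\colon D\to D'$ and every $v\in\mathcal V(D)$ at which $f_*$ is defined; * $(\Psi2)$ if $f\colon D\to D'$ is a decreasing second Reidemeister move that removes the crossings $u,v\in\mathcal V(D)$, then $\psi_D(u)=\psi_D(v)$;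 * $(\Psi3)$ if $f\colon D\to D'$ is a third Reidemeister move on the crossings $u,v,w\in\mathcal V(D)$, then $\psi_D(u)+\psi_D(v)+\psi_D(w)\neq 1$, the sum being taken in $\mathbb Z$. A weak parity is trivial if $\psi_D(v)=1$ for all $D$ and all $v\in\mathcal V(D)$. **Theorem.** Every nontrivial weak parity $\psi$ on $\mathfrak K$ satisfies * $(\Psi1)$ if $f\colon D\to D'$ is a decreasing first Reidemeister move that removes the crossing $u\in\mathcal V(D)$, then $\psi_D(u)=0$. -/

import Mathlib

/-! ### Combinatorial 4-valent maps

A finite 4-valent graph that is cellularly embedded in a closed oriented surface is encoded by its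
rotation system: the half-edges ("darts") at a vertex `w` are `(w, 0), (w, 1), (w, 2), (w, 3)` in
counterclockwise order, and `α` is the fixed-point-free involution that exchanges the two darts of
every edge. -/

/-- The darts of a 4-valent graph with vertex set `W`. -/
abbrev Dart (W : Type) : Type := W × ZMod 4

/-- Rotation by `k` quarter turns counterclockwise around every vertex. -/
def turn {W : Type} (k : ZMod 4) : Equiv.Perm (Dart W) where
  toFun d := (d.1, d.2 + k)
  invFun d := (d.1, d.2 - k)
  left_inv d := by simp
  right_inv d := by simp

/-- The boundary walk of the faces: run along the edge that starts with `d`, then take the leftmost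
exit.  The cycles are the faces; the face of the dart `(w, i)` is the one that contains the corner
of `w` between `(w, i)` and `(w, i + 1)`. -/
def faceWalk {W : Type} (α : Equiv.Perm (Dart W)) : Equiv.Perm (Dart W) := turn (-1) * α

/-- The straight-ahead walk: run along the edge that starts with `d`, then leave through the
opposite dart. -/
def straightWalk {W : Type} (α : Equiv.Perm (Dart W)) : Equiv.Perm (Dart W) := turn 2 * α

/-- The number of faces. -/
noncomputable def faceCount {W : Type} (α : Equiv.Perm (Dart W)) : ℕ :=
  Nat.card (Quotient (Equiv.Perm.SameCycle.setoid (faceWalk α)))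

open Classical in
/-- The Euler characteristic (vertices) - (edges) + (faces) of the closed surface that carries a
connected 4-valent map; there are twice as many edges as vertices.  The empty map stands for the
sphere (with a circle without vertices on it, or with nothing on it). -/
noncomputable def eulerChar {W : Type} (α : Equiv.Perm (Dart W)) : ℤ :=
  if IsEmpty W then 2 else (Nat.card W : ℤ) - 2 * Nat.card W + faceCount α

/-- The graph is connected. -/
def ConnectedMap {W : Type} (α : Equiv.Perm (Dart W)) : Prop :=
  ∀ d d' : Dart W, ∃ g ∈ Subgroup.closure {α, turn 1}, g d = d'

/-- `α'` arises from `α` by deleting the vertices outside the range of `ι` and going straight ahead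
through each of them: starting with a surviving dart `d`, follow its edge and cross deleted vertices
until a surviving vertex is reached. -/
def ErasesTo {W W' : Type} (α : Equiv.Perm (Dart W)) (α' : Equiv.Perm (Dart W')) (ι : W' → W) :
    Prop :=
  ∀ d : Dart W', ∃ n : ℕ,
    α ((straightWalk α ^ n) (ι d.1, d.2)) = (ι (α' d).1, (α' d).2) ∧
    ∀ m < n, (α ((straightWalk α ^ m) (ι d.1, d.2))).1 ∉ Set.range ι

/-! ### Knot theories

The ambient surface is a closed connected oriented surface `S`.  A surface is fixed by a *frame*: a
connected 4-valent graph `Γ` in `S` all of whose faces are discs.  Every closed connected oriented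
surface has one.  For `S = S²` the frame may be empty.  Diagrams are drawn in general position to
`Γ`, which is transparent for them: it only records where on `S` the diagram is, so that a diagram
up to isotopies of `S` is the rotation system of (diagram ∪ `Γ`) up to moving the diagram across the
edges and the vertices of `Γ`. -/

/-- A knot theory.
* `virt = false`, `flat = false`: knots in the thickening of the surface `S` of the frame
  (classical knots if `S` is the sphere);
* `virt = false`, `flat = true`: closed curves on `S` up to homotopy;
* `virt = true`, `flat = false`: virtual knots, given by diagrams with virtual crossings;
* `virt = true`, `flat = true`: flat (virtual) knots. -/
structure KnotTheory where
  /-- the vertices of the frame -/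
  V : Type
  finite_V : Finite V
  /-- the edges of the frame -/
  frame : Equiv.Perm (Dart V)
  frame_invol : ∀ d, frame (frame d) = d
  frame_ne : ∀ d, frame d ≠ d
  frame_connected : ConnectedMap frame
  /-- over and under are not distinguished at classical crossings -/
  flat : Bool
  /-- virtual crossings are allowed -/
  virt : Bool
  /-- virtual diagrams are drawn in the plane (equivalently, on the sphere), without a frame -/
  isEmpty_of_virt : virt = true → IsEmpty V

/-- The kinds of vertices of (diagram ∪ frame).  At a `classical` crossing of a theory that is not
flat, the darts `0, 2` form the underpass and `1, 3` the overpass.  At a `transit` vertex the knot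
crosses an edge of the frame: `0, 2` belong to the knot and `1, 3` to the frame.  A `frame` vertex
is a vertex of the frame. -/
inductive Kind
  | classical
  | virtual
  | transit
  | frame

/-- Does the dart number `i` of a vertex of this kind belong to the knot? -/
def Kind.OnKnot : Kind → ZMod 4 → Prop
  | .classical, _ => True
  | .virtual, _ => True
  | .transit, i => Even i
  | .frame, _ => False

/-- A knot diagram (one unicursal component) together with the frame.  Without frame, the empty
set of vertices stands for the diagram that is a circle without crossings. -/
structure Diagram (T : KnotTheory) where
  /-- the vertices that lie on the knot -/
  X : Type
  finite_X : Finite X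
  kind : X → Kind
  kind_ne_frame : ∀ x, kind x ≠ .frame
  kind_ne_virtual : T.virt = false → ∀ x, kind x ≠ .virtual
  /-- the edges -/
  edge : Equiv.Perm (Dart (T.V ⊕ X))
  edge_invol : ∀ d, edge (edge d) = d
  edge_ne : ∀ d, edge d ≠ d
  /-- every edge is an edge of the knot or (a piece of) an edge of the frame -/
  edge_onKnot : ∀ d : Dart (T.V ⊕ X),
    (Sum.elim (fun _ => Kind.frame) kind (edge d).1).OnKnot (edge d).2 ↔
      (Sum.elim (fun _ => Kind.frame) kind d.1).OnKnot d.2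
  /-- walking straight ahead along the knot, in one direction or the other, one sees all of it -/
  unicursal : ∀ d d' : Dart (T.V ⊕ X),
    (Sum.elim (fun _ => Kind.frame) kind d.1).OnKnot d.2 →
    (Sum.elim (fun _ => Kind.frame) kind d'.1).OnKnot d'.2 →
      (straightWalk edge).SameCycle d d' ∨ (straightWalk edge).SameCycle d (turn 2 d')

namespace Diagram

variable {T : KnotTheory}

/-- The kind of a vertex of (diagram ∪ frame). -/
def vertexKind (D : Diagram T) : T.V ⊕ D.X → Kind := Sum.elim (fun _ => Kind.frame) D.kind

/-- The set of classical crossings of a diagram. -/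
abbrev Crossing (D : Diagram T) : Type := {x : D.X // D.kind x = .classical}

/-- The diagram lies on the surface of the theory: the frame in it is the given one (deleting the
vertices on the knot leaves it, and every transit is a point of it), it meets the frame
if there is one, and (diagram ∪ frame) is connected and has the same Euler characteristic as the
frame (the sphere, if there is no frame). Elementary morphisms preserve this property. -/
structure OnSurface (D : Diagram T) : Prop where
  erases : ErasesTo D.edge T.frame Sum.inl
  transit : ∀ x, D.kind x = .transit → ∃ (v : T.V) (j : ZMod 4),
    (straightWalk D.edge).SameCycle (Sum.inr x, 1) (Sum.inl v, j)
  connected : ConnectedMap D.edge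
  meets : Nonempty T.V → Nonempty D.X
  euler : eulerChar D.edge = eulerChar T.frame

/-- An isotopy that respects the frame: an isomorphism of rotation systems that fixes the vertices of
the frame, and preserves the kinds of the vertices and the overpasses.  The number `shift w` tells
by how much the numbering of the darts at `w` is rotated. -/
structure Isotopy (D D' : Diagram T) where
  toEquiv : D.X ≃ D'.X
  shift : T.V ⊕ D.X → ZMod 4
  kind_eq : ∀ x, D'.kind (toEquiv x) = D.kind x
  shift_frame : ∀ v, shift (Sum.inl v) = 0
  shift_transit : ∀ x, D.kind x = .transit → Even (shift (Sum.inr x))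
  shift_classical : T.flat = false → ∀ x, D.kind x = .classical → Even (shift (Sum.inr x))
  edge_eq : ∀ d d', D.edge d = d' →
    D'.edge (Sum.map id toEquiv d.1, d.2 + shift d.1) =
      (Sum.map id toEquiv d'.1, d'.2 + shift d'.1)

/-- Decreasing first Reidemeister move: the crossing `u` with a one-sided face disappears. (If `u`
is virtual, this is a special case of the detour move.) -/
structure FirstMove (D D' : Diagram T) where
  /-- the inclusion of the vertices of `D'` into those of `D` -/
  keep : D'.X → D.X
  keep_inj : Function.Injective keep
  kind_eq : ∀ x, D.kind (keep x) = D'.kind x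
  erases : ErasesTo D.edge D'.edge (Sum.map id keep)
  u : D.X
  range_keep : Set.range keep = {u}ᶜ
  i : ZMod 4
  loop : D.edge (Sum.inr u, i) = (Sum.inr u, i + 1)

/-- Decreasing second Reidemeister move: the crossings `u`, `v` of a two-sided face disappear.  Both
are classical, and one strand is above the other at both of them (no condition in flat theories); or
both are virtual (a special case of the detour move); or both are transits (an isotopy that moves an
arc of the knot off an edge of the frame).

When the two-sided face is opened, it joins the faces of the two opposite corners.  These have to be
different: otherwise the new region is not a disc, which means for the inverse move that it was not
performed inside a disc of the surface. -/
structure SecondMove (D D' : Diagram T) where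
  /-- the inclusion of the vertices of `D'` into those of `D` -/
  keep : D'.X → D.X
  keep_inj : Function.Injective keep
  kind_eq : ∀ x, D.kind (keep x) = D'.kind x
  erases : ErasesTo D.edge D'.edge (Sum.map id keep)
  u : D.X
  v : D.X
  ne : u ≠ v
  range_keep : Set.range keep = {u, v}ᶜ
  i : ZMod 4
  j : ZMod 4
  side₁ : D.edge (Sum.inr u, i) = (Sum.inr v, j + 1)
  side₂ : D.edge (Sum.inr u, i + 1) = (Sum.inr v, j)
  same_kind : D.kind u = D.kind v
  layers : T.flat = false → D.kind u = .classical → (Even i ↔ Even (j + 1))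
  disc : ¬ (faceWalk D.edge).SameCycle (Sum.inr u, i + 2) (Sum.inr v, j + 2)

open Classical in
/-- The exchange of darts in a third Reidemeister move on a triangle whose corners are between
`(x, i)` and `(x, i + 1)`, between `(y, j)` and `(y, j + 1)`, and between `(z, k)` and `(z, k + 1)`:
each of the three strands passes its two crossings in the opposite order, in the same direction. -/
noncomputable def exchange {W : Type} (x y z : W) (i j k : ZMod 4) : Equiv.Perm (Dart W) :=
  Equiv.swap (x, i + 2) (y, j + 1) * Equiv.swap (x, i) (y, j + 3) *
  (Equiv.swap (y, j + 2) (z, k + 1) * Equiv.swap (y, j) (z, k + 3)) *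
  (Equiv.swap (z, k + 2) (x, i + 1) * Equiv.swap (z, k) (x, i + 3))

/-- Third Reidemeister move on the three-sided face with the vertices `x`, `y`, `z`.  Either all of
them are classical crossings and (unless the theory is flat) the face is not alternating, that is,
there are a top, a middle and a bottom strand; or at least two of them are virtual
(a special case of the detour move) or transits (an isotopy that moves a crossing of the
knot across an edge of the frame, or an arc of the knot across a vertex of the frame). -/
structure ThirdMove (D D' : Diagram T) where
  toEquiv : D.X ≃ D'.X
  kind_eq : ∀ x, D'.kind (toEquiv x) = D.kind x
  x : T.V ⊕ D.X
  y : T.V ⊕ D.X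
  z : T.V ⊕ D.X
  ne_xy : x ≠ y
  ne_yz : y ≠ z
  ne_zx : z ≠ x
  i : ZMod 4
  j : ZMod 4
  k : ZMod 4
  side₁ : D.edge (x, i) = (y, j + 1)
  side₂ : D.edge (y, j) = (z, k + 1)
  side₃ : D.edge (z, k) = (x, i + 1)
  admissible :
    (D.vertexKind x = .classical ∧ D.vertexKind y = .classical ∧ D.vertexKind z = .classical ∧
      (T.flat = false → ¬ ((Even i ↔ Even j) ∧ (Even j ↔ Even k)))) ∨
    (∃ q, (q = .virtual ∨ q = .transit) ∧
      ((D.vertexKind x = q ∧ D.vertexKind y = q) ∨ (D.vertexKind y = q ∧ D.vertexKind z = q) ∨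
        (D.vertexKind z = q ∧ D.vertexKind x = q)))
  edge_eq : ∀ d d', D.edge d = d' →
    D'.edge (Sum.map id toEquiv (exchange x y z i j k d).1, (exchange x y z i j k d).2) =
      (Sum.map id toEquiv (exchange x y z i j k d').1, (exchange x y z i j k d').2)

/-- `Elementary D D' R`: there is an elementary morphism `f : D → D'` (isotopy, Reidemeister move,
detour move) whose partial map `f_*` on vertices has the graph `R`. (A detour move is a composition
of first, second and third moves that involve virtual crossings.) -/
inductive Elementary : ∀ D D' : Diagram T, (D.X → D'.X → Prop) → Prop
  | isotopy {D D' : Diagram T} (f : Isotopy D D') : Elementary D D' (fun x x' => f.toEquiv x = x')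
  | first {D D' : Diagram T} (f : FirstMove D D') : Elementary D D' (fun x x' => x = f.keep x')
  | second {D D' : Diagram T} (f : SecondMove D D') : Elementary D D' (fun x x' => x = f.keep x')
  | third {D D' : Diagram T} (f : ThirdMove D D') : Elementary D D' (fun x x' => f.toEquiv x = x')
  | symm {D D' : Diagram T} {R : D.X → D'.X → Prop} (h : Elementary D D' R) :
      Elementary D' D (fun x' x => R x x')

/-- The diagrams of the knot that is represented by `D₀`: those that are connected with `D₀` by a
chain of elementary morphisms. -/
def DiagramOf (D₀ : Diagram T) : Type 1 :=
  {D : Diagram T // Relation.ReflTransGen (fun D D' => ∃ R, Elementary D D' R) D₀ D}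

/-- A weak parity on the category of diagrams of the knot represented by `D₀`. -/
structure IsWeakParity (D₀ : Diagram T) (ψ : ∀ D : DiagramOf D₀, D.1.Crossing → ZMod 2) : Prop where
  psi0 : ∀ (D D' : DiagramOf D₀) (R : D.1.X → D'.1.X → Prop), Elementary D.1 D'.1 R →
    ∀ (v : D.1.Crossing) (v' : D'.1.Crossing), R v.1 v'.1 → ψ D v = ψ D' v'
  psi2 : ∀ (D D' : DiagramOf D₀) (f : SecondMove D.1 D'.1) (u v : D.1.Crossing),
    u.1 = f.u → v.1 = f.v → ψ D u = ψ D v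
  psi3 : ∀ (D D' : DiagramOf D₀) (f : ThirdMove D.1 D'.1) (u v w : D.1.Crossing),
    Sum.inr u.1 = f.x → Sum.inr v.1 = f.y → Sum.inr w.1 = f.z →
      (ψ D u).val + (ψ D v).val + (ψ D w).val ≠ 1

/-- A weak parity is trivial if it is identically 1. -/
def IsTrivialParity (D₀ : Diagram T) (ψ : ∀ D : DiagramOf D₀, D.1.Crossing → ZMod 2) : Prop :=
  ∀ D v, ψ D v = 1

end Diagram

/-!
A *kink* is a classical crossing with a loop, inserted into a strand of a diagram; decreasing first
moves remove kinks.  Suppose that the weak parity is `1` ("odd") at one kink.  The theorem follows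
once all crossings of all diagrams are shown to be odd, since the parity is then trivial.

*An odd kink makes the next crossing odd* (`OddKink.slide`).  Let `u` be an odd kink and let `v` be
the next vertex on the strand behind it.  Push a finger of the strand that crosses at `v` over or
under the loop of the kink (as it lies at `v`); this is an increasing second move that creates
vertices `q`, `p` with equal parities.  Then `u`, `v`, `q` span a triangle, and a third move on it
takes the finger across `u`.  Now `v` and `p` span a bigon, and a decreasing second move removes
them, so that `v` and `p` have equal parities too.  By the condition on third moves, `u`, `v`, `q`
cannot have exactly one odd crossing; since `u` is odd and `v` and `q` agree, `v` is odd.  After these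
moves the kink is behind the crossing `q`, which has replaced `v`.  The moves are the same if `v` is
virtual or a point where the knot crosses the frame.  Hence the kink travels along the whole knot:
all crossings of the diagram are odd (`OddKink.oddAt`), and on every edge one of the kinks with the
two possible directions is odd (`OddKink.edge`).

*Odd kinks survive all moves* (`Elementary.hasOddKink_iff`).  For every move there is an edge of the
knot that it does not touch, so the move can be made in the presence of a kink on that edge.  For a
third move this is an edge that leads away from the triangle.  For a decreasing first or second move
it is an edge at a surviving vertex or, if only a circle without vertices is left, a loop outside of
the disc of the move.  Hence every diagram of the knot admits an odd kink, and all crossings are odd.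

*Every first move removes a kink* (`FirstMove.exists_kinkIsotopy`), so an odd crossing that is removed
by a first move yields an odd kink.

Diagrams with kinks and fingers are all built in the same way: vertices with some standard edges are
added to a diagram, and then the ends of the edges are permuted (`joinEdge`).  That a diagram arises
from another one by deleting vertices is expressed by threads (`Thread`), straight walks through
deleted vertices; the number of components is controlled by `Unicursal.of_erasesTo`.
-/

open Equiv.Perm (SameCycle)

/-! ### Straight threads through deleted vertices -/

section Maps

variable {W W' : Type}

@[simp] theorem turn_apply (k : ZMod 4) (d : Dart W) : turn k d = (d.1, d.2 + k) := rfl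

theorem turn_two_turn_two (d : Dart W) : turn 2 (turn 2 d) = d := by
  have h : ∀ a : ZMod 4, a + 2 + 2 = a := by decide
  simp [h]

theorem straightWalk_apply (α : Equiv.Perm (Dart W)) (d : Dart W) :
    straightWalk α d = turn 2 (α d) := rfl

theorem faceWalk_apply (α : Equiv.Perm (Dart W)) (d : Dart W) :
    faceWalk α d = turn (-1) (α d) := rfl

/-- `Thread α S a b`: a curve that starts with the dart `a` and goes straight ahead through vertices
of `S` arrives at the dart `b`. -/
inductive Thread (α : Equiv.Perm (Dart W)) (S : Set W) : Dart W → Dart W → Prop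
  | edge (a : Dart W) : Thread α S a (α a)
  | cross {a b : Dart W} (h : (α a).1 ∈ S) (t : Thread α S (turn 2 (α a)) b) : Thread α S a b

namespace Thread

variable {α : Equiv.Perm (Dart W)} {S : Set W} {a b c : Dart W}

theorem of_eq (h : α a = b) : Thread α S a b := h ▸ edge a

theorem cross_of_eq (h : α a = b) (hb : b.1 ∈ S) (t : Thread α S (turn 2 b) c) :
    Thread α S a c := by
  subst h
  exact cross hb t

theorem trans (t : Thread α S a b) (hb : b.1 ∈ S) (t' : Thread α S (turn 2 b) c) :
    Thread α S a c := by
  induction t with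
  | edge a => exact cross hb t'
  | cross h _ ih => exact cross h (ih hb t')

theorem symm (hα : ∀ d, α (α d) = d) (t : Thread α S a b) : Thread α S b a := by
  induction t with
  | edge a => exact of_eq (hα a)
  | @cross a b h _ ih =>
    refine ih.trans h ?_
    rw [turn_two_turn_two]
    exact of_eq (hα a)

theorem sameCycle (t : Thread α S a b) : (straightWalk α).SameCycle a (turn 2 b) := by
  induction t with
  | edge a => exact (SameCycle.refl _ _).apply_right
  | @cross a b h _ ih => exact (SameCycle.refl _ _).apply_right.trans ih

/-- A thread that ends outside of `S` is an edge if the edge ends outside of `S`. -/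
theorem eq_of_notMem (t : Thread α S a b) (h : (α a).1 ∉ S) : α a = b := by
  cases t with
  | edge => rfl
  | cross h' _ => exact absurd h' h

/-- The first step of a thread that enters `S` and ends outside of it. -/
theorem tail (t : Thread α S a b) (hb : b.1 ∉ S) (h : α a = c) (hc : c.1 ∈ S) :
    Thread α S (turn 2 c) b := by
  subst h
  cases t with
  | edge => exact absurd hc hb
  | cross _ t => exact t

theorem conj {ρ : Equiv.Perm (Dart W)} (hρ : ∀ x : Dart W, x.1 ∈ S → ρ x = x)
    (t : Thread α S a b) : Thread (ρ * α * ρ⁻¹) S (ρ a) (ρ b) := by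
  have key : ∀ x, (ρ * α * ρ⁻¹) (ρ x) = ρ (α x) := by simp
  induction t with
  | edge a => exact of_eq (key a)
  | @cross a b h _ ih =>
    rw [hρ (turn 2 (α a)) h] at ih
    exact cross_of_eq ((key a).trans (hρ _ h)) h ih

theorem map {α' : Equiv.Perm (Dart W')} {S' : Set W'} (j : W → W')
    (hj : ∀ d, α' (j d.1, d.2) = (j (α d).1, (α d).2)) (hS : ∀ w ∈ S, j w ∈ S')
    (t : Thread α S a b) : Thread α' S' (j a.1, a.2) (j b.1, b.2) := by
  induction t with
  | edge a => exact of_eq (hj a)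
  | @cross a b h _ ih => exact cross_of_eq (hj a) (hS _ h) ih

theorem iff_exists : Thread α S a b ↔
    ∃ n : ℕ, α ((straightWalk α ^ n) a) = b ∧ ∀ m < n, (α ((straightWalk α ^ m) a)).1 ∈ S := by
  constructor
  · intro t
    induction t with
    | edge a => exact ⟨0, rfl, by simp⟩
    | @cross a b h _ ih =>
      obtain ⟨n, hn, hm⟩ := ih
      refine ⟨n + 1, by rwa [pow_succ], fun m hmn => ?_⟩
      cases m with
      | zero => exact h
      | succ m =>
        rw [pow_succ]
        exact hm m (by omega)
  · rintro ⟨n, hn, hm⟩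
    induction n generalizing a with
    | zero => exact of_eq hn
    | succ n ih =>
      refine cross (hm 0 (by omega)) (ih ?_ fun m hmn => ?_)
      · rwa [pow_succ] at hn
      · have := hm (m + 1) (by omega)
        rwa [pow_succ] at this

end Thread

theorem erasesTo_iff {α : Equiv.Perm (Dart W)} {α' : Equiv.Perm (Dart W')} {ι : W' → W} :
    ErasesTo α α' ι ↔
      ∀ d : Dart W', Thread α (Set.range ι)ᶜ (ι d.1, d.2) (ι (α' d).1, (α' d).2) := by
  simp only [ErasesTo, Thread.iff_exists, Set.mem_compl_iff]

/-- An invariant of a permutation is constant on its cycles. -/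
theorem Equiv.Perm.SameCycle.map_eq {A B : Type*} {f : Equiv.Perm A} {φ : A → B} (hφ : ∀ x, φ (f x) = φ x)
    {x y : A} (h : f.SameCycle x y) : φ x = φ y := by
  obtain ⟨n, rfl⟩ := h
  induction n using Int.induction_on with
  | zero => rfl
  | succ n ih => rw [ih, add_comm, zpow_add, zpow_one, Equiv.Perm.mul_apply, hφ]
  | pred n ih =>
    rw [ih, sub_eq_add_neg, add_comm, zpow_add, Equiv.Perm.mul_apply, zpow_neg_one, ← hφ (f⁻¹ _)]
    simp

/-- A map that takes every step of `f` into a cycle of `g` takes cycles of `f` into cycles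
of `g`. -/
theorem Equiv.Perm.SameCycle.map_sameCycle {A B : Type*} {f : Equiv.Perm A} {g : Equiv.Perm B} {φ : A → B}
    (hφ : ∀ x, g.SameCycle (φ x) (φ (f x))) {x y : A} (h : f.SameCycle x y) :
    g.SameCycle (φ x) (φ y) := by
  have := SameCycle.map_eq (f := f)
    (φ := fun x => (Quotient.mk (SameCycle.setoid g) (φ x))) (fun x => Quotient.sound (hφ x).symm) h
  exact Quotient.exact this

/-- Reversing the direction of the straight-ahead walk. -/
theorem Equiv.Perm.SameCycle.turn_two {α : Equiv.Perm (Dart W)} (hα : ∀ d, α (α d) = d) {a b : Dart W}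
    (h : (straightWalk α).SameCycle a b) : (straightWalk α).SameCycle (turn 2 a) (turn 2 b) := by
  refine SameCycle.map_sameCycle (fun x => ?_) h
  have : straightWalk α (turn 2 (straightWalk α x)) = turn 2 x := by
    rw [straightWalk_apply, straightWalk_apply, turn_two_turn_two, hα]
  exact (this ▸ (SameCycle.refl _ _).apply_right : (straightWalk α).SameCycle
    (turn 2 (straightWalk α x)) (turn 2 x)).symm

/-- The dart `d` belongs to the knot. -/
def KnotDart (κ : W → Kind) (d : Dart W) : Prop := (κ d.1).OnKnot d.2

theorem Kind.onKnot_add_two (q : Kind) (i : ZMod 4) : q.OnKnot (i + 2) ↔ q.OnKnot i := by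
  cases q with
  | transit => revert i; simp only [Kind.OnKnot, Even]; decide
  | _ => rfl

theorem KnotDart.turn_two (κ : W → Kind) (d : Dart W) :
    KnotDart κ (turn 2 d) ↔ KnotDart κ d := Kind.onKnot_add_two _ _

theorem KnotDart.of_sameCycle {κ : W → Kind} {α : Equiv.Perm (Dart W)}
    (hα : ∀ d, KnotDart κ (α d) ↔ KnotDart κ d) {a b : Dart W}
    (h : (straightWalk α).SameCycle a b) : KnotDart κ a ↔ KnotDart κ b := by
  have := SameCycle.map_eq (f := straightWalk α) (φ := KnotDart κ)
    (fun x => propext ((KnotDart.turn_two _ _).trans (hα x))) h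
  rw [this]

/-- The knot has one component. -/
def Unicursal (κ : W → Kind) (α : Equiv.Perm (Dart W)) : Prop :=
  ∀ d d', KnotDart κ d → KnotDart κ d' →
    (straightWalk α).SameCycle d d' ∨ (straightWalk α).SameCycle d (turn 2 d')

/-- Deleting vertices does not change the number of components of a knot, unless a component loses
all of its vertices. -/
theorem Unicursal.of_erasesTo {κ : W → Kind} {κ' : W' → Kind} {α : Equiv.Perm (Dart W)}
    {α' : Equiv.Perm (Dart W')} {ι : W' → W} (hα : ∀ d, α (α d) = d)
    (hk : ∀ d, KnotDart κ (α d) ↔ KnotDart κ d) (hκ : ∀ w, κ (ι w) = κ' w)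
    (hE : ErasesTo α α' ι) (hu : Unicursal κ' α')
    (hd : ∀ a : Dart W, a.1 ∉ Set.range ι → KnotDart κ a → ∃ d : Dart W',
      (straightWalk α).SameCycle a (ι d.1, d.2) ∨
        (straightWalk α).SameCycle a (turn 2 (ι d.1, d.2))) :
    Unicursal κ α := by
  have hd' : ∀ a : Dart W, KnotDart κ a → ∃ d : Dart W', KnotDart κ' d ∧
      ((straightWalk α).SameCycle a (ι d.1, d.2) ∨
        (straightWalk α).SameCycle a (turn 2 (ι d.1, d.2))) := by
    intro a ha
    by_cases h : a.1 ∈ Set.range ι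
    · obtain ⟨w, hw⟩ := h
      refine ⟨(w, a.2), ?_, Or.inl ?_⟩
      · unfold KnotDart at *
        rwa [← hκ, hw]
      · simp only [hw]
        exact SameCycle.refl _ _
    · obtain ⟨d, h⟩ := hd a h ha
      refine ⟨d, ?_, h⟩
      have : KnotDart κ (ι d.1, d.2) := by
        rcases h with h | h
        · exact (KnotDart.of_sameCycle hk h).1 ha
        · exact (KnotDart.turn_two _ _).1 ((KnotDart.of_sameCycle hk h).1 ha)
      unfold KnotDart at *
      rwa [← hκ]
  have hmap : ∀ {d d' : Dart W'}, (straightWalk α').SameCycle d d' →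
      (straightWalk α).SameCycle (ι d.1, d.2) (ι d'.1, d'.2) := by
    intro d d' h
    exact SameCycle.map_sameCycle (φ := fun d : Dart W' => ((ι d.1, d.2) : Dart W))
      (fun x => (erasesTo_iff.1 hE x).sameCycle) h
  intro a b ha hb
  obtain ⟨d, hdk, hda⟩ := hd' a ha
  obtain ⟨d', hdk', hdb⟩ := hd' b hb
  have h1 : (straightWalk α).SameCycle (ι d.1, d.2) (ι d'.1, d'.2) ∨
      (straightWalk α).SameCycle (ι d.1, d.2) (turn 2 (ι d'.1, d'.2)) :=
    (hu d d' hdk hdk').imp hmap hmap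
  have tt : ∀ {x y : Dart W}, (straightWalk α).SameCycle x y →
      (straightWalk α).SameCycle (turn 2 x) (turn 2 y) := SameCycle.turn_two hα
  have tl : ∀ {x y : Dart W}, (straightWalk α).SameCycle x (turn 2 y) →
      (straightWalk α).SameCycle (turn 2 x) y := fun {x y} h => by
    have := tt h
    rwa [turn_two_turn_two] at this
  rcases hda with hda | hda <;> rcases hdb with hdb | hdb <;> rcases h1 with h1 | h1
  · exact Or.inl (hda.trans (h1.trans hdb.symm))
  · exact Or.inr (hda.trans (h1.trans (tt hdb.symm)))
  · exact Or.inr (hda.trans (h1.trans (tl hdb).symm))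
  · exact Or.inl (hda.trans (h1.trans hdb.symm))
  · exact Or.inr (hda.trans ((tt h1).trans (tt hdb.symm)))
  · exact Or.inl (hda.trans ((tl h1).trans hdb.symm))
  · exact Or.inl (hda.trans ((tt h1).trans hdb.symm))
  · exact Or.inr (hda.trans ((tl h1).trans (tl hdb).symm))

end Maps

/-! ### Adding vertices to a diagram -/

section Adjoin

variable {V X N : Type}

/-- A dart of the old part of an enlarged map. -/
def oldDart (N : Type) (d : Dart (V ⊕ X)) : Dart (V ⊕ (X ⊕ N)) := (Sum.map id Sum.inl d.1, d.2)

/-- A dart at one of the added vertices. -/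
def newDart (V X : Type) (a : Dart N) : Dart (V ⊕ (X ⊕ N)) := (Sum.inr (Sum.inr a.1), a.2)

theorem oldDart_injective : Function.Injective (oldDart N : Dart (V ⊕ X) → _) := by
  rintro ⟨v | x, i⟩ ⟨v' | x', i'⟩ h <;> simp_all [oldDart]

theorem newDart_injective : Function.Injective (newDart V X : Dart N → _) := by
  rintro ⟨n, i⟩ ⟨n', i'⟩ h
  simp_all [newDart]

theorem oldDart_ne_newDart (d : Dart (V ⊕ X)) (a : Dart N) : oldDart N d ≠ newDart V X a := by
  rcases d with ⟨v | x, i⟩ <;> simp [oldDart, newDart]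

@[simp] theorem oldDart_inj {d d' : Dart (V ⊕ X)} : oldDart N d = oldDart N d' ↔ d = d' :=
  oldDart_injective.eq_iff

@[simp] theorem newDart_inj {a a' : Dart N} : newDart V X a = newDart V X a' ↔ a = a' :=
  newDart_injective.eq_iff

@[simp] theorem oldDart_eq_newDart {d : Dart (V ⊕ X)} {a : Dart N} :
    oldDart N d = newDart V X a ↔ False := iff_false_intro (oldDart_ne_newDart _ _)

@[simp] theorem newDart_eq_oldDart {d : Dart (V ⊕ X)} {a : Dart N} :
    newDart V X a = oldDart N d ↔ False := iff_false_intro (oldDart_ne_newDart _ _).symm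

theorem dart_cases {p : Dart (V ⊕ (X ⊕ N)) → Prop} (ho : ∀ d, p (oldDart N d))
    (hn : ∀ a, p (newDart V X a)) : ∀ d, p d
  | (.inl v, i) => ho (.inl v, i)
  | (.inr (.inl x), i) => ho (.inr x, i)
  | (.inr (.inr n), i) => hn (n, i)

theorem turn_oldDart (k : ZMod 4) (d : Dart (V ⊕ X)) :
    turn k (oldDart N d) = oldDart N (turn k d) := rfl

theorem turn_newDart (k : ZMod 4) (a : Dart N) :
    turn k (newDart V X a) = newDart V X (turn k a) := rfl

/-- The rotation system with the edges of `α` on the old darts and the edges of `γ` on the new darts. -/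
def adjoinEdge (α : Equiv.Perm (Dart (V ⊕ X))) (γ : Equiv.Perm (Dart N)) :
    Equiv.Perm (Dart (V ⊕ (X ⊕ N))) where
  toFun
    | (.inl v, i) => oldDart N (α (.inl v, i))
    | (.inr (.inl x), i) => oldDart N (α (.inr x, i))
    | (.inr (.inr n), i) => newDart V X (γ (n, i))
  invFun
    | (.inl v, i) => oldDart N (α.symm (.inl v, i))
    | (.inr (.inl x), i) => oldDart N (α.symm (.inr x, i))
    | (.inr (.inr n), i) => newDart V X (γ.symm (n, i))
  left_inv := by
    have h : ∀ d : Dart (V ⊕ X), (match oldDart N d with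
      | (.inl v, i) => oldDart N (α.symm (.inl v, i))
      | (.inr (.inl x), i) => oldDart N (α.symm (.inr x, i))
      | (.inr (.inr n), i) => newDart V X (γ.symm (n, i))) = oldDart N (α.symm d) := by
      rintro ⟨v | x, i⟩ <;> rfl
    rintro ⟨v | x | n, i⟩
    · exact (h _).trans (by rw [Equiv.symm_apply_apply]; rfl)
    · exact (h _).trans (by rw [Equiv.symm_apply_apply]; rfl)
    · exact congrArg (newDart V X) (γ.symm_apply_apply (n, i))
  right_inv := by
    have h : ∀ d : Dart (V ⊕ X), (match oldDart N d with
      | (.inl v, i) => oldDart N (α (.inl v, i))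
      | (.inr (.inl x), i) => oldDart N (α (.inr x, i))
      | (.inr (.inr n), i) => newDart V X (γ (n, i))) = oldDart N (α d) := by
      rintro ⟨v | x, i⟩ <;> rfl
    rintro ⟨v | x | n, i⟩
    · exact (h _).trans (by rw [Equiv.apply_symm_apply]; rfl)
    · exact (h _).trans (by rw [Equiv.apply_symm_apply]; rfl)
    · exact congrArg (newDart V X) (γ.apply_symm_apply (n, i))

@[simp] theorem adjoinEdge_oldDart (α : Equiv.Perm (Dart (V ⊕ X))) (γ : Equiv.Perm (Dart N))
    (d : Dart (V ⊕ X)) : adjoinEdge α γ (oldDart N d) = oldDart N (α d) := by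
  rcases d with ⟨v | x, i⟩ <;> rfl

@[simp] theorem adjoinEdge_newDart (α : Equiv.Perm (Dart (V ⊕ X))) (γ : Equiv.Perm (Dart N))
    (a : Dart N) : adjoinEdge α γ (newDart V X a) = newDart V X (γ a) := rfl

/-- The edges of `α` and of `γ`, reconnected by `σ`: the ends of the edges are permuted. -/
def joinEdge (α : Equiv.Perm (Dart (V ⊕ X))) (γ : Equiv.Perm (Dart N))
    (σ : Equiv.Perm (Dart (V ⊕ (X ⊕ N)))) : Equiv.Perm (Dart (V ⊕ (X ⊕ N))) :=
  σ * adjoinEdge α γ * σ⁻¹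

section

variable (α : Equiv.Perm (Dart (V ⊕ X))) (γ : Equiv.Perm (Dart N))
  (σ : Equiv.Perm (Dart (V ⊕ (X ⊕ N))))

/-- The edges of `joinEdge α γ σ` have their ends at the images under `σ` of the ends of the edges
of `α` and `γ`. -/
theorem joinEdge_oldDart (d : Dart (V ⊕ X)) :
    joinEdge α γ σ (σ (oldDart N d)) = σ (oldDart N (α d)) := by
  simp [joinEdge]

theorem joinEdge_newDart (a : Dart N) :
    joinEdge α γ σ (σ (newDart V X a)) = σ (newDart V X (γ a)) := by
  simp [joinEdge]

theorem joinEdge_mul_apply (τ : Equiv.Perm (Dart (V ⊕ (X ⊕ N)))) (d : Dart (V ⊕ (X ⊕ N))) :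
    joinEdge α γ (τ * σ) (τ d) = τ (joinEdge α γ σ d) := by
  simp [joinEdge]

variable {α γ}

theorem dart_cases_perm {p : Dart (V ⊕ (X ⊕ N)) → Prop} (ho : ∀ d, p (σ (oldDart N d)))
    (hn : ∀ a, p (σ (newDart V X a))) : ∀ d, p d := by
  intro d
  have : ∀ d, p (σ d) := dart_cases ho hn
  simpa using this (σ⁻¹ d)

theorem joinEdge_invol (hα : ∀ d, α (α d) = d) (hγ : ∀ d, γ (γ d) = d) :
    ∀ d, joinEdge α γ σ (joinEdge α γ σ d) = d :=
  dart_cases_perm σ (fun d => by rw [joinEdge_oldDart, joinEdge_oldDart, hα])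
    (fun a => by rw [joinEdge_newDart, joinEdge_newDart, hγ])

theorem joinEdge_ne (hα : ∀ d, α d ≠ d) (hγ : ∀ d, γ d ≠ d) : ∀ d, joinEdge α γ σ d ≠ d :=
  dart_cases_perm σ
    (fun d => by
      rw [joinEdge_oldDart, Ne, EmbeddingLike.apply_eq_iff_eq, oldDart_inj]
      exact hα d)
    (fun a => by
      rw [joinEdge_newDart, Ne, EmbeddingLike.apply_eq_iff_eq, newDart_inj]
      exact hγ a)

end

end Adjoin

theorem KnotDart.swap {W : Type} [DecidableEq (Dart W)] {κ : W → Kind} {a b : Dart W}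
    (h : KnotDart κ a ↔ KnotDart κ b) (d : Dart W) :
    KnotDart κ (Equiv.swap a b d) ↔ KnotDart κ d := by
  rw [Equiv.swap_apply_def]
  split_ifs with h1 h2
  · rw [h1, h]
  · rw [h2, h]
  · rfl

namespace Diagram

variable {T : KnotTheory}

theorem edge_knotDart (D : Diagram T) (d : Dart (T.V ⊕ D.X)) :
    KnotDart D.vertexKind (D.edge d) ↔ KnotDart D.vertexKind d := D.edge_onKnot d

theorem knotDart_inr (D : Diagram T) {d : Dart (T.V ⊕ D.X)} (h : KnotDart D.vertexKind d) :
    ∃ x, d.1 = Sum.inr x := by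
  rcases d with ⟨v | x, i⟩
  · exact h.elim
  · exact ⟨x, rfl⟩

/-- Vertices with edges between them that can be added to a diagram. -/
structure Piece (T : KnotTheory) (N : Type) where
  finite : Finite N
  /-- the kinds of the vertices -/
  kind : N → Kind
  kind_ne_frame : ∀ x, kind x ≠ .frame
  kind_ne_virtual : T.virt = false → ∀ x, kind x ≠ .virtual
  /-- the edges -/
  edge : Equiv.Perm (Dart N)
  edge_invol : ∀ d, edge (edge d) = d
  edge_ne : ∀ d, edge d ≠ d
  edge_onKnot : ∀ d, KnotDart kind (edge d) ↔ KnotDart kind d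

/-- The kinds of the vertices of a diagram with an added piece. -/
def adjoinKind {N : Type} (D : Diagram T) (P : Piece T N) : T.V ⊕ (D.X ⊕ N) → Kind :=
  Sum.elim (fun _ => Kind.frame) (Sum.elim D.kind P.kind)

theorem knotDart_oldDart {N : Type} (D : Diagram T) (P : Piece T N) (d : Dart (T.V ⊕ D.X)) :
    KnotDart (D.adjoinKind P) (oldDart N d) ↔ KnotDart D.vertexKind d := by
  rcases d with ⟨v | x, i⟩ <;> rfl

theorem knotDart_newDart {N : Type} (D : Diagram T) (P : Piece T N) (a : Dart N) :
    KnotDart (D.adjoinKind P) (newDart T.V D.X a) ↔ KnotDart P.kind a := Iff.rfl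

section

variable {N : Type} (D : Diagram T) (P : Piece T N) (σ : Equiv.Perm (Dart (T.V ⊕ (D.X ⊕ N))))

theorem joinEdge_knotDart {σ}
    (hσ : ∀ d, KnotDart (D.adjoinKind P) (σ d) ↔ KnotDart (D.adjoinKind P) d) :
    ∀ d, KnotDart (D.adjoinKind P) (joinEdge D.edge P.edge σ d) ↔ KnotDart (D.adjoinKind P) d :=
  dart_cases_perm σ
    (fun d => by
      rw [joinEdge_oldDart, hσ, hσ, knotDart_oldDart, knotDart_oldDart, edge_knotDart])
    (fun a => by
      rw [joinEdge_newDart, hσ, hσ, knotDart_newDart, knotDart_newDart, P.edge_onKnot])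

/-- The diagram that consists of `D` and the piece `P`, reconnected by `σ`. -/
def adjoin (hσ : ∀ d, KnotDart (D.adjoinKind P) (σ d) ↔ KnotDart (D.adjoinKind P) d)
    (hu : Unicursal (D.adjoinKind P) (joinEdge D.edge P.edge σ)) : Diagram T where
  X := D.X ⊕ N
  finite_X := by
    have := D.finite_X
    have := P.finite
    infer_instance
  kind := Sum.elim D.kind P.kind
  kind_ne_frame := by
    rintro (x | x)
    exacts [D.kind_ne_frame x, P.kind_ne_frame x]
  kind_ne_virtual := by
    rintro h (x | x)
    exacts [D.kind_ne_virtual h x, P.kind_ne_virtual h x]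
  edge := joinEdge D.edge P.edge σ
  edge_invol := joinEdge_invol σ D.edge_invol P.edge_invol
  edge_ne := joinEdge_ne σ D.edge_ne P.edge_ne
  edge_onKnot := D.joinEdge_knotDart P hσ
  unicursal := hu

end

/-! ### Kinks -/

/-- The permutation of darts `(x, a) ↦ (f x, s - a)`.  For `f = 1` and odd `s` it joins neighbouring
darts of each vertex by loops; if `f` exchanges two vertices, then it joins them by four edges that
bound bigons. -/
def reflect {N : Type} (f : Equiv.Perm N) (s : ZMod 4) : Equiv.Perm (Dart N) :=
  Equiv.prodCongr f (Equiv.subLeft s)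

@[simp] theorem reflect_apply {N : Type} (f : Equiv.Perm N) (s : ZMod 4) (a : Dart N) :
    reflect f s a = (f a.1, s - a.2) := rfl

/-- A classical crossing with two loops, one between the darts `i` and `i + 1` and one between
`i + 2` and `i + 3`. -/
def kinkPiece (T : KnotTheory) (i : ZMod 4) : Piece T Unit where
  finite := inferInstance
  kind _ := .classical
  kind_ne_frame _ := by simp
  kind_ne_virtual _ _ := by simp
  edge := reflect 1 (2 * i + 1)
  edge_invol d := by simp
  edge_ne := by
    have : ∀ i a : ZMod 4, 2 * i + 1 - a ≠ a := by decide
    rintro ⟨_, a⟩ h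
    exact this i a (Prod.ext_iff.1 h).2
  edge_onKnot _ := Iff.rfl

/-- The places where a kink can be inserted: before a dart of the knot (that is, on its edge and with
a preferred direction), or `none` on a circle without vertices. -/
def IsSite (D : Diagram T) : Option (Dart (T.V ⊕ D.X)) → Prop
  | none => IsEmpty D.X
  | some c => KnotDart D.vertexKind c

open Classical in
/-- The reconnection that inserts the kink at a site.  One of the loops of the piece is cut open and
takes the place of the edge of `c`.  For the site `none` the circle itself is replaced by the second
loop of the piece. -/
noncomputable def kinkPerm (D : Diagram T) (i : ZMod 4) :
    Option (Dart (T.V ⊕ D.X)) → Equiv.Perm (Dart (T.V ⊕ (D.X ⊕ Unit)))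
  | none => 1
  | some c => Equiv.swap (newDart T.V D.X ((), i + 2)) (oldDart Unit c)

theorem knotDart_kinkPerm (D : Diagram T) (i : ZMod 4) (s : Option (Dart (T.V ⊕ D.X)))
    (hs : D.IsSite s) (d : Dart (T.V ⊕ (D.X ⊕ Unit))) :
    KnotDart (D.adjoinKind (kinkPiece T i)) (D.kinkPerm i s d) ↔
      KnotDart (D.adjoinKind (kinkPiece T i)) d := by
  cases s with
  | none => rfl
  | some c =>
    classical
    have h : KnotDart (D.adjoinKind (kinkPiece T i)) (newDart T.V D.X ((), i + 2)) := trivial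
    exact KnotDart.swap (iff_of_true h ((D.knotDart_oldDart (kinkPiece T i) c).2 hs)) d

/-- The edges of the diagram with a kink. -/
noncomputable def kinkEdge (D : Diagram T) (i : ZMod 4) (s : Option (Dart (T.V ⊕ D.X))) :
    Equiv.Perm (Dart (T.V ⊕ (D.X ⊕ Unit))) :=
  joinEdge D.edge (kinkPiece T i).edge (D.kinkPerm i s)

section

variable (D : Diagram T) (i : ZMod 4)

/-- The dart number `a` of the crossing of a kink. -/
abbrev kinkDart (a : ZMod 4) : Dart (T.V ⊕ (D.X ⊕ Unit)) := newDart T.V D.X ((), a)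

theorem kinkEdge_invol (s) : ∀ d, D.kinkEdge i s (D.kinkEdge i s d) = d :=
  joinEdge_invol _ D.edge_invol (kinkPiece T i).edge_invol

theorem kinkPerm_kinkDart (s) {a : ZMod 4} (ha : a ≠ i + 2) :
    D.kinkPerm i s (D.kinkDart a) = D.kinkDart a := by
  cases s with
  | none => rfl
  | some c =>
    classical exact Equiv.swap_apply_of_ne_of_ne (by simpa using ha) (by simp)

theorem kinkPerm_self (c) : D.kinkPerm i (some c) (D.kinkDart (i + 2)) = oldDart Unit c := by
  classical exact Equiv.swap_apply_left _ _

theorem kinkPerm_oldDart_self (c) : D.kinkPerm i (some c) (oldDart Unit c) = D.kinkDart (i + 2) := by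
  classical exact Equiv.swap_apply_right _ _

theorem kinkPerm_oldDart {s} {d : Dart (T.V ⊕ D.X)} (h : s ≠ some d) :
    D.kinkPerm i s (oldDart Unit d) = oldDart Unit d := by
  cases s with
  | none => rfl
  | some c =>
    classical
    refine Equiv.swap_apply_of_ne_of_ne (by simp) ?_
    simpa using fun h' : d = c => h (h' ▸ rfl)

theorem kinkEdge_kinkDart (s) {a : ZMod 4} (b : ZMod 4) (ha : a ≠ i + 2)
    (hb : 2 * i + 1 - a = b) :
    D.kinkEdge i s (D.kinkDart a) = D.kinkPerm i s (D.kinkDart b) := by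
  subst hb
  have := joinEdge_newDart D.edge (kinkPiece T i).edge (D.kinkPerm i s) ((), a)
  rw [D.kinkPerm_kinkDart i s ha] at this
  exact this

theorem kinkEdge_zero (s) : D.kinkEdge i s (D.kinkDart i) = D.kinkDart (i + 1) := by
  rw [D.kinkEdge_kinkDart i s (i + 1) (by revert i; decide) (by ring),
    kinkPerm_kinkDart _ _ _ (by revert i; decide)]

theorem kinkEdge_one (s) : D.kinkEdge i s (D.kinkDart (i + 1)) = D.kinkDart i := by
  rw [← kinkEdge_zero D i s, kinkEdge_invol]

theorem kinkEdge_three (c) : D.kinkEdge i (some c) (D.kinkDart (i + 3)) = oldDart Unit c := by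
  rw [D.kinkEdge_kinkDart i _ (i + 2) (by revert i; decide) (by revert i; decide), kinkPerm_self]

theorem kinkEdge_self (c) : D.kinkEdge i (some c) (oldDart Unit c) = D.kinkDart (i + 3) := by
  rw [← D.kinkEdge_three i c, kinkEdge_invol]

theorem kinkEdge_kinkPerm_oldDart (s) (d : Dart (T.V ⊕ D.X)) :
    D.kinkEdge i s (D.kinkPerm i s (oldDart Unit d)) = D.kinkPerm i s (oldDart Unit (D.edge d)) :=
  joinEdge_oldDart D.edge (kinkPiece T i).edge _ d

theorem kinkEdge_two (c) :
    D.kinkEdge i (some c) (D.kinkDart (i + 2)) = oldDart Unit (D.edge c) := by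
  rw [← kinkPerm_oldDart_self, kinkEdge_kinkPerm_oldDart, kinkPerm_oldDart]
  simpa using (D.edge_ne c).symm

theorem kinkEdge_oldDart {s} {d : Dart (T.V ⊕ D.X)} (h : s ≠ some d) (h' : s ≠ some (D.edge d)) :
    D.kinkEdge i s (oldDart Unit d) = oldDart Unit (D.edge d) := by
  rw [← kinkPerm_oldDart D i h', ← kinkEdge_kinkPerm_oldDart, kinkPerm_oldDart D i h]

theorem compl_range_inl : (Set.range (Sum.map id Sum.inl : T.V ⊕ D.X → T.V ⊕ (D.X ⊕ Unit)))ᶜ =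
    {Sum.inr (Sum.inr ())} := by
  ext (v | x | u) <;> simp

theorem kinkDart_mem (a : ZMod 4) : (D.kinkDart a).1 ∈
    (Set.range (Sum.map id Sum.inl : T.V ⊕ D.X → T.V ⊕ (D.X ⊕ Unit)))ᶜ := by
  rw [compl_range_inl]
  rfl

/-- The thread through the kink: it passes the crossing, the loop, and the crossing again. -/
theorem kinkEdge_thread {s : Option (Dart (T.V ⊕ D.X))} (d : Dart (T.V ⊕ D.X)) :
    Thread (D.kinkEdge i s) (Set.range (Sum.map id Sum.inl : T.V ⊕ D.X → T.V ⊕ (D.X ⊕ Unit)))ᶜ 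
      (oldDart Unit d) (oldDart Unit (D.edge d)) := by
  have key : ∀ c, s = some c → Thread (D.kinkEdge i s)
      (Set.range (Sum.map id Sum.inl : T.V ⊕ D.X → T.V ⊕ (D.X ⊕ Unit)))ᶜ (oldDart Unit c)
      (oldDart Unit (D.edge c)) := by
    rintro c rfl
    refine .cross_of_eq (D.kinkEdge_self i c) (D.kinkDart_mem _) ?_
    rw [turn_newDart, show turn 2 ((), i + 3) = ((), i + 1) by
      simp; revert i; decide]
    refine .cross_of_eq (D.kinkEdge_one i _) (D.kinkDart_mem _) ?_
    exact .of_eq (D.kinkEdge_two i c)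
  by_cases h : s = some d
  · exact key d h
  by_cases h' : s = some (D.edge d)
  · have := (key _ h').symm (D.kinkEdge_invol i s)
    rwa [D.edge_invol] at this
  · exact .of_eq (D.kinkEdge_oldDart i h h')

theorem kinkEdge_erasesTo (s) : ErasesTo (D.kinkEdge i s) D.edge (Sum.map id Sum.inl) :=
  erasesTo_iff.2 fun d => D.kinkEdge_thread i d

theorem kinkEdge_unicursal {s} (hs : D.IsSite s) :
    Unicursal (D.adjoinKind (kinkPiece T i)) (D.kinkEdge i s) := by
  have hz : ∀ k : ZMod 4, k = 0 ∨ k = 1 ∨ k = 2 ∨ k = 3 := by decide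
  have hi : ∀ a : ZMod 4, ∃ k, a = i + k := fun a => ⟨a - i, by ring⟩
  have e1 : i + 1 + 2 = i + 3 := by revert i; decide
  have e2 : i + 2 + 2 = i := by revert i; decide
  have e3 : i + 3 + 2 = i + 1 := by revert i; decide
  have h03 : (straightWalk (D.kinkEdge i s)).SameCycle (D.kinkDart i) (D.kinkDart (i + 3)) := by
    have := (SameCycle.refl (straightWalk (D.kinkEdge i s)) (D.kinkDart i)).apply_right
    rwa [straightWalk_apply, kinkEdge_zero, turn_newDart, turn_apply, e1] at this
  have h12 : (straightWalk (D.kinkEdge i s)).SameCycle (D.kinkDart (i + 1))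
      (D.kinkDart (i + 2)) := by
    have := (SameCycle.refl (straightWalk (D.kinkEdge i s)) (D.kinkDart (i + 1))).apply_right
    rwa [straightWalk_apply, kinkEdge_one, turn_newDart, turn_apply] at this
  cases s with
  | none =>
    have hX : IsEmpty D.X := hs
    have h20 : turn 2 (D.kinkDart (i + 2)) = D.kinkDart i := by
      rw [turn_newDart, turn_apply, e2]
    have h31 : turn 2 (D.kinkDart (i + 3)) = D.kinkDart (i + 1) := by
      rw [turn_newDart, turn_apply, e3]
    have h13 : turn 2 (D.kinkDart (i + 1)) = D.kinkDart (i + 3) := by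
      rw [turn_newDart, turn_apply, e1]
    have h02 : turn 2 (D.kinkDart i) = D.kinkDart (i + 2) := by
      rw [turn_newDart, turn_apply]
    refine dart_cases (fun d => dart_cases (fun d' h => ?_) fun a h => ?_)
      (fun a => dart_cases (fun d' h h' => ?_) fun a' h h' => ?_)
    · obtain ⟨x, -⟩ := D.knotDart_inr ((D.knotDart_oldDart (kinkPiece T i) d).1 h)
      exact hX.elim x
    · obtain ⟨x, -⟩ := D.knotDart_inr ((D.knotDart_oldDart (kinkPiece T i) d).1 h)
      exact hX.elim x
    · obtain ⟨x, -⟩ := D.knotDart_inr ((D.knotDart_oldDart (kinkPiece T i) d').1 h')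
      exact hX.elim x
    · obtain ⟨⟨⟩, a⟩ := a
      obtain ⟨⟨⟩, a'⟩ := a'
      obtain ⟨k, rfl⟩ := hi a
      obtain ⟨k', rfl⟩ := hi a'
      rcases hz k with rfl | rfl | rfl | rfl <;> rcases hz k' with rfl | rfl | rfl | rfl <;>
        (try simp only [add_zero]) <;>
        (try simp only [h20, h31, h13, h02]) <;>
        simp only [SameCycle.refl, h03, h12, h03.symm, h12.symm, true_or, or_true]
  | some c =>
    refine Unicursal.of_erasesTo (D.kinkEdge_invol i _)
      (D.joinEdge_knotDart _ (D.knotDart_kinkPerm i (some c) hs)) (fun w => by cases w <;> rfl)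
      (D.kinkEdge_erasesTo i _) D.unicursal (dart_cases (fun d hd => ?_) fun a _ _ => ⟨c, ?_⟩)
    · exact absurd ⟨d.1, rfl⟩ hd
    · change _ ∨ (straightWalk (D.kinkEdge i (some c))).SameCycle _ (turn 2 (oldDart Unit c))
      have h3c : (straightWalk (D.kinkEdge i (some c))).SameCycle (D.kinkDart (i + 3))
          (turn 2 (oldDart Unit c)) := by
        have := (SameCycle.refl (straightWalk (D.kinkEdge i (some c)))
          (D.kinkDart (i + 3))).apply_right
        rwa [straightWalk_apply, kinkEdge_three] at this
      have hc1 : (straightWalk (D.kinkEdge i (some c))).SameCycle (oldDart Unit c)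
          (D.kinkDart (i + 1)) := by
        have := (SameCycle.refl (straightWalk (D.kinkEdge i (some c)))
          (oldDart Unit c)).apply_right
        rwa [straightWalk_apply, kinkEdge_self, turn_newDart, turn_apply, e3] at this
      obtain ⟨⟨⟩, a⟩ := a
      obtain ⟨k, rfl⟩ := hi a
      rcases hz k with rfl | rfl | rfl | rfl
      · rw [add_zero]
        exact Or.inr (h03.trans h3c)
      · exact Or.inl hc1.symm
      · exact Or.inl (hc1.trans h12).symm
      · exact Or.inr h3c

/-- The diagram `D` with a kink at the site `s`.  Its loop runs between the darts `i` and `i + 1` of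
the new crossing; the darts `i + 2` and `i + 3` are connected with the rest of the diagram, and
`i + 3` is connected with `c` if `s = some c`. -/
noncomputable def kink {s} (hs : D.IsSite s) : Diagram T :=
  D.adjoin (kinkPiece T i) (D.kinkPerm i s) (D.knotDart_kinkPerm i s hs)
    (D.kinkEdge_unicursal i hs)

/-- The kink can be removed. -/
def kinkFirstMove {s} (hs : D.IsSite s) : FirstMove (D.kink i hs) D where
  keep := Sum.inl
  keep_inj := Sum.inl_injective
  kind_eq _ := rfl
  erases := D.kinkEdge_erasesTo i s
  u := Sum.inr ()
  range_keep := by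
    change Set.range (Sum.inl : D.X → D.X ⊕ Unit) = {Sum.inr ()}ᶜ
    ext (x | u) <;> simp
  i := i
  loop := D.kinkEdge_zero i s

end

end Diagram

/-! ### Moving a kink past a vertex -/

/-- Sums of quarter turns, reduced modulo four. -/
theorem quarter_add (a : ZMod 4) : a + 1 + 2 = a + 3 ∧ a + 2 + 2 = a ∧ a + 3 + 2 = a + 1 ∧
    a + -1 = a + 3 ∧ a + 1 + -1 = a ∧ a + 2 + -1 = a + 1 ∧ a + 3 + -1 = a + 2 ∧
    a + 3 + 1 = a ∧ a + 3 + 3 = a + 2 ∧ a + 2 + 1 = a + 3 ∧ a + 2 + 3 = a + 1 ∧ a + 1 + 1 = a + 2 ∧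
    a + 1 + 3 = a := by
  revert a
  decide

theorem quarter_cases (a b : ZMod 4) : b = a ∨ b = a + 1 ∨ b = a + 2 ∨ b = a + 3 := by
  revert a b
  decide

theorem quarter_ne : (1 : ZMod 4) ≠ 0 ∧ (2 : ZMod 4) ≠ 0 ∧ (3 : ZMod 4) ≠ 0 ∧ (1 : ZMod 4) ≠ 2 ∧
    (1 : ZMod 4) ≠ 3 ∧ (2 : ZMod 4) ≠ 1 ∧ (2 : ZMod 4) ≠ 3 ∧ (3 : ZMod 4) ≠ 1 ∧
    (3 : ZMod 4) ≠ 2 ∧ (0 : ZMod 4) ≠ 1 ∧ (0 : ZMod 4) ≠ 2 ∧ (0 : ZMod 4) ≠ 3 := by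
  decide

theorem even_add_three_iff (a : ZMod 4) : ¬ (Even (a + 3) ↔ Even a) := by
  simp only [Even]
  revert a
  decide

theorem quarter_two_mul_sub (a : ZMod 4) : 2 * a - (a + 1) = a + 3 ∧ 2 * a - (a + 2) = a + 2 ∧
    2 * a - (a + 3) = a + 1 ∧ 2 * a - a = a := by
  revert a
  decide

namespace Diagram

section

variable {W : Type} {x y z : W} (i j k : ZMod 4)

theorem exchange_apply (hxy : x ≠ y) (hyz : y ≠ z) (hzx : z ≠ x) :
    (exchange x y z i j k (x, i) = (y, j + 3) ∧ exchange x y z i j k (x, i + 1) = (z, k + 2) ∧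
      exchange x y z i j k (x, i + 2) = (y, j + 1) ∧ exchange x y z i j k (x, i + 3) = (z, k)) ∧
    (exchange x y z i j k (y, j) = (z, k + 3) ∧ exchange x y z i j k (y, j + 1) = (x, i + 2) ∧
      exchange x y z i j k (y, j + 2) = (z, k + 1) ∧ exchange x y z i j k (y, j + 3) = (x, i)) ∧
    (exchange x y z i j k (z, k) = (x, i + 3) ∧ exchange x y z i j k (z, k + 1) = (y, j + 2) ∧
      exchange x y z i j k (z, k + 2) = (x, i + 1) ∧ exchange x y z i j k (z, k + 3) = (y, j)) := by
  obtain ⟨h1, h2, h3, h4, h5, h6, h7, h8, h9, h10, h11, h12⟩ := quarter_ne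
  simp [exchange, Equiv.swap_apply_def, hxy, hyz, hzx, hxy.symm, hyz.symm, hzx.symm,
    h1, h2, h3, h4, h5, h6, h7, h8, h9]

theorem exchange_apply_of_ne {d : Dart W} (hx : d.1 ≠ x) (hy : d.1 ≠ y) (hz : d.1 ≠ z) :
    exchange x y z i j k d = d := by
  obtain ⟨w, a⟩ := d
  simp_all [exchange, Equiv.swap_apply_def]

theorem KnotDart.exchange {κ : W → Kind} {x y z : W} {i j k : ZMod 4}
    (h₁ : KnotDart κ (x, i + 2) ↔ KnotDart κ (y, j + 1))
    (h₂ : KnotDart κ (x, i) ↔ KnotDart κ (y, j + 3))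
    (h₃ : KnotDart κ (y, j + 2) ↔ KnotDart κ (z, k + 1))
    (h₄ : KnotDart κ (y, j) ↔ KnotDart κ (z, k + 3))
    (h₅ : KnotDart κ (z, k + 2) ↔ KnotDart κ (x, i + 1))
    (h₆ : KnotDart κ (z, k) ↔ KnotDart κ (x, i + 3))
    (d : Dart W) : KnotDart κ (exchange x y z i j k d) ↔ KnotDart κ d := by
  classical
  simp only [Diagram.exchange, Equiv.Perm.mul_apply]
  rw [KnotDart.swap h₁, KnotDart.swap h₂, KnotDart.swap h₃, KnotDart.swap h₄, KnotDart.swap h₅,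
    KnotDart.swap h₆]

end

variable {T : KnotTheory}

/-- Two vertices of the same kind, connected by four edges in such a way that neighbouring edges
bound bigons: the dart `j + k` of one vertex is joined with the dart `j - k` of the other one. -/
def bigonPiece (q : Kind) (hq : q ≠ .frame) (hv : T.virt = false → q ≠ .virtual) (j : ZMod 4) :
    Piece T Bool where
  finite := inferInstance
  kind _ := q
  kind_ne_frame _ := hq
  kind_ne_virtual h _ := hv h
  edge := reflect Equiv.boolNot (2 * j)
  edge_invol d := by simp
  edge_ne := by
    rintro ⟨b, a⟩ h
    have := (Prod.ext_iff.1 h).1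
    simp at this
  edge_onKnot := by
    rintro ⟨b, a⟩
    change q.OnKnot (2 * j - a) ↔ q.OnKnot a
    cases q with
    | transit =>
      simp only [Kind.OnKnot, Even]
      revert j a
      decide
    | _ => rfl

section Slide

variable (D : Diagram T) (i : ZMod 4) (x : D.X) (j : ZMod 4)

/-- The edges of the diagram with a kink right before the vertex `x`, which is entered through its
dart `j`. -/
noncomputable abbrev kinkBefore : Equiv.Perm (Dart (T.V ⊕ (D.X ⊕ Unit))) :=
  D.kinkEdge i (some (Sum.inr x, j))

/-- The edges of the diagram with a kink right behind the vertex `x`, which is left through its dart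
`j + 2`. -/
noncomputable abbrev kinkAfter : Equiv.Perm (Dart (T.V ⊕ (D.X ⊕ Unit))) :=
  D.kinkEdge i (some (D.edge (Sum.inr x, j + 2)))

/-- A dart of the crossing of the kink. -/
abbrev uD (a : ZMod 4) : Dart (T.V ⊕ ((D.X ⊕ Unit) ⊕ Bool)) := oldDart Bool (D.kinkDart a)

/-- A dart of the vertex that the kink passes. -/
abbrev vD (a : ZMod 4) : Dart (T.V ⊕ ((D.X ⊕ Unit) ⊕ Bool)) :=
  oldDart Bool (oldDart Unit (Sum.inr x, a))

/-- A dart of the new vertex that is adjacent to the crossing of the kink. -/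
abbrev qD (a : ZMod 4) : Dart (T.V ⊕ ((D.X ⊕ Unit) ⊕ Bool)) :=
  newDart T.V (D.X ⊕ Unit) (false, a)

/-- A dart of the other new vertex. -/
abbrev pD (a : ZMod 4) : Dart (T.V ⊕ ((D.X ⊕ Unit) ⊕ Bool)) :=
  newDart T.V (D.X ⊕ Unit) (true, a)

open Classical in
/-- The reconnection that moves a finger of the strand through `(x, j + 3)` across the loop of the
kink. -/
noncomputable def fingerPerm : Equiv.Perm (Dart (T.V ⊕ ((D.X ⊕ Unit) ⊕ Bool))) :=
  Equiv.swap (D.pD (j + 3)) (D.vD x (j + 3)) * Equiv.swap (D.pD j) (D.uD i)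

/-- The edges of the diagram with the kink before `x` and the finger. -/
noncomputable def fingerEdge : Equiv.Perm (Dart (T.V ⊕ ((D.X ⊕ Unit) ⊕ Bool))) :=
  joinEdge (D.kinkBefore i x j) (reflect Equiv.boolNot (2 * j)) (D.fingerPerm i x j)

/-- The exchange of darts in the third move on the triangle between the kink, `x` and the finger. -/
noncomputable def slidePerm : Equiv.Perm (Dart (T.V ⊕ ((D.X ⊕ Unit) ⊕ Bool))) :=
  exchange (Sum.inr (Sum.inl (Sum.inr ()))) (Sum.inr (Sum.inl (Sum.inl x)))
    (Sum.inr (Sum.inr false)) (i + 3) (j + 3) j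

/-- The edges of the diagram after the third move. -/
noncomputable def slidEdge : Equiv.Perm (Dart (T.V ⊕ ((D.X ⊕ Unit) ⊕ Bool))) :=
  joinEdge (D.kinkBefore i x j) (reflect Equiv.boolNot (2 * j))
    (D.slidePerm i x j * D.fingerPerm i x j)

theorem fingerPerm_p3 : D.fingerPerm i x j (D.pD (j + 3)) = D.vD x (j + 3) := by
  simp [fingerPerm, Equiv.swap_apply_def, quarter_ne]

theorem fingerPerm_v3 : D.fingerPerm i x j (D.vD x (j + 3)) = D.pD (j + 3) := by
  simp [fingerPerm, Equiv.swap_apply_def, oldDart, newDart]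

theorem fingerPerm_p0 : D.fingerPerm i x j (D.pD j) = D.uD i := by
  simp [fingerPerm, Equiv.swap_apply_def, oldDart, newDart]

theorem fingerPerm_u0 : D.fingerPerm i x j (D.uD i) = D.pD j := by
  simp [fingerPerm, Equiv.swap_apply_def, quarter_ne]

theorem fingerPerm_q (a : ZMod 4) : D.fingerPerm i x j (D.qD a) = D.qD a := by
  simp [fingerPerm, Equiv.swap_apply_def]

theorem fingerPerm_p {a : ZMod 4} (h : a ≠ j) (h' : a ≠ j + 3) :
    D.fingerPerm i x j (D.pD a) = D.pD a := by
  simp [fingerPerm, Equiv.swap_apply_def, h, h']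

theorem fingerPerm_old {d : Dart (T.V ⊕ (D.X ⊕ Unit))} (h : d ≠ oldDart Unit (Sum.inr x, j + 3))
    (h' : d ≠ D.kinkDart i) : D.fingerPerm i x j (oldDart Bool d) = oldDart Bool d := by
  simp [fingerPerm, Equiv.swap_apply_def, h, h']

theorem fingerPerm_u {a : ZMod 4} (h : a ≠ i) : D.fingerPerm i x j (D.uD a) = D.uD a :=
  D.fingerPerm_old i x j (by simp) (by simpa using h)

theorem fingerEdge_invol : ∀ d, D.fingerEdge i x j (D.fingerEdge i x j d) = d :=
  joinEdge_invol _ (D.kinkEdge_invol i _) (fun a => by simp)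

theorem slidEdge_invol : ∀ d, D.slidEdge i x j (D.slidEdge i x j d) = d :=
  joinEdge_invol _ (D.kinkEdge_invol i _) (fun a => by simp)

theorem fingerEdge_new (b : Bool) (a : ZMod 4) :
    D.fingerEdge i x j (D.fingerPerm i x j (newDart T.V (D.X ⊕ Unit) (b, a))) =
      D.fingerPerm i x j (newDart T.V (D.X ⊕ Unit) (!b, 2 * j - a)) :=
  joinEdge_newDart _ _ _ _

theorem fingerEdge_old (d : Dart (T.V ⊕ (D.X ⊕ Unit))) :
    D.fingerEdge i x j (D.fingerPerm i x j (oldDart Bool d)) =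
      D.fingerPerm i x j (oldDart Bool (D.kinkBefore i x j d)) :=
  joinEdge_oldDart _ _ _ _

theorem fingerEdge_v3 : D.fingerEdge i x j (D.vD x (j + 3)) = D.qD (j + 1) := by
  rw [← fingerPerm_p3 D i, fingerEdge_new, (quarter_two_mul_sub j).2.2.1]
  exact D.fingerPerm_q i x j _

theorem fingerEdge_u0 : D.fingerEdge i x j (D.uD i) = D.qD j := by
  rw [← fingerPerm_p0 D i x, fingerEdge_new, (quarter_two_mul_sub j).2.2.2]
  exact D.fingerPerm_q i x j _

theorem fingerEdge_q2 : D.fingerEdge i x j (D.qD (j + 2)) = D.pD (j + 2) := by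
  rw [← fingerPerm_q D i x j, fingerEdge_new, (quarter_two_mul_sub j).2.1]
  exact D.fingerPerm_p i x j (by simp [quarter_ne]) (by simp [quarter_ne])

theorem fingerEdge_q3 : D.fingerEdge i x j (D.qD (j + 3)) = D.pD (j + 1) := by
  rw [← fingerPerm_q D i x j, fingerEdge_new, (quarter_two_mul_sub j).2.2.1]
  exact D.fingerPerm_p i x j (by simp [quarter_ne]) (by simp [quarter_ne])

theorem fingerEdge_p0 : D.fingerEdge i x j (D.pD j) = D.uD (i + 1) := by
  rw [← fingerPerm_u0 D i x, fingerEdge_old, kinkEdge_zero, fingerPerm_u]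
  simp [quarter_ne]

theorem fingerEdge_u3 : D.fingerEdge i x j (D.uD (i + 3)) = D.vD x j := by
  rw [← fingerPerm_u D i x j (a := i + 3) (by simp [quarter_ne]), fingerEdge_old, kinkEdge_three,
    fingerPerm_old]
  · simp [quarter_ne]
  · simp

/-- The third move takes the edges of the diagram with the finger to the edges of the diagram after
the move. -/
theorem slidEdge_slidePerm (d : Dart (T.V ⊕ ((D.X ⊕ Unit) ⊕ Bool))) :
    D.slidEdge i x j (D.slidePerm i x j d) = D.slidePerm i x j (D.fingerEdge i x j d) :=
  joinEdge_mul_apply _ _ _ _ _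

theorem slidePerm_apply :
    (D.slidePerm i x j (D.uD i) = D.qD (j + 2) ∧ D.slidePerm i x j (D.uD (i + 1)) = D.vD x j ∧
      D.slidePerm i x j (D.uD (i + 2)) = D.qD j ∧
      D.slidePerm i x j (D.uD (i + 3)) = D.vD x (j + 2)) ∧
    (D.slidePerm i x j (D.vD x j) = D.uD (i + 1) ∧
      D.slidePerm i x j (D.vD x (j + 1)) = D.qD (j + 1) ∧
      D.slidePerm i x j (D.vD x (j + 2)) = D.uD (i + 3) ∧
      D.slidePerm i x j (D.vD x (j + 3)) = D.qD (j + 3)) ∧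
    (D.slidePerm i x j (D.qD j) = D.uD (i + 2) ∧
      D.slidePerm i x j (D.qD (j + 1)) = D.vD x (j + 1) ∧
      D.slidePerm i x j (D.qD (j + 2)) = D.uD i ∧
      D.slidePerm i x j (D.qD (j + 3)) = D.vD x (j + 3)) := by
  have := exchange_apply (x := (Sum.inr (Sum.inl (Sum.inr ())) : T.V ⊕ ((D.X ⊕ Unit) ⊕ Bool)))
    (y := Sum.inr (Sum.inl (Sum.inl x))) (z := Sum.inr (Sum.inr false)) (i + 3) (j + 3) j
    (by simp) (by simp) (by simp)
  obtain ⟨-, -, i3, -, -, -, -, i31, i33, -⟩ := quarter_add i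
  obtain ⟨-, -, j3, -, -, -, -, j31, j33, -⟩ := quarter_add j
  have i32 := (quarter_add i).2.2.1
  rw [i31, i33, i32, j31, j33, j3] at this
  obtain ⟨⟨h1, h2, h3, h4⟩, ⟨h5, h6, h7, h8⟩, h9, h10, h11, h12⟩ := this
  exact ⟨⟨h2, h3, h4, h1⟩, ⟨h6, h7, h8, h5⟩, h9, h10, h11, h12⟩

theorem slidePerm_p (a : ZMod 4) : D.slidePerm i x j (D.pD a) = D.pD a :=
  exchange_apply_of_ne _ _ _ (by simp [newDart]) (by simp [newDart]) (by simp [newDart])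

theorem slidePerm_old {d : Dart (T.V ⊕ D.X)} (h : d.1 ≠ Sum.inr x) :
    D.slidePerm i x j (oldDart Bool (oldDart Unit d)) = oldDart Bool (oldDart Unit d) := by
  refine exchange_apply_of_ne _ _ _ ?_ ?_ ?_ <;> rcases d with ⟨v | y, a⟩ <;>
    simp [oldDart] at h ⊢
  exact h

theorem slidEdge_q3 : D.slidEdge i x j (D.qD (j + 3)) = D.vD x (j + 1) := by
  rw [← (D.slidePerm_apply i x j).2.1.2.2.2, slidEdge_slidePerm, fingerEdge_v3,
    (D.slidePerm_apply i x j).2.2.2.1]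

theorem slidEdge_q2 : D.slidEdge i x j (D.qD (j + 2)) = D.uD (i + 2) := by
  rw [← (D.slidePerm_apply i x j).1.1, slidEdge_slidePerm, fingerEdge_u0,
    (D.slidePerm_apply i x j).2.2.1]

theorem slidEdge_p0 : D.slidEdge i x j (D.pD j) = D.vD x j := by
  rw [← D.slidePerm_p i x j, slidEdge_slidePerm, fingerEdge_p0, (D.slidePerm_apply i x j).1.2.1]

theorem slidEdge_u0 : D.slidEdge i x j (D.uD i) = D.pD (j + 2) := by
  rw [← (D.slidePerm_apply i x j).2.2.2.2.1, slidEdge_slidePerm, fingerEdge_q2, slidePerm_p]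

theorem slidEdge_v3 : D.slidEdge i x j (D.vD x (j + 3)) = D.pD (j + 1) := by
  rw [← (D.slidePerm_apply i x j).2.2.2.2.2, slidEdge_slidePerm, fingerEdge_q3, slidePerm_p]

theorem slidEdge_v2 : D.slidEdge i x j (D.vD x (j + 2)) = D.uD (i + 1) := by
  rw [← (D.slidePerm_apply i x j).1.2.2.2, slidEdge_slidePerm, fingerEdge_u3,
    (D.slidePerm_apply i x j).2.1.1]

end Slide

end Diagram

/-- Two darts that are joined with the ends of an edge by threads are joined by a thread. -/
theorem Thread.of_ends {W : Type} {α : Equiv.Perm (Dart W)} {S : Set W} (hα : ∀ d, α (α d) = d)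
    {a b a' b' : Dart W} (e : α a' = b')
    (ha : a' = a ∨ ∃ c, c.1 ∈ S ∧ Thread α S a c ∧ turn 2 c = a')
    (hb : b' = b ∨ ∃ c, c.1 ∈ S ∧ Thread α S b c ∧ turn 2 c = b') : Thread α S a b := by
  have h1 : Thread α S a b' := by
    rcases ha with rfl | ⟨c, hc, t, rfl⟩
    · exact .of_eq e
    · exact t.trans hc (.of_eq e)
  rcases hb with rfl | ⟨c, hc, t, rfl⟩
  · exact h1
  · exact (t.trans hc (h1.symm hα)).symm hα

theorem sameCycle_of_edge {W : Type} {α : Equiv.Perm (Dart W)} {a b c : Dart W} (h : α a = b)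
    (hc : turn 2 b = c) : (straightWalk α).SameCycle a c :=
  hc ▸ (Thread.of_eq (S := ∅) h).sameCycle

namespace Diagram

variable {T : KnotTheory} (D : Diagram T) (i : ZMod 4) (x : D.X) (j : ZMod 4)

theorem fingerEdge_erasesTo :
    ErasesTo (D.fingerEdge i x j) (D.kinkBefore i x j) (Sum.map id Sum.inl) := by
  refine erasesTo_iff.2 fun y => ?_
  change Thread _ _ (oldDart Bool y) (oldDart Bool _)
  have hS : ∀ a : Dart Bool, (newDart T.V (D.X ⊕ Unit) a).1 ∈ (Set.range
      (Sum.map id Sum.inl : T.V ⊕ (D.X ⊕ Unit) → T.V ⊕ ((D.X ⊕ Unit) ⊕ Bool)))ᶜ := by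
    rintro ⟨b, a⟩ ⟨v | y, h⟩ <;> simp [newDart] at h
  have key : ∀ y, D.fingerPerm i x j (oldDart Bool y) = oldDart Bool y ∨ ∃ c, c.1 ∈ (Set.range
      (Sum.map id Sum.inl : T.V ⊕ (D.X ⊕ Unit) → T.V ⊕ ((D.X ⊕ Unit) ⊕ Bool)))ᶜ ∧
      Thread (D.fingerEdge i x j) (Set.range
        (Sum.map id Sum.inl : T.V ⊕ (D.X ⊕ Unit) → T.V ⊕ ((D.X ⊕ Unit) ⊕ Bool)))ᶜ
        (oldDart Bool y) c ∧ turn 2 c = D.fingerPerm i x j (oldDart Bool y) := by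
    intro y
    by_cases h : y = oldDart Unit (Sum.inr x, j + 3)
    · subst h
      refine Or.inr ⟨D.pD (j + 1), hS _, ?_, ?_⟩
      · refine .cross_of_eq (D.fingerEdge_v3 i x j) (hS _) ?_
        rw [turn_newDart, turn_apply, (quarter_add j).1]
        exact .of_eq (D.fingerEdge_q3 i x j)
      · rw [turn_newDart, turn_apply, (quarter_add j).1, fingerPerm_v3]
    by_cases h' : y = D.kinkDart i
    · subst h'
      refine Or.inr ⟨D.pD (j + 2), hS _, ?_, ?_⟩
      · refine .cross_of_eq (D.fingerEdge_u0 i x j) (hS _) ?_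
        exact .of_eq (D.fingerEdge_q2 i x j)
      · rw [turn_newDart, turn_apply, (quarter_add j).2.1, fingerPerm_u0]
    · exact Or.inl (D.fingerPerm_old i x j h h')
  exact .of_ends (D.fingerEdge_invol i x j) (D.fingerEdge_old i x j y) (key y) (key _)

/-- The vertices that are added by the finger. -/
def fingerPiece : Piece T Bool :=
  bigonPiece (D.kind x) (D.kind_ne_frame x) (fun h => D.kind_ne_virtual h x) j

/-- The kinds of the vertices of the diagrams with a finger. -/
def fingerKind : T.V ⊕ ((D.X ⊕ Unit) ⊕ Bool) → Kind :=
  Sum.elim (fun _ => .frame) (Sum.elim (Sum.elim D.kind fun _ => .classical) fun _ => D.kind x)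

variable {x j}

/-- The diagram with a kink before the vertex `x`. -/
noncomputable def kinkAt (hc : KnotDart D.vertexKind (Sum.inr x, j)) :
    Diagram T := D.kink i (s := some (Sum.inr x, j)) hc

theorem knotDart_fingerPerm (hc : KnotDart D.vertexKind (Sum.inr x, j)) (d) :
    KnotDart (D.fingerKind x) (D.fingerPerm i x j d) ↔ KnotDart (D.fingerKind x) d := by
  classical
  have hp : KnotDart (D.fingerKind x) (D.pD j) := hc
  have hu : KnotDart (D.fingerKind x) (D.uD i) := trivial
  have h : KnotDart (D.fingerKind x) (D.pD (j + 3)) ↔ KnotDart (D.fingerKind x) (D.vD x (j + 3)) :=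
    Iff.rfl
  rw [fingerPerm, Equiv.Perm.mul_apply, KnotDart.swap h, KnotDart.swap (iff_of_true hp hu)]

theorem knotDart_slidePerm (hc : KnotDart D.vertexKind (Sum.inr x, j)) (d) :
    KnotDart (D.fingerKind x) (D.slidePerm i x j d) ↔ KnotDart (D.fingerKind x) d := by
  have h2 : (D.kind x).OnKnot (j + 2) := (Kind.onKnot_add_two _ _).2 hc
  have e : ∀ a : ZMod 4, a + 3 + 1 = a ∧ a + 3 + 3 = a + 2 ∧ a + 3 + 2 = a + 1 := by decide
  refine KnotDart.exchange ?_ ?_ ?_ ?_ ?_ ?_ d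
  · rw [(e j).1]
    exact iff_of_true trivial hc
  · rw [(e j).2.1]
    exact iff_of_true trivial h2
  · rw [(e j).2.2]
    rfl
  · rfl
  · exact iff_of_true h2 trivial
  · exact iff_of_true hc trivial

theorem knotDart_fingerEdge (hc : KnotDart D.vertexKind (Sum.inr x, j)) (d) :
    KnotDart (D.fingerKind x) (D.fingerEdge i x j d) ↔ KnotDart (D.fingerKind x) d :=
  (D.kinkAt i hc).joinEdge_knotDart (D.fingerPiece x j) (D.knotDart_fingerPerm i hc) d

theorem knotDart_slidEdge (hc : KnotDart D.vertexKind (Sum.inr x, j)) (d) :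
    KnotDart (D.fingerKind x) (D.slidEdge i x j d) ↔ KnotDart (D.fingerKind x) d :=
  (D.kinkAt i hc).joinEdge_knotDart (D.fingerPiece x j)
    (σ := D.slidePerm i x j * D.fingerPerm i x j)
    (fun d => (D.knotDart_slidePerm i hc (D.fingerPerm i x j d)).trans
      (D.knotDart_fingerPerm i hc d)) d

theorem fingerEdge_unicursal (hc : KnotDart D.vertexKind (Sum.inr x, j)) :
    Unicursal (D.fingerKind x) (D.fingerEdge i x j) := by
  refine Unicursal.of_erasesTo (D.fingerEdge_invol i x j) (D.knotDart_fingerEdge i hc)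
    (fun w => by cases w <;> rfl) (D.fingerEdge_erasesTo i x j)
    (D.kinkEdge_unicursal i (s := some (Sum.inr x, j)) hc)
    (dart_cases (fun d hd => absurd ⟨d.1, rfl⟩ hd) ?_)
  rintro ⟨b, a⟩ - -
  obtain ⟨j12, j22, j32, -⟩ := quarter_add j
  have tn : ∀ {b : Bool} {a a' : ZMod 4}, a + 2 = a' →
      turn 2 (newDart T.V (D.X ⊕ Unit) (b, a)) = newDart T.V (D.X ⊕ Unit) (b, a') := by
    rintro b a _ rfl
    rfl
  have iv : ∀ {a b}, D.fingerEdge i x j a = b → D.fingerEdge i x j b = a := fun {a b} h => by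
    rw [← h, fingerEdge_invol]
  have hu0 := sameCycle_of_edge (D.fingerEdge_u0 i x j) (tn rfl)
  have hq2 := sameCycle_of_edge (D.fingerEdge_q2 i x j) (tn j22)
  have hv3 := sameCycle_of_edge (D.fingerEdge_v3 i x j) (tn j12)
  have hq3 := sameCycle_of_edge (D.fingerEdge_q3 i x j) (tn j12)
  have hq0 := sameCycle_of_edge (iv (D.fingerEdge_u0 i x j)) rfl
  have hp2 := sameCycle_of_edge (iv (D.fingerEdge_q2 i x j)) (tn j22)
  have hq1 := sameCycle_of_edge (iv (D.fingerEdge_v3 i x j)) rfl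
  have hp1 := sameCycle_of_edge (iv (D.fingerEdge_q3 i x j)) (tn j32)
  change ∃ d, _ ∨ (straightWalk (D.fingerEdge i x j)).SameCycle _ (turn 2 (oldDart Bool d))
  rcases quarter_cases j a with rfl | rfl | rfl | rfl <;> cases b
  · exact ⟨_, Or.inr hq0⟩
  · exact ⟨D.kinkDart i, Or.inl (hu0.trans hq2).symm⟩
  · exact ⟨_, Or.inr hq1⟩
  · exact ⟨_, Or.inr (hp1.trans hq1)⟩
  · exact ⟨D.kinkDart i, Or.inl hu0.symm⟩
  · exact ⟨_, Or.inr (hp2.trans hq0)⟩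
  · exact ⟨oldDart Unit (Sum.inr x, j + 3), Or.inl hv3.symm⟩
  · exact ⟨oldDart Unit (Sum.inr x, j + 3), Or.inl (hv3.trans hq3).symm⟩

/-- The vertices of the diagram with the kink behind `x`, as vertices of the diagram after the third
move: the old vertex `x` is going to disappear, and a new one takes its place. -/
noncomputable def slideKeep (x : D.X) : D.X ⊕ Unit → (D.X ⊕ Unit) ⊕ Bool := by
  classical
  exact Sum.elim (fun y => if y = x then Sum.inr false else Sum.inl (Sum.inl y))
    (fun _ => Sum.inl (Sum.inr ()))

theorem slideKeep_inl_self : D.slideKeep x (Sum.inl x) = Sum.inr false := if_pos rfl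

theorem slideKeep_inl_of_ne {y : D.X} (h : y ≠ x) :
    D.slideKeep x (Sum.inl y) = Sum.inl (Sum.inl y) := if_neg h

theorem slideKeep_cases (y : D.X ⊕ Unit) : (y = Sum.inl x ∧ D.slideKeep x y = Sum.inr false) ∨
    (y ≠ Sum.inl x ∧ D.slideKeep x y = Sum.inl y) := by
  classical
  rcases y with y | ⟨⟩
  · by_cases h : y = x
    · subst h
      exact Or.inl ⟨rfl, D.slideKeep_inl_self⟩
    · exact Or.inr ⟨by simpa using h, D.slideKeep_inl_of_ne h⟩
  · exact Or.inr ⟨by simp, rfl⟩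

theorem slideKeep_kind (y : D.X ⊕ Unit) :
    Sum.elim (Sum.elim D.kind fun _ => Kind.classical) (fun _ => D.kind x) (D.slideKeep x y) =
      Sum.elim D.kind (fun _ => Kind.classical) y := by
  rcases D.slideKeep_cases (x := x) y with ⟨rfl, hy'⟩ | ⟨-, hy'⟩ <;> rw [hy'] <;> rfl

theorem slideKeep_injective : Function.Injective (D.slideKeep x) := by
  intro y z h
  rcases D.slideKeep_cases (x := x) y with ⟨hy, hy'⟩ | ⟨hy, hy'⟩ <;>
    rcases D.slideKeep_cases (x := x) z with ⟨hz, hz'⟩ | ⟨hz, hz'⟩ <;> rw [hy', hz'] at h <;>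
    simp_all

theorem range_slideKeep :
    Set.range (D.slideKeep x) = {Sum.inl (Sum.inl x), Sum.inr true}ᶜ := by
  ext z
  simp only [Set.mem_range, Set.mem_compl_iff, Set.mem_insert_iff, Set.mem_singleton_iff, not_or]
  constructor
  · rintro ⟨y, rfl⟩
    rcases D.slideKeep_cases (x := x) y with ⟨hy, hy'⟩ | ⟨hy, hy'⟩ <;> rw [hy'] <;> simp [hy]
  · rintro ⟨h, h'⟩
    rcases z with y | b
    · refine ⟨y, ?_⟩
      rcases D.slideKeep_cases (x := x) y with ⟨hy, hy'⟩ | ⟨hy, hy'⟩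
      · exact absurd (congrArg Sum.inl hy) h
      · exact hy'
    · cases b
      · exact ⟨_, D.slideKeep_inl_self⟩
      · exact absurd rfl h'

theorem slidEdge_erasesTo (x : D.X) (j : ZMod 4) :
    ErasesTo (D.slidEdge i x j) (D.kinkAfter i x j) (Sum.map id (D.slideKeep x)) := by
  classical
  refine erasesTo_iff.2 ?_
  set S := (Set.range (Sum.map id (D.slideKeep x)))ᶜ with hS
  have hvS : ∀ a, (D.vD x a).1 ∈ S := by
    rintro a ⟨v | y, h⟩
    · simp [oldDart] at h
    · have : Sum.inl (Sum.inl x) ∈ Set.range (D.slideKeep x) := ⟨y, by simpa [oldDart] using h⟩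
      rw [range_slideKeep] at this
      simp at this
  have hpS : ∀ a, (D.pD a).1 ∈ S := by
    rintro a ⟨v | y, h⟩
    · simp [newDart] at h
    · have : Sum.inr true ∈ Set.range (D.slideKeep x) := ⟨y, by simpa [newDart] using h⟩
      rw [range_slideKeep] at this
      simp at this
  set J : Dart (T.V ⊕ (D.X ⊕ Unit)) → Dart (T.V ⊕ ((D.X ⊕ Unit) ⊕ Bool)) :=
    fun d => (Sum.map id (D.slideKeep x) d.1, d.2) with hJ
  have Jv : ∀ a, J (oldDart Unit (Sum.inr x, a)) = D.qD a := fun a => by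
    simp [hJ, oldDart, newDart, slideKeep_inl_self]
  have Ju : ∀ a, J (D.kinkDart a) = D.uD a := fun a => rfl
  have Jo : ∀ d : Dart (T.V ⊕ D.X), d.1 ≠ Sum.inr x →
      J (oldDart Unit d) = oldDart Bool (oldDart Unit d) := by
    rintro ⟨v | y, a⟩ h
    · rfl
    · have : y ≠ x := by simpa using h
      simp [hJ, oldDart, slideKeep_inl_of_ne, this]
  obtain ⟨j12, j22, j32, -⟩ := quarter_add j
  -- the ends of the edges of `D` in the diagram after the slide and in the diagram of the third move
  set ρ : Dart (T.V ⊕ D.X) → Dart (T.V ⊕ (D.X ⊕ Unit)) :=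
    fun d => if d = (Sum.inr x, j + 2) then D.kinkDart (i + 3) else oldDart Unit d with hρ
  set π : Dart (T.V ⊕ D.X) → Dart (T.V ⊕ ((D.X ⊕ Unit) ⊕ Bool)) := fun d =>
    D.slidePerm i x j (D.fingerPerm i x j (oldDart Bool
      (D.kinkPerm i (some (Sum.inr x, j)) (oldDart Unit d)))) with hπ
  have eρ : ∀ d, D.kinkAfter i x j (ρ d) = ρ (D.edge d) := by
    intro d
    have hne := D.edge_ne (Sum.inr x, j + 2)
    by_cases h : d = (Sum.inr x, j + 2)
    · subst h
      simp only [hρ, if_true, if_neg hne, kinkAfter, kinkEdge_three]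
    by_cases h' : D.edge d = (Sum.inr x, j + 2)
    · have : d = D.edge (Sum.inr x, j + 2) := by rw [← h', D.edge_invol]
      simp only [hρ, if_neg h, if_pos h']
      rw [this, kinkAfter, kinkEdge_self]
    · simp only [hρ, if_neg h, if_neg h']
      refine kinkEdge_oldDart _ _ ?_ ?_
      · rw [Ne, Option.some_inj]
        rintro rfl
        exact h' (D.edge_invol _)
      · rw [Ne, Option.some_inj, D.edge.injective.eq_iff]
        exact fun h'' => h h''.symm
  have eπ : ∀ d, D.slidEdge i x j (π d) = π (D.edge d) := by
    intro d
    rw [hπ]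
    simp only [slidEdge_slidePerm, fingerEdge_old, kinkBefore, kinkEdge_kinkPerm_oldDart]
  have πo : ∀ d : Dart (T.V ⊕ D.X), d.1 ≠ Sum.inr x → π d = oldDart Bool (oldDart Unit d) := by
    intro d h
    have h' : ∀ a, d ≠ (Sum.inr x, a) := fun a h' => h (by rw [h'])
    simp only [hπ]
    rw [kinkPerm_oldDart, fingerPerm_old, slidePerm_old _ _ _ _ h]
    · simpa using h' _
    · simp
    · simpa using (h' _).symm
  obtain ⟨⟨-, -, su2, -⟩, ⟨-, sv1, sv2, -⟩, -⟩ := D.slidePerm_apply i x j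
  have πv0 : π (Sum.inr x, j) = D.qD j := by
    simp only [hπ]
    rw [kinkPerm_oldDart_self, fingerPerm_u, su2]
    simp [quarter_ne]
  have πv : ∀ a : ZMod 4, a ≠ j → a ≠ j + 3 → π (Sum.inr x, a) = D.slidePerm i x j (D.vD x a) := by
    intro a h h'
    simp only [hπ]
    rw [kinkPerm_oldDart, fingerPerm_old]
    · simpa using h'
    · simp
    · simpa using h.symm
  have πv3 : π (Sum.inr x, j + 3) = D.pD (j + 3) := by
    simp only [hπ]
    rw [kinkPerm_oldDart, fingerPerm_v3, slidePerm_p]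
    simp [quarter_ne]
  have key : ∀ d, π d = J (ρ d) ∨ ∃ c, c.1 ∈ S ∧ Thread (D.slidEdge i x j) S (J (ρ d)) c ∧
      turn 2 c = π d := by
    intro d
    by_cases h : d.1 = Sum.inr x
    · obtain ⟨w, a⟩ := d
      subst h
      rcases quarter_cases j a with rfl | rfl | rfl | rfl
      · left
        rw [πv0, hρ]
        simp [quarter_ne, Jv]
      · left
        rw [πv _ (by simp [quarter_ne]) (by simp [quarter_ne]), sv1, hρ]
        simp [quarter_ne, Jv]
      · left
        rw [πv _ (by simp [quarter_ne]) (by simp [quarter_ne]), sv2, hρ]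
        simp [Ju]
      · right
        refine ⟨D.pD (j + 1), hpS _, ?_, ?_⟩
        · have : ρ (Sum.inr x, j + 3) = oldDart Unit (Sum.inr x, j + 3) := by
            rw [hρ]
            simp [quarter_ne]
          rw [this, Jv]
          refine .cross_of_eq (D.slidEdge_q3 i x j) (hvS _) ?_
          rw [turn_oldDart, turn_oldDart, turn_apply, j12]
          exact .of_eq (D.slidEdge_v3 i x j)
        · rw [turn_newDart, turn_apply, j12, πv3]
    · left
      rw [πo d h, hρ]
      have h' : d ≠ (Sum.inr x, j + 2) := fun h' => h (by rw [h'])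
      simp only [if_neg h', Jo d h]
  have hρt : ∀ d, Thread (D.slidEdge i x j) S (J (ρ d)) (J (D.kinkAfter i x j (ρ d))) := by
    intro d
    rw [eρ]
    exact .of_ends (D.slidEdge_invol i x j) (eπ d) (key d) (key _)
  have hsymm : ∀ d, Thread (D.slidEdge i x j) S (J d) (J (D.kinkAfter i x j d)) →
      Thread (D.slidEdge i x j) S (J (D.kinkAfter i x j d))
        (J (D.kinkAfter i x j (D.kinkAfter i x j d))) := by
    intro d h
    rw [kinkEdge_invol]
    exact h.symm (D.slidEdge_invol i x j)
  have iv : ∀ {a b}, D.slidEdge i x j a = b → D.slidEdge i x j b = a := fun {a b} h => by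
    rw [← h, slidEdge_invol]
  have t0 : Thread (D.slidEdge i x j) S (J (D.kinkDart i)) (J (D.kinkAfter i x j (D.kinkDart i))) := by
    rw [kinkAfter, kinkEdge_zero, Ju, Ju]
    refine .cross_of_eq (D.slidEdge_u0 i x j) (hpS _) ?_
    rw [turn_newDart, turn_apply, j22]
    refine .cross_of_eq (D.slidEdge_p0 i x j) (hvS _) ?_
    exact .of_eq (D.slidEdge_v2 i x j)
  have t2 : Thread (D.slidEdge i x j) S (J (D.kinkDart (i + 2)))
      (J (D.kinkAfter i x j (D.kinkDart (i + 2)))) := by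
    rw [kinkAfter, kinkEdge_two, D.edge_invol, Ju, Jv]
    exact .of_eq (iv (D.slidEdge_q2 i x j))
  refine dart_cases (fun d => ?_) ?_
  · change Thread _ _ (J (oldDart Unit d)) (J _)
    by_cases h : d = (Sum.inr x, j + 2)
    · have := hsymm _ t2
      rw [kinkAfter, kinkEdge_two, D.edge_invol] at this
      rwa [h]
    · have := hρt d
      simp only [hρ, if_neg h] at this
      exact this
  · rintro ⟨⟨⟩, a⟩
    change Thread _ _ (J (D.kinkDart a)) (J _)
    rcases quarter_cases i a with rfl | rfl | rfl | rfl
    · exact t0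
    · have := hsymm _ t0
      rwa [kinkAfter, kinkEdge_zero] at this
    · exact t2
    · have := hρt (Sum.inr x, j + 2)
      simp only [hρ, if_true] at this
      exact this

theorem slidEdge_unicursal (hc : KnotDart D.vertexKind (Sum.inr x, j)) :
    Unicursal (D.fingerKind x) (D.slidEdge i x j) := by
  have hc' : KnotDart D.vertexKind (D.edge (Sum.inr x, j + 2)) :=
    (D.edge_knotDart _).2 ((KnotDart.turn_two D.vertexKind (Sum.inr x, j)).2 hc)
  refine Unicursal.of_erasesTo (κ' := D.adjoinKind (kinkPiece T i)) (D.slidEdge_invol i x j)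
    (D.knotDart_slidEdge i hc) ?_ (D.slidEdge_erasesTo i x j)
    (D.kinkEdge_unicursal i (s := some (D.edge (Sum.inr x, j + 2))) hc') ?_
  · rintro (v | y)
    · rfl
    · exact (D.slideKeep_kind y).trans (by cases y <;> rfl)
  rintro ⟨w, a⟩ hw -
  obtain ⟨j12, j22, j32, -⟩ := quarter_add j
  have tn : ∀ {b : Bool} {a a' : ZMod 4}, a + 2 = a' →
      turn 2 (newDart T.V (D.X ⊕ Unit) (b, a)) = newDart T.V (D.X ⊕ Unit) (b, a') := by
    rintro b a _ rfl
    rfl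
  have tv : ∀ {a a' : ZMod 4}, a + 2 = a' → turn 2 (D.vD x a) = D.vD x a' := by
    rintro a _ rfl
    rfl
  have tu : ∀ {a a' : ZMod 4}, a + 2 = a' → turn 2 (D.uD a) = D.uD a' := by
    rintro a _ rfl
    rfl
  have iv : ∀ {a b}, D.slidEdge i x j a = b → D.slidEdge i x j b = a := fun {a b} h => by
    rw [← h, slidEdge_invol]
  have cq : ∀ a, (Sum.map id (D.slideKeep x) (Sum.inr (Sum.inl x)), a) = D.qD a := fun a => by
    simp [slideKeep_inl_self, newDart]
  have hq3 := sameCycle_of_edge (D.slidEdge_q3 i x j) (tv j12)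
  have hv1 := sameCycle_of_edge (iv (D.slidEdge_q3 i x j)) rfl
  have hv3 := sameCycle_of_edge (D.slidEdge_v3 i x j) (tn j12)
  have hp1 := sameCycle_of_edge (iv (D.slidEdge_v3 i x j)) (tv j32)
  have hu0 := sameCycle_of_edge (D.slidEdge_u0 i x j) (tn j22)
  have hp0 := sameCycle_of_edge (D.slidEdge_p0 i x j) (tv rfl)
  have hv0 := sameCycle_of_edge (iv (D.slidEdge_p0 i x j)) (tn rfl)
  have hp2 := sameCycle_of_edge (iv (D.slidEdge_u0 i x j)) rfl
  have hq : ∀ a b, (straightWalk (D.slidEdge i x j)).SameCycle b (D.qD a) ∨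
      (straightWalk (D.slidEdge i x j)).SameCycle b (turn 2 (D.qD a)) →
      ∃ d : Dart (T.V ⊕ (D.X ⊕ Unit)), (straightWalk (D.slidEdge i x j)).SameCycle b
          (Sum.map id (D.slideKeep x) d.1, d.2) ∨
        (straightWalk (D.slidEdge i x j)).SameCycle b
          (turn 2 (Sum.map id (D.slideKeep x) d.1, d.2)) := by
    intro a b h
    refine ⟨oldDart Unit (Sum.inr x, a), ?_⟩
    rw [← cq] at h
    exact h
  have hu : ∀ a b, (straightWalk (D.slidEdge i x j)).SameCycle b (D.uD a) ∨
      (straightWalk (D.slidEdge i x j)).SameCycle b (turn 2 (D.uD a)) →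
      ∃ d : Dart (T.V ⊕ (D.X ⊕ Unit)), (straightWalk (D.slidEdge i x j)).SameCycle b
          (Sum.map id (D.slideKeep x) d.1, d.2) ∨
        (straightWalk (D.slidEdge i x j)).SameCycle b
          (turn 2 (Sum.map id (D.slideKeep x) d.1, d.2)) :=
    fun a b h => ⟨D.kinkDart a, h⟩
  rcases w with v | z
  · exact absurd ⟨Sum.inl v, rfl⟩ hw
  have hz : z ∉ Set.range (D.slideKeep x) := by
    rintro ⟨y, rfl⟩
    exact hw ⟨Sum.inr y, rfl⟩
  rw [range_slideKeep, Set.notMem_compl_iff] at hz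
  rcases hz with rfl | rfl <;> rcases quarter_cases j a with rfl | rfl | rfl | rfl
  · exact hu _ _ (Or.inr (hv0.trans hp2))
  · exact hq _ _ (Or.inr hv1)
  · exact hu _ _ (Or.inl (hu0.trans hp0).symm)
  · exact hq _ _ (Or.inl hq3.symm)
  · exact hu _ _ (Or.inl hu0.symm)
  · exact hq _ _ (Or.inr (hp1.trans hv1))
  · exact hu _ _ (Or.inr hp2)
  · exact hq _ _ (Or.inl (hq3.trans hv3).symm)

end Diagram

/-- A cycle of length three contains only its three elements. -/
theorem not_sameCycle_of_three {A : Type*} {f : Equiv.Perm A} {a b c d : A} (hab : f a = b)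
    (hbc : f b = c) (hca : f c = a) (hda : d ≠ a) (hdb : d ≠ b) (hdc : d ≠ c) :
    ¬ f.SameCycle a d := by
  intro h
  have := SameCycle.map_eq (f := f) (φ := fun x => x = a ∨ x = b ∨ x = c) (fun x => ?_) h
  · have h' : d = a ∨ d = b ∨ d = c := this ▸ Or.inl rfl
    rcases h' with h' | h' | h'
    exacts [hda h', hdb h', hdc h']
  · have e1 : f x = a ↔ x = c := by rw [← hca, f.injective.eq_iff]
    have e2 : f x = b ↔ x = a := by rw [← hab, f.injective.eq_iff]
    have e3 : f x = c ↔ x = b := by rw [← hbc, f.injective.eq_iff]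
    rw [e1, e2, e3]
    exact propext (by tauto)

namespace Diagram

variable {T : KnotTheory} (D : Diagram T) (i : ZMod 4) {x : D.X} {j : ZMod 4}

theorem knotDart_next (hc : KnotDart D.vertexKind (Sum.inr x, j)) :
    KnotDart D.vertexKind (D.edge (Sum.inr x, j + 2)) :=
  (D.edge_knotDart _).2 ((KnotDart.turn_two D.vertexKind (Sum.inr x, j)).2 hc)

/-- The diagram with a kink behind the vertex `x`. -/
noncomputable def kinkPast (hc : KnotDart D.vertexKind (Sum.inr x, j)) : Diagram T :=
  D.kink i (s := some (D.edge (Sum.inr x, j + 2))) (D.knotDart_next hc)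

/-- The diagram with the kink before `x` and the finger. -/
noncomputable def finger (hc : KnotDart D.vertexKind (Sum.inr x, j)) : Diagram T :=
  (D.kinkAt i hc).adjoin (D.fingerPiece x j) (D.fingerPerm i x j) (D.knotDart_fingerPerm i hc)
    (D.fingerEdge_unicursal i hc)

/-- The diagram after the third move. -/
noncomputable def slid (hc : KnotDart D.vertexKind (Sum.inr x, j)) : Diagram T :=
  (D.kinkAt i hc).adjoin (D.fingerPiece x j) (D.slidePerm i x j * D.fingerPerm i x j)
    (fun d => (D.knotDart_slidePerm i hc (D.fingerPerm i x j d)).trans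
      (D.knotDart_fingerPerm i hc d)) (D.slidEdge_unicursal i hc)

/-- Pulling the finger back. -/
def fingerMove (hc : KnotDart D.vertexKind (Sum.inr x, j)) :
    SecondMove (D.finger i hc) (D.kinkAt i hc) where
  keep := Sum.inl
  keep_inj := Sum.inl_injective
  kind_eq _ := rfl
  erases := D.fingerEdge_erasesTo i x j
  u := Sum.inr false
  v := Sum.inr true
  ne := by
    change (Sum.inr false : (D.X ⊕ Unit) ⊕ Bool) ≠ Sum.inr true
    simp
  range_keep := by
    change Set.range (Sum.inl : D.X ⊕ Unit → (D.X ⊕ Unit) ⊕ Bool) = {Sum.inr false, Sum.inr true}ᶜ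
    ext (x | _ | _) <;> simp
  i := j + 2
  j := j + 1
  side₁ := by
    rw [(quarter_add j).2.2.2.2.2.2.2.2.2.2.2.1]
    exact D.fingerEdge_q2 i x j
  side₂ := by
    rw [(quarter_add j).2.2.2.2.2.2.2.2.2.1]
    exact D.fingerEdge_q3 i x j
  same_kind := rfl
  layers _ _ := by rw [(quarter_add j).2.2.2.2.2.2.2.2.2.2.2.1]
  -- the face opposite to the bigon is the triangle, which the other vertex of the bigon is not on
  disc := by
    rw [(quarter_add j).1, (quarter_add j).2.1]
    change ¬ (faceWalk (D.fingerEdge i x j)).SameCycle (D.qD j) (D.pD (j + 3))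
    refine not_sameCycle_of_three (b := D.uD (i + 3)) (c := D.vD x (j + 3)) ?_ ?_ ?_ ?_ ?_ ?_
    · rw [faceWalk_apply, ← fingerEdge_u0 D i x j, fingerEdge_invol, turn_oldDart, turn_newDart,
        turn_apply, (quarter_add i).2.2.2.1]
    · rw [faceWalk_apply, fingerEdge_u3, turn_oldDart, turn_oldDart, turn_apply,
        (quarter_add j).2.2.2.1]
    · rw [faceWalk_apply, fingerEdge_v3, turn_newDart, turn_apply, (quarter_add j).2.2.2.2.1]
    all_goals simp

/-- The third move on the triangle between the kink, `x` and the finger. -/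
def slideMove (hc : KnotDart D.vertexKind (Sum.inr x, j)) :
    ThirdMove (D.finger i hc) (D.slid i hc) where
  toEquiv := Equiv.refl ((D.X ⊕ Unit) ⊕ Bool)
  kind_eq _ := rfl
  x := Sum.inr (Sum.inl (Sum.inr ()))
  y := Sum.inr (Sum.inl (Sum.inl x))
  z := Sum.inr (Sum.inr false)
  ne_xy h := by cases h
  ne_yz h := by cases h
  ne_zx h := by cases h
  i := i + 3
  j := j + 3
  k := j
  side₁ := by
    rw [(quarter_add j).2.2.2.2.2.2.2.1]
    exact D.fingerEdge_u3 i x j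
  side₂ := D.fingerEdge_v3 i x j
  side₃ := by
    rw [(quarter_add i).2.2.2.2.2.2.2.1]
    have := D.fingerEdge_invol i x j (D.uD i)
    rwa [fingerEdge_u0] at this
  admissible := by
    change (Kind.classical = .classical ∧ D.kind x = .classical ∧ D.kind x = .classical ∧ _) ∨
      (∃ q, (q = .virtual ∨ q = .transit) ∧ ((Kind.classical = q ∧ D.kind x = q) ∨
        (D.kind x = q ∧ D.kind x = q) ∨ (D.kind x = q ∧ Kind.classical = q)))
    have hf := D.kind_ne_frame x
    cases h : D.kind x with
    | classical => exact Or.inl ⟨rfl, rfl, rfl, fun _ h => even_add_three_iff j h.2⟩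
    | virtual => exact Or.inr ⟨_, Or.inl rfl, Or.inr (Or.inl ⟨rfl, rfl⟩)⟩
    | transit => exact Or.inr ⟨_, Or.inr rfl, Or.inr (Or.inl ⟨rfl, rfl⟩)⟩
    | frame => exact absurd h hf
  edge_eq := by
    rintro d d' rfl
    have h : ∀ d : Dart (T.V ⊕ ((D.X ⊕ Unit) ⊕ Bool)),
        ((Sum.map id (Equiv.refl ((D.X ⊕ Unit) ⊕ Bool)) d.1, d.2) :
          Dart (T.V ⊕ ((D.X ⊕ Unit) ⊕ Bool))) = d := by
      rintro ⟨v | y, a⟩ <;> rfl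
    refine (congrArg (D.slidEdge i x j) (h (D.slidePerm i x j d))).trans ?_
    exact (D.slidEdge_slidePerm i x j d).trans (h (D.slidePerm i x j (D.fingerEdge i x j d))).symm

/-- Pulling the finger out on the other side of the kink. -/
noncomputable def slidMove (hc : KnotDart D.vertexKind (Sum.inr x, j)) :
    SecondMove (D.slid i hc) (D.kinkPast i hc) where
  keep := D.slideKeep x
  keep_inj := D.slideKeep_injective
  kind_eq := D.slideKeep_kind
  erases := D.slidEdge_erasesTo i x j
  u := Sum.inl (Sum.inl x)
  v := Sum.inr true
  ne := by
    change (Sum.inl (Sum.inl x) : (D.X ⊕ Unit) ⊕ Bool) ≠ Sum.inr true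
    simp
  range_keep := D.range_slideKeep
  i := j + 3
  j := j
  side₁ := D.slidEdge_v3 i x j
  side₂ := by
    rw [(quarter_add j).2.2.2.2.2.2.2.1]
    have := D.slidEdge_invol i x j (D.pD j)
    rwa [slidEdge_p0] at this
  same_kind := rfl
  layers _ _ := by
    have : ∀ j : ZMod 4, Even (j + 3) ↔ Even (j + 1) := by
      simp only [Even]
      decide
    exact this j
  -- again, the face opposite to the bigon is the triangle
  disc := by
    rw [(quarter_add j).2.2.1]
    change ¬ (faceWalk (D.slidEdge i x j)).SameCycle (D.vD x (j + 1)) (D.pD (j + 2))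
    refine not_sameCycle_of_three (b := D.qD (j + 2)) (c := D.uD (i + 1)) ?_ ?_ ?_ ?_ ?_ ?_
    · rw [faceWalk_apply, ← slidEdge_q3 D i x j, slidEdge_invol, turn_newDart,
        turn_apply, (quarter_add j).2.2.2.2.2.2.1]
    · rw [faceWalk_apply, slidEdge_q2, turn_oldDart, turn_newDart, turn_apply,
        (quarter_add i).2.2.2.2.2.1]
    · rw [faceWalk_apply, ← slidEdge_v2 D i x j, slidEdge_invol, turn_oldDart, turn_oldDart,
        turn_apply, (quarter_add j).2.2.2.2.2.1]
    all_goals simp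

end Diagram

/-! ### Odd crossings -/

namespace Diagram

variable {T : KnotTheory} {D₀ : Diagram T} (ψ : ∀ D : DiagramOf D₀, D.1.Crossing → ZMod 2)

/-- `D` is a diagram of the knot, and `x` is a classical crossing of it at which the weak parity `ψ`
is `1`. -/
def OddAt (D : Diagram T) (x : D.X) : Prop :=
  ∃ (h : Relation.ReflTransGen (fun D D' => ∃ R, Elementary D D' R) D₀ D)
    (hx : D.kind x = .classical), ψ ⟨D, h⟩ ⟨x, hx⟩ = 1

/-- The diagram `D` with a kink at the site `s` is a diagram of the knot, and `ψ` is `1` at the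
crossing of the kink. -/
def OddKink (D : Diagram T) (i : ZMod 4) (s : Option (Dart (T.V ⊕ D.X))) : Prop :=
  ∃ hs : D.IsSite s, OddAt ψ (D.kink i hs) (Sum.inr ())

variable {ψ} {D D' : Diagram T} {R : D.X → D'.X → Prop}

theorem OddAt.elementary (hψ : IsWeakParity D₀ ψ) (f : Elementary D D' R) {x : D.X} {x' : D'.X}
    (hR : R x x') (hx' : D'.kind x' = .classical) (h : OddAt ψ D x) : OddAt ψ D' x' := by
  obtain ⟨hD, hx, h⟩ := h
  refine ⟨hD.tail ⟨R, f⟩, hx', ?_⟩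
  rw [← h]
  exact (hψ.psi0 ⟨D, hD⟩ ⟨D', hD.tail ⟨R, f⟩⟩ R f ⟨x, hx⟩ ⟨x', hx'⟩ hR).symm

theorem oddAt_iff_of_secondMove (hψ : IsWeakParity D₀ ψ) (f : SecondMove D D') :
    OddAt ψ D f.u ↔ OddAt ψ D f.v := by
  have key : ∀ (h : Relation.ReflTransGen (fun D D' => ∃ R, Elementary D D' R) D₀ D)
      (hu : D.kind f.u = .classical) (hv : D.kind f.v = .classical),
      ψ ⟨D, h⟩ ⟨f.u, hu⟩ = ψ ⟨D, h⟩ ⟨f.v, hv⟩ := fun h hu hv =>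
    hψ.psi2 ⟨D, h⟩ ⟨D', h.tail ⟨_, .second f⟩⟩ f ⟨f.u, hu⟩ ⟨f.v, hv⟩ rfl rfl
  constructor
  · rintro ⟨h, hu, e⟩
    exact ⟨h, f.same_kind ▸ hu, (key h hu _) ▸ e⟩
  · rintro ⟨h, hv, e⟩
    exact ⟨h, f.same_kind ▸ hv, (key h _ hv) ▸ e⟩

theorem OddAt.thirdMove (hψ : IsWeakParity D₀ ψ) (f : ThirdMove D D') {x y z : D.X}
    (hx : Sum.inr x = f.x) (hy : Sum.inr y = f.y) (hz : Sum.inr z = f.z)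
    (ky : D.kind y = .classical) (kz : D.kind z = .classical) (h : OddAt ψ D x)
    (hyz : OddAt ψ D y ↔ OddAt ψ D z) : OddAt ψ D y := by
  obtain ⟨hD, kx, h⟩ := h
  have := hψ.psi3 ⟨D, hD⟩ ⟨D', hD.tail ⟨_, .third f⟩⟩ f ⟨x, kx⟩ ⟨y, ky⟩ ⟨z, kz⟩ hx hy hz
  have key : ∀ a : ZMod 2, a = 0 ∨ a = 1 := by decide
  rcases key (ψ ⟨D, hD⟩ ⟨y, ky⟩) with hy | hy
  · rcases key (ψ ⟨D, hD⟩ ⟨z, kz⟩) with hz | hz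
    · rw [h, hy, hz] at this
      exact absurd rfl this
    · exact hyz.2 ⟨hD, kz, hz⟩
  · exact ⟨hD, ky, hy⟩

/-- An odd kink can be moved past the next vertex, and that vertex is odd if it is a classical
crossing.  Of the three crossings of the triangle in the third move, the kink is odd and the other
two have the same parity, because a second move removes each of them together with the same third
crossing; so all of them are odd. -/
theorem OddKink.slide (hψ : IsWeakParity D₀ ψ) {i : ZMod 4} {x : D.X} {j : ZMod 4}
    (h : OddKink ψ D i (some (Sum.inr x, j))) :
    OddKink ψ D i (some (D.edge (Sum.inr x, j + 2))) ∧
      (D.kind x = .classical → OddAt ψ D x) := by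
  obtain ⟨hc, h⟩ := h
  have h₁ : OddAt ψ (D.finger i hc) (Sum.inl (Sum.inr ())) :=
    h.elementary hψ (.symm (.second (D.fingerMove i hc))) rfl rfl
  have h₂ : OddAt ψ (D.slid i hc) (Sum.inl (Sum.inr ())) :=
    h₁.elementary hψ (.third (D.slideMove i hc)) rfl rfl
  refine ⟨⟨D.knotDart_next hc, h₂.elementary hψ (.second (D.slidMove i hc)) rfl rfl⟩, fun hx => ?_⟩
  have e₁ : OddAt ψ (D.finger i hc) (Sum.inr false) ↔ OddAt ψ (D.finger i hc) (Sum.inr true) :=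
    oddAt_iff_of_secondMove hψ (D.fingerMove i hc)
  have e₂ : OddAt ψ (D.slid i hc) (Sum.inl (Sum.inl x)) ↔ OddAt ψ (D.slid i hc) (Sum.inr true) :=
    oddAt_iff_of_secondMove hψ (D.slidMove i hc)
  have e₃ : ∀ y : (D.X ⊕ Unit) ⊕ Bool, (D.finger i hc).kind y = .classical →
      (OddAt ψ (D.finger i hc) y ↔ OddAt ψ (D.slid i hc) y) := fun y hy =>
    ⟨fun h => h.elementary hψ (.third (D.slideMove i hc)) rfl hy,
      fun h => h.elementary hψ (.symm (.third (D.slideMove i hc))) rfl hy⟩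
  have h₃ : OddAt ψ (D.finger i hc) (Sum.inl (Sum.inl x)) := by
    exact h₁.thirdMove hψ (D.slideMove i hc) rfl rfl rfl hx hx
      ((e₃ (Sum.inl (Sum.inl x)) hx).trans (e₂.trans ((e₃ (Sum.inr true) hx).symm.trans e₁.symm)))
  have h₄ : OddAt ψ (D.kinkAt i hc) (Sum.inl x) :=
    h₃.elementary hψ (.second (D.fingerMove i hc)) rfl hx
  exact h₄.elementary hψ (.first (D.kinkFirstMove i (s := some (Sum.inr x, j)) hc)) rfl hx

theorem OddKink.sameCycle (hψ : IsWeakParity D₀ ψ) {i : ZMod 4} {c d : Dart (T.V ⊕ D.X)}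
    (h : OddKink ψ D i (some c)) (hcd : (straightWalk D.edge).SameCycle c d) :
    OddKink ψ D i (some d) := by
  have := T.finite_V
  have := D.finite_X
  have step : ∀ c, OddKink ψ D i (some ((straightWalk D.edge) c)) → OddKink ψ D i (some c) := by
    intro c h
    obtain ⟨y, hy⟩ := D.knotDart_inr (show KnotDart D.vertexKind _ from h.1)
    have e : straightWalk D.edge c = (Sum.inr y, (straightWalk D.edge c).2) := by rw [← hy]
    rw [e] at h
    have := (h.slide hψ).1
    have e' : D.edge (Sum.inr y, (straightWalk D.edge c).2 + 2) = c := by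
      rw [← hy]
      change D.edge (turn 2 (turn 2 (D.edge c))) = c
      rw [turn_two_turn_two, D.edge_invol]
    rwa [e'] at this
  -- the kink moves against the direction of its dart; on a finite cycle this makes no difference
  obtain ⟨n, rfl⟩ := hcd.symm.exists_nat_pow_eq
  clear hcd
  induction n with
  | zero => exact h
  | succ n ih =>
    rw [pow_succ', Equiv.Perm.mul_apply] at h
    exact ih (step _ h)

/-- An odd kink can be moved along the whole knot, and reaches every edge in one of the two
directions. -/
theorem OddKink.turn (hψ : IsWeakParity D₀ ψ) {i : ZMod 4} {c d : Dart (T.V ⊕ D.X)}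
    (h : OddKink ψ D i (some c)) (hd : KnotDart D.vertexKind d) :
    OddKink ψ D i (some d) ∨ OddKink ψ D i (some (turn 2 d)) :=
  (D.unicursal c d h.1 hd).imp (h.sameCycle hψ) (h.sameCycle hψ)

/-- If there is an odd kink, then on every edge one of the two kinks with opposite directions is
odd. -/
theorem OddKink.edge (hψ : IsWeakParity D₀ ψ) {i : ZMod 4} {c d : Dart (T.V ⊕ D.X)}
    (h : OddKink ψ D i (some c)) (hd : KnotDart D.vertexKind d) :
    OddKink ψ D i (some d) ∨ OddKink ψ D i (some (D.edge d)) := by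
  refine (h.turn hψ hd).imp id fun h => h.sameCycle hψ (SameCycle.symm ?_)
  have := (SameCycle.refl (straightWalk D.edge) (D.edge d)).apply_right
  rwa [straightWalk_apply, D.edge_invol] at this

/-- If there is an odd kink, then all crossings are odd: the kink passes each of them. -/
theorem OddKink.oddAt (hψ : IsWeakParity D₀ ψ) {i : ZMod 4} {s}
    (h : OddKink ψ D i s) {x : D.X} (hx : D.kind x = .classical) : OddAt ψ D x := by
  cases s with
  | none => exact (h.1 : IsEmpty D.X).elim x
  | some c =>
    have hk : KnotDart D.vertexKind (Sum.inr x, 0) := by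
      change (D.kind x).OnKnot 0
      rw [hx]
      trivial
    rcases h.turn hψ hk with h | h
    · exact (h.slide hψ).2 hx
    · exact (h.slide hψ).2 hx

end Diagram

/-! ### Isotopies and third moves away from a kink -/

theorem Kind.onKnot_opposite_corner {q : Kind} (hq : q ≠ .frame) (a : ZMod 4) :
    q.OnKnot (a + 2) ∨ q.OnKnot (a + 3) := by
  cases q with
  | classical => exact Or.inl trivial
  | virtual => exact Or.inl trivial
  | transit =>
    simp only [Kind.OnKnot, Even]
    revert a
    decide
  | frame => exact absurd rfl hq

theorem Kind.onKnot_zero {q : Kind} (hq : q ≠ .frame) : q.OnKnot 0 := by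
  cases q with
  | transit => exact ⟨0, rfl⟩
  | frame => exact absurd rfl hq
  | _ => trivial

namespace Diagram

variable {T : KnotTheory}

section

variable {D D' : Diagram T} {θ : Dart (T.V ⊕ D.X) → Dart (T.V ⊕ D'.X)}
  {Θ : Dart (T.V ⊕ (D.X ⊕ Unit)) → Dart (T.V ⊕ (D'.X ⊕ Unit))}

theorem kinkPerm_map (i : ZMod 4) (hθ : Function.Injective θ)
    (ho : ∀ d, Θ (oldDart Unit d) = oldDart Unit (θ d)) (hk : ∀ a, Θ (D.kinkDart a) = D'.kinkDart a)
    (s : Option (Dart (T.V ⊕ D.X))) (y) :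
    D'.kinkPerm i (s.map θ) (Θ y) = Θ (D.kinkPerm i s y) := by
  cases s with
  | none => rfl
  | some c =>
    revert y
    refine dart_cases (fun d => ?_) ?_
    · by_cases h : c = d
      · subst h
        rw [ho, kinkPerm_oldDart_self, hk]
        exact D'.kinkPerm_oldDart_self i _
      · rw [ho, kinkPerm_oldDart, kinkPerm_oldDart, ho]
        · simpa using h
        · simpa [hθ.eq_iff] using h
    · rintro ⟨⟨⟩, a⟩
      by_cases h : a = i + 2
      · subst h
        rw [hk, kinkPerm_self, ho]
        exact D'.kinkPerm_self i _
      · rw [hk, kinkPerm_kinkDart _ _ _ h, kinkPerm_kinkDart _ _ _ h, hk]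

/-- Maps of darts that respect the edges extend to diagrams with a kink. -/
theorem kinkEdge_map (i : ZMod 4) (hθ : Function.Injective θ)
    (he : ∀ d, D'.edge (θ d) = θ (D.edge d))
    (ho : ∀ d, Θ (oldDart Unit d) = oldDart Unit (θ d)) (hk : ∀ a, Θ (D.kinkDart a) = D'.kinkDart a)
    (s : Option (Dart (T.V ⊕ D.X))) :
    ∀ y, D'.kinkEdge i (s.map θ) (Θ y) = Θ (D.kinkEdge i s y) := by
  refine dart_cases_perm (D.kinkPerm i s) (fun d => ?_) ?_
  · rw [kinkEdge_kinkPerm_oldDart, ← kinkPerm_map i hθ ho hk, ← kinkPerm_map i hθ ho hk, ho, ho,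
      kinkEdge_kinkPerm_oldDart, he]
  · rintro ⟨⟨⟩, a⟩
    have h := joinEdge_newDart D.edge (kinkPiece T i).edge (D.kinkPerm i s) ((), a)
    have h' := joinEdge_newDart D'.edge (kinkPiece T i).edge (D'.kinkPerm i (s.map θ)) ((), a)
    rw [← kinkPerm_map i hθ ho hk, hk, kinkEdge, kinkEdge, h, ← kinkPerm_map i hθ ho hk]
    exact h'.trans (congrArg _ (hk _).symm)

end

variable {D₀ : Diagram T} {ψ : ∀ D : DiagramOf D₀, D.1.Crossing → ZMod 2} {D D' : Diagram T}
  {i : ZMod 4}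

variable (ψ) in
/-- There is an odd kink somewhere on the diagram. -/
def HasOddKink (D : Diagram T) (i : ZMod 4) : Prop := ∃ s, OddKink ψ D i s

theorem HasOddKink.edge (hψ : IsWeakParity D₀ ψ) (h : HasOddKink ψ D i) {d : Dart (T.V ⊕ D.X)}
    (hd : KnotDart D.vertexKind d) :
    OddKink ψ D i (some d) ∨ OddKink ψ D i (some (D.edge d)) := by
  obtain ⟨_ | c, h⟩ := h
  · obtain ⟨x, -⟩ := D.knotDart_inr hd
    exact (h.1 : IsEmpty D.X).elim x
  · exact h.edge hψ hd

theorem HasOddKink.turn (hψ : IsWeakParity D₀ ψ) (h : HasOddKink ψ D i) {d : Dart (T.V ⊕ D.X)}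
    (hd : KnotDart D.vertexKind d) :
    OddKink ψ D i (some d) ∨ OddKink ψ D i (some (turn 2 d)) := by
  obtain ⟨_ | c, h⟩ := h
  · obtain ⟨x, -⟩ := D.knotDart_inr hd
    exact (h.1 : IsEmpty D.X).elim x
  · exact h.turn hψ hd

theorem knotDart_zero (D : Diagram T) (x : D.X) : KnotDart D.vertexKind (Sum.inr x, 0) :=
  Kind.onKnot_zero (D.kind_ne_frame x)

namespace Isotopy

/-- The map of darts that belongs to an isotopy. -/
def dartMap (f : Isotopy D D') (d : Dart (T.V ⊕ D.X)) : Dart (T.V ⊕ D'.X) :=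
  (Sum.map id f.toEquiv d.1, d.2 + f.shift d.1)

theorem dartMap_injective (f : Isotopy D D') : Function.Injective f.dartMap := by
  rintro ⟨w, a⟩ ⟨w', a'⟩ h
  obtain ⟨h1, h2⟩ := Prod.ext_iff.1 h
  have : w = w' := (Sum.map_injective.2 ⟨Function.injective_id, f.toEquiv.injective⟩) h1
  subst this
  exact Prod.ext rfl (add_right_cancel h2)

theorem knotDart (f : Isotopy D D') (d : Dart (T.V ⊕ D.X)) :
    KnotDart D'.vertexKind (f.dartMap d) ↔ KnotDart D.vertexKind d := by
  obtain ⟨v | x, a⟩ := d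
  · rfl
  · change (D'.kind (f.toEquiv x)).OnKnot (a + f.shift (Sum.inr x)) ↔ (D.kind x).OnKnot a
    have h := f.shift_transit x
    rw [f.kind_eq]
    cases hk : D.kind x with
    | transit =>
      have := h hk
      simp only [Kind.OnKnot]
      generalize f.shift (Sum.inr x) = b at this
      revert this
      simp only [Even]
      revert a b
      decide
    | _ => rfl

theorem isSite (f : Isotopy D D') {s} (hs : D.IsSite s) : D'.IsSite (s.map f.dartMap) := by
  cases s with
  | none =>
    have : IsEmpty D.X := hs
    exact f.toEquiv.symm.isEmpty
  | some c => exact (f.knotDart c).2 hs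

/-- The isotopy of diagrams with a kink. -/
def kink (f : Isotopy D D') (i : ZMod 4) {s} (hs : D.IsSite s) :
    Isotopy (D.kink i hs) (D'.kink i (f.isSite hs)) where
  toEquiv := Equiv.sumCongr f.toEquiv (Equiv.refl Unit)
  shift := Sum.elim (fun v => f.shift (Sum.inl v)) (Sum.elim (fun x => f.shift (Sum.inr x)) 0)
  kind_eq := by
    rintro (x | x)
    · exact f.kind_eq x
    · rfl
  shift_frame := f.shift_frame
  shift_transit := by
    rintro (x | x) h
    · exact f.shift_transit x h
    · exact ⟨0, rfl⟩
  shift_classical := by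
    rintro hT (x | x) h
    · exact f.shift_classical hT x h
    · exact ⟨0, rfl⟩
  edge_eq := by
    rintro d _ rfl
    exact kinkEdge_map (Θ := fun d => (Sum.map id (Equiv.sumCongr f.toEquiv (Equiv.refl Unit)) d.1,
      d.2 + Sum.elim (fun v => f.shift (Sum.inl v)) (Sum.elim (fun x => f.shift (Sum.inr x)) 0) d.1))
      i f.dartMap_injective (fun d => f.edge_eq d _ rfl) (by rintro ⟨v | x, a⟩ <;> rfl)
      (fun a => by simp [kinkDart, newDart]) s d

theorem oddKink_iff (hψ : IsWeakParity D₀ ψ) (f : Isotopy D D') {s} (hs : D.IsSite s) :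
    OddKink ψ D i s ↔ OddKink ψ D' i (s.map f.dartMap) :=
  ⟨fun h => ⟨f.isSite hs, h.2.elementary hψ (.isotopy (f.kink i hs)) rfl rfl⟩,
    fun h => ⟨hs, h.2.elementary hψ (.symm (.isotopy (f.kink i hs))) rfl rfl⟩⟩

theorem hasOddKink_iff (hψ : IsWeakParity D₀ ψ) (f : Isotopy D D') :
    HasOddKink ψ D i ↔ HasOddKink ψ D' i := by
  constructor
  · rintro ⟨s, h⟩
    exact ⟨_, (f.oddKink_iff hψ h.1).1 h⟩
  · intro h
    rcases isEmpty_or_nonempty D.X with hD | ⟨⟨x⟩⟩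
    · obtain ⟨_ | c, h⟩ := h
      · exact ⟨none, (f.oddKink_iff hψ (s := none) hD).2 h⟩
      · obtain ⟨x, -⟩ := D'.knotDart_inr (show KnotDart D'.vertexKind c from h.1)
        exact isEmptyElim (f.toEquiv.symm x)
    · have hx := D.knotDart_zero x
      rcases h.edge hψ ((f.knotDart _).2 hx) with h | h
      · exact ⟨_, (f.oddKink_iff hψ (s := some _) hx).2 h⟩
      · rw [show D'.edge (f.dartMap (Sum.inr x, 0)) = f.dartMap (D.edge (Sum.inr x, 0)) from
          f.edge_eq _ _ rfl] at h
        exact ⟨_, (f.oddKink_iff hψ (s := some _) ((D.edge_knotDart _).2 hx)).2 h⟩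

end Isotopy

theorem exchange_map {W W' : Type} {g : W → W'} (hg : Function.Injective g) (x y z : W)
    (i j k : ZMod 4) (d : Dart W) :
    exchange (g x) (g y) (g z) i j k (g d.1, d.2) =
      (g (exchange x y z i j k d).1, (exchange x y z i j k d).2) := by
  classical
  have hm : Function.Injective (fun d : Dart W => (g d.1, d.2)) := by
    rintro ⟨w, a⟩ ⟨w', a'⟩ h
    obtain ⟨h1, h2⟩ := Prod.ext_iff.1 h
    exact Prod.ext (hg h1) h2
  have key : ∀ (w : W) (a : ZMod 4) (w' : W) (a' : ZMod 4) (d : Dart W),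
      Equiv.swap (g w, a) (g w', a') (g d.1, d.2) =
        (g (Equiv.swap (w, a) (w', a') d).1, (Equiv.swap (w, a) (w', a') d).2) :=
    fun w a w' a' d => hm.swap_apply (w, a) (w', a') d
  simp only [exchange, Equiv.Perm.mul_apply, key]

namespace ThirdMove

/-- The map of darts that belongs to a third move. -/
noncomputable def dartMap (f : ThirdMove D D') (d : Dart (T.V ⊕ D.X)) : Dart (T.V ⊕ D'.X) :=
  (Sum.map id f.toEquiv (exchange f.x f.y f.z f.i f.j f.k d).1,
    (exchange f.x f.y f.z f.i f.j f.k d).2)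

theorem dartMap_injective (f : ThirdMove D D') : Function.Injective f.dartMap := by
  intro d d' h
  obtain ⟨h1, h2⟩ := Prod.ext_iff.1 h
  have := (Sum.map_injective.2 ⟨Function.injective_id, f.toEquiv.injective⟩) h1
  exact (exchange f.x f.y f.z f.i f.j f.k).injective (Prod.ext this h2)

theorem knotDart (f : ThirdMove D D') (d : Dart (T.V ⊕ D.X)) :
    KnotDart D'.vertexKind (f.dartMap d) ↔ KnotDart D.vertexKind d := by
  have h : ∀ d : Dart (T.V ⊕ D.X),
      KnotDart D'.vertexKind (Sum.map id f.toEquiv d.1, d.2) ↔ KnotDart D.vertexKind d := by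
    rintro ⟨v | x, a⟩
    · rfl
    · change (D'.kind (f.toEquiv x)).OnKnot a ↔ (D.kind x).OnKnot a
      rw [f.kind_eq]
  have h₁ := D.edge_knotDart (f.x, f.i)
  have h₂ := D.edge_knotDart (f.y, f.j)
  have h₃ := D.edge_knotDart (f.z, f.k)
  rw [f.side₁] at h₁
  rw [f.side₂] at h₂
  rw [f.side₃] at h₃
  have t : ∀ (w : T.V ⊕ D.X) (a : ZMod 4), KnotDart D.vertexKind (w, a + 2) ↔
      KnotDart D.vertexKind (w, a) := fun w a => KnotDart.turn_two D.vertexKind (w, a)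
  have t' : ∀ (w : T.V ⊕ D.X) (a : ZMod 4), KnotDart D.vertexKind (w, a + 3) ↔
      KnotDart D.vertexKind (w, a + 1) := fun w a => by
    rw [← t w (a + 1), (quarter_add a).1]
  refine (h _).trans (KnotDart.exchange ?_ ?_ ?_ ?_ ?_ ?_ d)
  · rw [t, h₁]
  · rw [t', h₁]
  · rw [t, h₂]
  · rw [t', h₂]
  · rw [t, h₃]
  · rw [t', h₃]

/-- The edge that starts with `c` is not a side of the triangle. -/
def Outside (f : ThirdMove D D') (c : Dart (T.V ⊕ D.X)) : Prop :=
  (c ≠ (f.x, f.i) ∧ c ≠ (f.x, f.i + 1)) ∧ (c ≠ (f.y, f.j) ∧ c ≠ (f.y, f.j + 1)) ∧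
    (c ≠ (f.z, f.k) ∧ c ≠ (f.z, f.k + 1))

theorem Outside.edge {f : ThirdMove D D'} {c : Dart (T.V ⊕ D.X)} (h : f.Outside c) :
    f.Outside (D.edge c) := by
  have key : ∀ {a b}, D.edge a = b → c ≠ b → D.edge c ≠ a := by
    rintro a _ rfl h rfl
    exact h (D.edge_invol c).symm
  have key' : ∀ {a b}, D.edge a = b → c ≠ a → D.edge c ≠ b := by
    rintro a _ rfl h h'
    exact h (D.edge.injective h')
  obtain ⟨⟨h1, h2⟩, ⟨h3, h4⟩, h5, h6⟩ := h
  exact ⟨⟨key f.side₁ h4, key' f.side₃ h5⟩, ⟨key f.side₂ h6, key' f.side₁ h1⟩,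
    key f.side₃ h2, key' f.side₂ h3⟩

/-- The knot has an edge that is not a side of the triangle: it starts at a corner of the triangle
and leads away from it. -/
theorem exists_outside (f : ThirdMove D D') :
    ∃ c, KnotDart D.vertexKind c ∧ f.Outside c := by
  have hq : D.vertexKind f.x ≠ .frame ∨ D.vertexKind f.y ≠ .frame := by
    rcases f.admissible with ⟨h, -⟩ | ⟨q, hq, h⟩
    · exact Or.inl (by simp [h])
    · have : q ≠ .frame := by rcases hq with rfl | rfl <;> simp
      rcases h with ⟨h, -⟩ | ⟨h, -⟩ | ⟨-, h⟩
      · exact Or.inl (h ▸ this)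
      · exact Or.inr (h ▸ this)
      · exact Or.inl (h ▸ this)
  have hn : ∀ a : ZMod 4, a + 2 ≠ a ∧ a + 2 ≠ a + 1 ∧ a + 3 ≠ a ∧ a + 3 ≠ a + 1 := by decide
  rcases hq with hq | hq
  · have h := f.ne_xy
    have h' := f.ne_zx.symm
    have := hn f.i
    rcases Kind.onKnot_opposite_corner hq f.i with hk | hk
    · exact ⟨(f.x, f.i + 2), hk, by simp [Outside, h, h', quarter_ne]⟩
    · exact ⟨(f.x, f.i + 3), hk, by simp [Outside, h, h', quarter_ne]⟩
  · have h := f.ne_xy.symm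
    have h' := f.ne_yz
    have := hn f.j
    rcases Kind.onKnot_opposite_corner hq f.j with hk | hk
    · exact ⟨(f.y, f.j + 2), hk, by simp [Outside, h, h', quarter_ne]⟩
    · exact ⟨(f.y, f.j + 3), hk, by simp [Outside, h, h', quarter_ne]⟩

/-- The third move of diagrams with a kink outside of the triangle. -/
def kink (f : ThirdMove D D') (i : ZMod 4) {c} (hc : KnotDart D.vertexKind c) (ho : f.Outside c) :
    ThirdMove (D.kink i (s := some c) hc)
      (D'.kink i (s := some (f.dartMap c)) ((f.knotDart c).2 hc)) where
  toEquiv := Equiv.sumCongr f.toEquiv (Equiv.refl Unit)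
  kind_eq := by
    rintro (x | x)
    · exact f.kind_eq x
    · rfl
  x := Sum.map id Sum.inl f.x
  y := Sum.map id Sum.inl f.y
  z := Sum.map id Sum.inl f.z
  ne_xy h := f.ne_xy (Sum.map_injective.2 ⟨Function.injective_id, Sum.inl_injective⟩ h)
  ne_yz h := f.ne_yz (Sum.map_injective.2 ⟨Function.injective_id, Sum.inl_injective⟩ h)
  ne_zx h := f.ne_zx (Sum.map_injective.2 ⟨Function.injective_id, Sum.inl_injective⟩ h)
  i := f.i
  j := f.j
  k := f.k
  side₁ := by
    have := D.kinkEdge_oldDart i (s := some c) (d := (f.x, f.i)) (by simpa using ho.1.1)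
      (by simpa [f.side₁] using ho.2.1.2)
    rwa [f.side₁] at this
  side₂ := by
    have := D.kinkEdge_oldDart i (s := some c) (d := (f.y, f.j)) (by simpa using ho.2.1.1)
      (by simpa [f.side₂] using ho.2.2.2)
    rwa [f.side₂] at this
  side₃ := by
    have := D.kinkEdge_oldDart i (s := some c) (d := (f.z, f.k)) (by simpa using ho.2.2.1)
      (by simpa [f.side₃] using ho.1.2)
    rwa [f.side₃] at this
  admissible := by
    have h : ∀ w, (D.kink i (s := some c) hc).vertexKind (Sum.map id Sum.inl w) =
        D.vertexKind w := by
      rintro (v | x) <;> rfl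
    rw [h, h, h]
    exact f.admissible
  edge_eq := by
    rintro d _ rfl
    have hinj : Function.Injective (Sum.map id Sum.inl : T.V ⊕ D.X → T.V ⊕ (D.X ⊕ Unit)) :=
      Sum.map_injective.2 ⟨Function.injective_id, Sum.inl_injective⟩
    refine kinkEdge_map (Θ := fun d =>
      (Sum.map id (Equiv.sumCongr f.toEquiv (Equiv.refl Unit)) (exchange (Sum.map id Sum.inl f.x)
        (Sum.map id Sum.inl f.y) (Sum.map id Sum.inl f.z) f.i f.j f.k d).1,
        (exchange (Sum.map id Sum.inl f.x : T.V ⊕ (D.X ⊕ Unit)) (Sum.map id Sum.inl f.y)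
          (Sum.map id Sum.inl f.z) f.i f.j f.k d).2))
      i f.dartMap_injective (fun d => f.edge_eq d _ rfl) (fun d => ?_) (fun a => ?_) (some c) d
    · simp only [oldDart, exchange_map hinj]
      rw [dartMap]
      rcases exchange f.x f.y f.z f.i f.j f.k d with ⟨v | x, a⟩ <;> rfl
    · have hn : ∀ w : T.V ⊕ D.X, (D.kinkDart a).1 ≠ Sum.map id Sum.inl w := by
        rintro (v | x) <;> simp [newDart]
      simp only [exchange_apply_of_ne _ _ _ (hn f.x) (hn f.y) (hn f.z)]
      rfl

theorem oddKink_iff (hψ : IsWeakParity D₀ ψ) (f : ThirdMove D D') {c}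
    (hc : KnotDart D.vertexKind c) (ho : f.Outside c) :
    OddKink ψ D i (some c) ↔ OddKink ψ D' i (some (f.dartMap c)) :=
  ⟨fun h => ⟨(f.knotDart c).2 hc, h.2.elementary hψ (.third (f.kink i hc ho)) rfl rfl⟩,
    fun h => ⟨hc, h.2.elementary hψ (.symm (.third (f.kink i hc ho))) rfl rfl⟩⟩

theorem hasOddKink_iff (hψ : IsWeakParity D₀ ψ) (f : ThirdMove D D') :
    HasOddKink ψ D i ↔ HasOddKink ψ D' i := by
  obtain ⟨c, hc, ho⟩ := f.exists_outside
  have hc' := (D.edge_knotDart c).2 hc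
  constructor
  · intro h
    rcases h.edge hψ hc with h | h
    · exact ⟨_, (f.oddKink_iff hψ hc ho).1 h⟩
    · exact ⟨_, (f.oddKink_iff hψ hc' ho.edge).1 h⟩
  · intro h
    rcases h.edge hψ ((f.knotDart c).2 hc) with h | h
    · exact ⟨_, (f.oddKink_iff hψ hc ho).2 h⟩
    · rw [show D'.edge (f.dartMap c) = f.dartMap (D.edge c) from f.edge_eq _ _ rfl] at h
      exact ⟨_, (f.oddKink_iff hψ hc' ho.edge).2 h⟩

end ThirdMove

end Diagram

/-! ### First and second moves away from a kink -/

namespace Diagram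

variable {T : KnotTheory} {D D' : Diagram T} (i : ZMod 4)

/-- A deleted vertex is also deleted in the presence of a kink. -/
theorem sumMap_inl_notMem_range {keep : D'.X → D.X} {w : T.V ⊕ D.X}
    (hw : w ∉ Set.range (Sum.map id keep : T.V ⊕ D'.X → T.V ⊕ D.X)) :
    (Sum.map id Sum.inl w : T.V ⊕ (D.X ⊕ Unit)) ∉
      Set.range (Sum.map id (Sum.map keep id) : T.V ⊕ (D'.X ⊕ Unit) → T.V ⊕ (D.X ⊕ Unit)) := by
  rintro ⟨v | x | u, h⟩ <;> rcases w with v' | x' <;> simp at h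
  · exact hw ⟨Sum.inl v, congrArg Sum.inl h⟩
  · exact hw ⟨Sum.inr x, congrArg Sum.inr h⟩

/-- Deleting vertices commutes with inserting a kink next to a dart that survives. -/
theorem kinkEdge_erasesTo_kinkEdge {keep : D'.X → D.X} (hk : Function.Injective keep)
    (he : ErasesTo D.edge D'.edge (Sum.map id keep)) (c : Dart (T.V ⊕ D'.X)) :
    ErasesTo (D.kinkEdge i (some (Sum.map id keep c.1, c.2))) (D'.kinkEdge i (some c))
      (Sum.map id (Sum.map keep id)) := by
  set ι : T.V ⊕ D'.X → T.V ⊕ D.X := Sum.map id keep with hι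
  set S := (Set.range (Sum.map id (Sum.map keep id) :
    T.V ⊕ (D'.X ⊕ Unit) → T.V ⊕ (D.X ⊕ Unit)))ᶜ with hS
  have hinj : Function.Injective (fun d : Dart (T.V ⊕ D'.X) => ((ι d.1, d.2) : Dart _)) := by
    rintro ⟨w, a⟩ ⟨w', a'⟩ h
    obtain ⟨h1, h2⟩ := Prod.ext_iff.1 h
    exact Prod.ext ((Sum.map_injective.2 ⟨Function.injective_id, hk⟩) h1) h2
  have hJ := kinkPerm_map (D := D') (D' := D) (θ := fun d => (ι d.1, d.2))
    (Θ := fun d => (Sum.map id (Sum.map keep id) d.1, d.2)) i hinj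
    (by rintro ⟨v | x, a⟩ <;> rfl) (fun a => rfl) (some c)
  have hfix : ∀ y : Dart (T.V ⊕ (D.X ⊕ Unit)), y.1 ∈ S →
      D.kinkPerm i (some (ι c.1, c.2)) y = y := by
    refine dart_cases (fun d hd => kinkPerm_oldDart _ _ ?_) (fun a ha => absurd ha ?_)
    · rw [Ne, Option.some_inj]
      rintro rfl
      refine hd ⟨Sum.map id Sum.inl c.1, ?_⟩
      rcases c with ⟨v | x, a⟩ <;> rfl
    · exact fun h => h ⟨Sum.inr (Sum.inr ()), rfl⟩
  refine erasesTo_iff.2 (dart_cases_perm (D'.kinkPerm i (some c)) (fun d => ?_) ?_)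
  · rw [kinkEdge_kinkPerm_oldDart]
    have h1 := hJ (oldDart Unit d)
    have h2 := hJ (oldDart Unit (D'.edge d))
    rw [← h1, ← h2]
    refine Thread.conj (α := adjoinEdge D.edge (kinkPiece T i).edge) hfix ?_
    have := (erasesTo_iff.1 he d).map (α' := adjoinEdge D.edge (kinkPiece T i).edge) (S' := S)
      (Sum.map id Sum.inl) (adjoinEdge_oldDart _ _) (fun w hw => sumMap_inl_notMem_range hw)
    rcases d with ⟨v | x, a⟩ <;> generalize D'.edge _ = e at this ⊢ <;>
      rcases e with ⟨v' | x', a'⟩ <;> exact this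
  · rintro ⟨⟨⟩, a⟩
    have h := joinEdge_newDart D.edge (kinkPiece T i).edge (D.kinkPerm i (some (ι c.1, c.2))) ((), a)
    have h' : D'.kinkEdge i (some c) (D'.kinkPerm i (some c) (D'.kinkDart a)) = _ :=
      joinEdge_newDart D'.edge (kinkPiece T i).edge (D'.kinkPerm i (some c)) ((), a)
    have h1 := hJ (D'.kinkDart a)
    have h2 := hJ (newDart T.V D'.X ((kinkPiece T i).edge ((), a)))
    rw [h', ← h1, ← h2]
    exact .of_eq h

/-- Inserting a kink does not join different faces. -/
theorem not_sameCycle_faceWalk_kinkEdge (c : Dart (T.V ⊕ D.X)) {a b : Dart (T.V ⊕ D.X)}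
    (h : ¬ (faceWalk D.edge).SameCycle a b) :
    ¬ (faceWalk (D.kinkEdge i (some c))).SameCycle (oldDart Unit a) (oldDart Unit b) := by
  classical
  intro hab
  apply h
  -- The darts `i + 1`, `i + 2`, `i + 3` of the kink lie in the two faces next to `c`.  The dart `i`
  -- is a face of its own, inside the loop, and its image does not matter.
  let φ : Dart (T.V ⊕ (D.X ⊕ Unit)) → Dart (T.V ⊕ D.X)
    | (.inl v, k) => (.inl v, k)
    | (.inr (.inl x), k) => (.inr x, k)
    | (.inr (.inr ()), k) =>
      if k = i + 2 then c else if k = i then c else D.edge c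
  have hφ : ∀ d, φ (oldDart Unit d) = d := by
    rintro ⟨v | x, k⟩ <;> rfl
  have hφ0 : φ (D.kinkDart i) = c := by
    change (if i = i + 2 then c else if i = i then c else D.edge c) = c
    simp
  have hφ1 : φ (D.kinkDart (i + 1)) = D.edge c := by
    change (if i + 1 = i + 2 then c else if i + 1 = i then c else D.edge c) = _
    simp [quarter_ne]
  have hφ2 : φ (D.kinkDart (i + 2)) = c := by
    change (if i + 2 = i + 2 then c else if i + 2 = i then c else D.edge c) = _
    simp
  have hφ3 : φ (D.kinkDart (i + 3)) = D.edge c := by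
    change (if i + 3 = i + 2 then c else if i + 3 = i then c else D.edge c) = _
    simp [quarter_ne]
  obtain ⟨-, -, -, i0, i1, i2, i3, -⟩ := quarter_add i
  have key : ∀ d, (faceWalk D.edge).SameCycle (φ d) (φ (faceWalk (D.kinkEdge i (some c)) d)) := by
    have hf : ∀ d, (faceWalk D.edge).SameCycle d (turn (-1) (D.edge d)) :=
      fun d => (SameCycle.refl _ _).apply_right
    refine dart_cases (fun d => ?_) ?_
    · rw [faceWalk_apply, hφ]
      by_cases h : c = d
      · subst h
        rw [kinkEdge_self, turn_newDart, turn_apply, i3, hφ2]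
      by_cases h' : c = D.edge d
      · subst h'
        have e := D.kinkEdge_invol i (some (D.edge d)) (D.kinkDart (i + 2))
        rw [kinkEdge_two, D.edge_invol] at e
        rw [e, turn_newDart, turn_apply, i2, hφ1, D.edge_invol]
      · rw [kinkEdge_oldDart _ _ (by simpa using h) (by simpa using h'), turn_oldDart, hφ]
        exact hf d
    · rintro ⟨⟨⟩, k⟩
      rw [faceWalk_apply]
      rcases quarter_cases i k with rfl | rfl | rfl | rfl
      · rw [hφ0, kinkEdge_zero, turn_newDart, turn_apply, i1, hφ0]
      · rw [hφ1, kinkEdge_one, turn_newDart, turn_apply, i0, hφ3]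
      · rw [hφ2, kinkEdge_two, turn_oldDart, hφ]
        exact hf c
      · rw [hφ3, kinkEdge_three, turn_oldDart, hφ]
        have := hf (D.edge c)
        rwa [D.edge_invol] at this
  have := SameCycle.map_sameCycle key hab
  rwa [hφ, hφ] at this

theorem knotDart_keep {keep : D'.X → D.X} (hk : ∀ x, D.kind (keep x) = D'.kind x)
    {c : Dart (T.V ⊕ D'.X)} (hc : KnotDart D'.vertexKind c) :
    KnotDart D.vertexKind (Sum.map id keep c.1, c.2) := by
  rcases c with ⟨v | x, a⟩
  · exact hc
  · change (D.kind (keep x)).OnKnot a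
    rw [hk]
    exact hc

theorem range_sumMap_keep {keep : D'.X → D.X} {s : Set D.X} (h : Set.range keep = sᶜ) :
    Set.range (Sum.map keep id : D'.X ⊕ Unit → D.X ⊕ Unit) = (Sum.inl '' s)ᶜ := by
  ext (x | u)
  · have : x ∈ Set.range keep ↔ x ∉ s := by rw [h, Set.mem_compl_iff]
    simpa using this
  · simp

theorem ne_keep_of_notMem {keep : D'.X → D.X} {u : D.X} (hu : u ∉ Set.range keep) (a : ZMod 4)
    (c : Dart (T.V ⊕ D'.X)) : (Sum.map id keep c.1, c.2) ≠ ((Sum.inr u, a) : Dart (T.V ⊕ D.X)) := by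
  rcases c with ⟨v | x, b⟩
  · simp
  · intro h
    exact hu ⟨x, by simpa using (Prod.ext_iff.1 h).1⟩

/-- The first move of diagrams with a kink at sites that correspond to each other. -/
def FirstMove.kink (f : FirstMove D D') {s : Option (Dart (T.V ⊕ D.X))} (hs : D.IsSite s)
    {s' : Option (Dart (T.V ⊕ D'.X))} (hs' : D'.IsSite s')
    (he : ErasesTo (D.kinkEdge i s) (D'.kinkEdge i s') (Sum.map id (Sum.map f.keep id)))
    (hl : s ≠ some (Sum.inr f.u, f.i) ∧ s ≠ some (Sum.inr f.u, f.i + 1)) :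
    FirstMove (D.kink i hs) (D'.kink i hs') where
  keep := Sum.map f.keep id
  keep_inj := Sum.map_injective.2 ⟨f.keep_inj, Function.injective_id⟩
  kind_eq := by
    rintro (x | x)
    · exact f.kind_eq x
    · rfl
  erases := he
  u := Sum.inl f.u
  range_keep := by
    have := range_sumMap_keep f.range_keep
    rwa [Set.image_singleton] at this
  i := f.i
  loop := by
    have := D.kinkEdge_oldDart i hl.1 (by rw [f.loop]; exact hl.2)
    rwa [f.loop] at this

/-- The second move of diagrams with a kink at sites that correspond to each other. -/
def SecondMove.kink (f : SecondMove D D') {c : Dart (T.V ⊕ D.X)}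
    (hc : KnotDart D.vertexKind c)
    {s' : Option (Dart (T.V ⊕ D'.X))} (hs' : D'.IsSite s')
    (he : ErasesTo (D.kinkEdge i (some c)) (D'.kinkEdge i s') (Sum.map id (Sum.map f.keep id)))
    (hu : c ≠ (Sum.inr f.u, f.i) ∧ c ≠ (Sum.inr f.u, f.i + 1))
    (hv : c ≠ (Sum.inr f.v, f.j) ∧ c ≠ (Sum.inr f.v, f.j + 1)) :
    SecondMove (D.kink i (s := some c) hc) (D'.kink i hs') where
  keep := Sum.map f.keep id
  keep_inj := Sum.map_injective.2 ⟨f.keep_inj, Function.injective_id⟩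
  kind_eq := by
    rintro (x | x)
    · exact f.kind_eq x
    · rfl
  erases := he
  u := Sum.inl f.u
  v := Sum.inl f.v
  ne h := f.ne (Sum.inl_injective h)
  range_keep := by
    have := range_sumMap_keep f.range_keep
    rwa [Set.image_pair] at this
  i := f.i
  j := f.j
  side₁ := by
    have := D.kinkEdge_oldDart i (s := some c) (by simpa using hu.1)
      (by rw [f.side₁]; simpa using hv.2)
    rwa [f.side₁] at this
  side₂ := by
    have := D.kinkEdge_oldDart i (s := some c) (by simpa using hu.2)
      (by rw [f.side₂]; simpa using hv.1)
    rwa [f.side₂] at this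
  same_kind := f.same_kind
  layers := f.layers
  disc := not_sameCycle_faceWalk_kinkEdge i c f.disc

/-- Deleting all vertices but the kink leaves a circle with a kink.  The thread in the hypothesis is
the rest of the knot: the walk from the far end of the edge of `c` back to `c`. -/
theorem kinkEdge_erasesTo_none {keep : D'.X → D.X} (hX' : IsEmpty D'.X)
    (he : ErasesTo D.edge D'.edge (Sum.map id keep)) (hk : ∀ x, D.kind x ≠ .transit)
    {c b : Dart (T.V ⊕ D.X)} (hc : KnotDart D.vertexKind c)
    (ht : Thread (D.kinkEdge i (some c))
      (Set.range (Sum.map id (Sum.map keep id) : T.V ⊕ (D'.X ⊕ Unit) → T.V ⊕ (D.X ⊕ Unit)))ᶜ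
      (oldDart Unit (turn 2 (D.edge c))) (oldDart Unit b))
    (hb : turn 2 b = c) :
    ErasesTo (D.kinkEdge i (some c)) (D'.kinkEdge i none) (Sum.map id (Sum.map keep id)) := by
  set S := (Set.range (Sum.map id (Sum.map keep id) :
    T.V ⊕ (D'.X ⊕ Unit) → T.V ⊕ (D.X ⊕ Unit)))ᶜ with hS
  have hmem : ∀ {w : T.V ⊕ D.X} {x}, w = Sum.inr x → (Sum.map id Sum.inl w) ∈ S := by
    rintro w x rfl
    refine sumMap_inl_notMem_range ?_
    rintro ⟨v | x, h⟩
    · simp at h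
    · exact isEmptyElim x
  have hon : ∀ x a, KnotDart D.vertexKind (Sum.inr x, a) := by
    intro x a
    change (D.kind x).OnKnot a
    have h1 := hk x
    have h2 := D.kind_ne_frame x
    cases h : D.kind x with
    | transit => exact absurd h h1
    | frame => exact absurd h h2
    | _ => trivial
  have hcx := D.knotDart_inr hc
  have hαc := D.knotDart_inr ((D.edge_knotDart c).2 hc)
  have hbx : ∃ x, b.1 = Sum.inr x := by
    obtain ⟨x, hx⟩ := hcx
    exact ⟨x, by rw [← hx, ← hb]; rfl⟩
  -- the strand with the kink is closed up behind the deleted vertices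
  have t2 : Thread (D.kinkEdge i (some c)) S (D.kinkDart (i + 2)) (D.kinkDart (i + 3)) := by
    refine .cross_of_eq (D.kinkEdge_two i c) (hmem hαc.choose_spec) ?_
    refine ht.trans (hmem hbx.choose_spec) ?_
    rw [turn_oldDart, hb]
    exact .of_eq (D.kinkEdge_self i c)
  have h23 : ∀ i : ZMod 4, 2 * i + 1 - (i + 3) = i + 2 := by decide
  have e3 : D'.kinkEdge i none (D'.kinkDart (i + 3)) = D'.kinkDart (i + 2) :=
    D'.kinkEdge_kinkDart i none (a := i + 3) (i + 2) (by simp [quarter_ne]) (h23 i)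
  have e2 : D'.kinkEdge i none (D'.kinkDart (i + 2)) = D'.kinkDart (i + 3) := by
    rw [← e3, kinkEdge_invol]
  refine erasesTo_iff.2 (dart_cases ?_ ?_)
  · rintro ⟨v | x, a⟩
    · have hoff : ¬ KnotDart D.vertexKind (D.edge (Sum.inl v, a)) :=
        fun h => (D.edge_knotDart _).1 h
      have hα : ∃ v', (D.edge (Sum.inl v, a)).1 = Sum.inl v' := by
        rcases h : D.edge (Sum.inl v, a) with ⟨v' | x, b⟩
        · exact ⟨v', rfl⟩
        · rw [h] at hoff
          exact absurd (hon x b) hoff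
      have h1 : D.edge (Sum.inl v, a) = (Sum.map id keep (D'.edge (Sum.inl v, a)).1,
          (D'.edge (Sum.inl v, a)).2) := by
        refine (erasesTo_iff.1 he (Sum.inl v, a)).eq_of_notMem ?_
        obtain ⟨v', hv'⟩ := hα
        rw [Set.notMem_compl_iff]
        exact ⟨Sum.inl v', hv'.symm⟩
      rw [D'.kinkEdge_oldDart i (by simp) (by simp)]
      refine .of_eq ((D.kinkEdge_oldDart i (d := (Sum.inl v, a)) ?_ ?_).trans ?_)
      · rw [Ne, Option.some_inj]
        rintro rfl
        exact hc
      · rw [Ne, Option.some_inj]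
        rintro rfl
        exact hoff hc
      · rw [h1]
        rcases D'.edge (Sum.inl v, a) with ⟨v' | x', a'⟩ <;> rfl
    · exact isEmptyElim x
  · rintro ⟨⟨⟩, a⟩
    rcases quarter_cases i a with rfl | rfl | rfl | rfl
    · rw [kinkEdge_zero]
      exact .of_eq (D.kinkEdge_zero a _)
    · rw [kinkEdge_one]
      exact .of_eq (D.kinkEdge_one i _)
    · rw [e2]
      exact t2
    · rw [e3]
      exact t2.symm (D.kinkEdge_invol i _)

end Diagram

/-! ### Odd kinks survive all moves -/

namespace Diagram

variable {T : KnotTheory} {D₀ : Diagram T} {ψ : ∀ D : DiagramOf D₀, D.1.Crossing → ZMod 2}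
  {D D' : Diagram T} {i : ZMod 4}

/-- If a vertex of the knot survives, the kink can be put next to it, in both directions. -/
theorem hasOddKink_iff_of_nonempty (hψ : IsWeakParity D₀ ψ) {keep : D'.X → D.X}
    (hk : ∀ x, D.kind (keep x) = D'.kind x) (hX' : Nonempty D'.X)
    (h : ∀ c : Dart (T.V ⊕ D'.X), KnotDart D'.vertexKind c →
      (OddKink ψ D i (some (Sum.map id keep c.1, c.2)) ↔ OddKink ψ D' i (some c))) :
    HasOddKink ψ D i ↔ HasOddKink ψ D' i := by
  obtain ⟨x⟩ := hX'
  have hx := D'.knotDart_zero x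
  have hx' := (KnotDart.turn_two D'.vertexKind _).2 hx
  constructor
  · intro hD
    rcases hD.turn hψ (knotDart_keep hk hx) with hD | hD
    · exact ⟨_, (h _ hx).1 hD⟩
    · exact ⟨_, (h _ hx').1 hD⟩
  · intro hD
    rcases hD.turn hψ hx with hD | hD
    · exact ⟨_, (h _ hx).2 hD⟩
    · exact ⟨_, (h _ hx').2 hD⟩

/-- If only a circle is left, the kink can be put on an edge of the original diagram, in both
directions. -/
theorem hasOddKink_iff_of_isEmpty (hψ : IsWeakParity D₀ ψ) (hX' : IsEmpty D'.X)
    {c c' : Dart (T.V ⊕ D.X)} (hc : KnotDart D.vertexKind c) (hcc : D.edge c = c')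
    (h : OddKink ψ D i (some c) ↔ OddKink ψ D' i none)
    (h' : OddKink ψ D i (some c') ↔ OddKink ψ D' i none) :
    HasOddKink ψ D i ↔ HasOddKink ψ D' i := by
  constructor
  · intro hD
    rcases hD.edge hψ hc with hD | hD
    · exact ⟨_, h.1 hD⟩
    · exact ⟨_, h'.1 (hcc ▸ hD)⟩
  · rintro ⟨_ | d, hD⟩
    · exact ⟨_, h.2 hD⟩
    · obtain ⟨x, -⟩ := D'.knotDart_inr (show KnotDart D'.vertexKind d from hD.1)
      exact hX'.elim x

theorem knotDart_of_ne_transit {x : D.X} (hx : D.kind x ≠ .transit) (a : ZMod 4) :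
    KnotDart D.vertexKind (Sum.inr x, a) := by
  change (D.kind x).OnKnot a
  have h := D.kind_ne_frame x
  cases hk : D.kind x with
  | transit => exact absurd hk hx
  | frame => exact absurd hk h
  | _ => trivial

theorem oldDart_mem_of_isEmpty {keep : D'.X → D.X} (hX' : IsEmpty D'.X) (x : D.X) (a : ZMod 4) :
    (oldDart Unit ((Sum.inr x, a) : Dart (T.V ⊕ D.X))).1 ∈ (Set.range (Sum.map id (Sum.map keep id) :
      T.V ⊕ (D'.X ⊕ Unit) → T.V ⊕ (D.X ⊕ Unit)))ᶜ := by
  rintro ⟨v | x | u, h⟩ <;> simp [oldDart] at h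
  exact hX'.elim x

namespace FirstMove

theorem u_notMem (f : FirstMove D D') : f.u ∉ Set.range f.keep := by simp [f.range_keep]

theorem eq_u (f : FirstMove D D') (hX' : IsEmpty D'.X) (x : D.X) : x = f.u := by
  by_contra h
  have : x ∈ Set.range f.keep := by rw [f.range_keep]; exact h
  obtain ⟨y, -⟩ := this
  exact hX'.elim y

theorem loop' (f : FirstMove D D') : D.edge (Sum.inr f.u, f.i + 1) = (Sum.inr f.u, f.i) := by
  rw [← f.loop, D.edge_invol]

theorem kind_ne_transit (f : FirstMove D D') : D.kind f.u ≠ .transit := by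
  intro h
  have h1 := D.edge_knotDart (Sum.inr f.u, f.i)
  rw [f.loop] at h1
  change (D.kind f.u).OnKnot (f.i + 1) ↔ (D.kind f.u).OnKnot f.i at h1
  rw [h] at h1
  have : ∀ a : ZMod 4, ¬ (Even (a + 1) ↔ Even a) := by
    simp only [Even]
    decide
  exact this _ h1

/-- An edge from the remaining darts of the crossing to the crossing itself is a second loop. -/
theorem edge_two_of_fst (f : FirstMove D D') (h : (D.edge (Sum.inr f.u, f.i + 2)).1 = Sum.inr f.u) :
    D.edge (Sum.inr f.u, f.i + 2) = (Sum.inr f.u, f.i + 3) := by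
  obtain ⟨b, hb⟩ : ∃ b, D.edge (Sum.inr f.u, f.i + 2) = (Sum.inr f.u, b) :=
    ⟨_, Prod.ext h rfl⟩
  have hb' : D.edge (Sum.inr f.u, b) = (Sum.inr f.u, f.i + 2) := by rw [← hb, D.edge_invol]
  rcases quarter_cases f.i b with rfl | rfl | rfl | rfl
  · rw [f.loop] at hb'
    simp [quarter_ne] at hb'
  · rw [f.loop'] at hb'
    simp [quarter_ne] at hb'
  · exact absurd hb (D.edge_ne _)
  · exact hb

theorem edge_two (f : FirstMove D D') (hX' : IsEmpty D'.X) :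
    D.edge (Sum.inr f.u, f.i + 2) = (Sum.inr f.u, f.i + 3) := by
  refine f.edge_two_of_fst ?_
  obtain ⟨y, hy⟩ := D.knotDart_inr
    ((D.edge_knotDart _).2 (knotDart_of_ne_transit f.kind_ne_transit (f.i + 2)))
  rw [hy, f.eq_u hX' y]

theorem oddKink_iff (hψ : IsWeakParity D₀ ψ) (f : FirstMove D D') {s : Option (Dart (T.V ⊕ D.X))}
    (hs : D.IsSite s) {s' : Option (Dart (T.V ⊕ D'.X))} (hs' : D'.IsSite s')
    (he : ErasesTo (D.kinkEdge i s) (D'.kinkEdge i s') (Sum.map id (Sum.map f.keep id)))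
    (hl : s ≠ some (Sum.inr f.u, f.i) ∧ s ≠ some (Sum.inr f.u, f.i + 1)) :
    OddKink ψ D i s ↔ OddKink ψ D' i s' :=
  ⟨fun h => ⟨hs', h.2.elementary hψ (.first (f.kink i hs hs' he hl)) rfl rfl⟩,
    fun h => ⟨hs, h.2.elementary hψ (.symm (.first (f.kink i hs hs' he hl))) rfl rfl⟩⟩

theorem hasOddKink_iff (hψ : IsWeakParity D₀ ψ) (f : FirstMove D D') :
    HasOddKink ψ D i ↔ HasOddKink ψ D' i := by
  rcases isEmpty_or_nonempty D'.X with hX' | hX'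
  · have h2 := f.edge_two hX'
    have h3 : D.edge (Sum.inr f.u, f.i + 3) = (Sum.inr f.u, f.i + 2) := by
      rw [← h2, D.edge_invol]
    have hk := knotDart_of_ne_transit f.kind_ne_transit
    obtain ⟨i12, i22, i32, -⟩ := quarter_add f.i
    have ht : ∀ x, D.kind x ≠ .transit := fun x => by
      rw [f.eq_u hX' x]
      exact f.kind_ne_transit
    refine hasOddKink_iff_of_isEmpty hψ hX' (hk (f.i + 2)) h2
      (f.oddKink_iff hψ (s := some _) (hk (f.i + 2)) (s' := none) hX' ?_ ?_)
      (f.oddKink_iff hψ (s := some _) (hk (f.i + 3)) (s' := none) hX' ?_ ?_)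
    · refine kinkEdge_erasesTo_none (b := (Sum.inr f.u, f.i)) i hX' f.erases ht (hk _) ?_ rfl
      rw [h2, turn_apply, i32]
      refine .of_eq ((D.kinkEdge_oldDart i ?_ ?_).trans ?_)
      · simp [quarter_ne]
      · simp [f.loop', quarter_ne]
      · rw [f.loop']
    · simp [quarter_ne]
    · refine kinkEdge_erasesTo_none (b := (Sum.inr f.u, f.i + 1)) i hX' f.erases ht (hk _) ?_
        (by rw [turn_apply, i12])
      rw [h3, turn_apply, i22]
      refine .of_eq ((D.kinkEdge_oldDart i ?_ ?_).trans ?_)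
      · simp [quarter_ne]
      · simp [f.loop, quarter_ne]
      · rw [f.loop]
    · simp [quarter_ne]
  · refine hasOddKink_iff_of_nonempty hψ f.kind_eq hX' fun c hc => ?_
    refine f.oddKink_iff hψ (s := some _) (knotDart_keep f.kind_eq hc) (s' := some c) hc
      (kinkEdge_erasesTo_kinkEdge i f.keep_inj f.erases c) ⟨?_, ?_⟩
    · simpa using ne_keep_of_notMem f.u_notMem f.i c
    · simpa using ne_keep_of_notMem f.u_notMem (f.i + 1) c

end FirstMove

namespace SecondMove

theorem u_notMem (f : SecondMove D D') : f.u ∉ Set.range f.keep := by simp [f.range_keep]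

theorem v_notMem (f : SecondMove D D') : f.v ∉ Set.range f.keep := by simp [f.range_keep]

theorem eq_u_or_eq_v (f : SecondMove D D') (hX' : IsEmpty D'.X) (x : D.X) : x = f.u ∨ x = f.v := by
  by_contra h
  have : x ∈ Set.range f.keep := by rw [f.range_keep]; exact h
  obtain ⟨y, -⟩ := this
  exact hX'.elim y

theorem side₁' (f : SecondMove D D') : D.edge (Sum.inr f.v, f.j + 1) = (Sum.inr f.u, f.i) := by
  rw [← f.side₁, D.edge_invol]

theorem side₂' (f : SecondMove D D') : D.edge (Sum.inr f.v, f.j) = (Sum.inr f.u, f.i + 1) := by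
  rw [← f.side₂, D.edge_invol]

/-- If no vertex is left, then an edge of the knot that is not a side of the bigon connects two of
the remaining darts. -/
theorem edge_cases (f : SecondMove D D') (hX' : IsEmpty D'.X) {w : D.X} {a : ZMod 4}
    (hd : KnotDart D.vertexKind (Sum.inr w, a))
    (hu : (w, a) ≠ (f.u, f.i) ∧ (w, a) ≠ (f.u, f.i + 1))
    (hv : (w, a) ≠ (f.v, f.j) ∧ (w, a) ≠ (f.v, f.j + 1)) :
    D.edge (Sum.inr w, a) = (Sum.inr f.u, f.i + 2) ∨
    D.edge (Sum.inr w, a) = (Sum.inr f.u, f.i + 3) ∨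
    D.edge (Sum.inr w, a) = (Sum.inr f.v, f.j + 2) ∨
      D.edge (Sum.inr w, a) = (Sum.inr f.v, f.j + 3) := by
  obtain ⟨y, hy⟩ := D.knotDart_inr ((D.edge_knotDart _).2 hd)
  obtain ⟨b, hb⟩ : ∃ b, D.edge (Sum.inr w, a) = (Sum.inr y, b) := ⟨_, Prod.ext hy rfl⟩
  have hb' : D.edge (Sum.inr y, b) = (Sum.inr w, a) := by rw [← hb, D.edge_invol]
  have inj : ∀ {w' a'}, ((Sum.inr w', a') : Dart (T.V ⊕ D.X)) = (Sum.inr w, a) →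
      (w, a) = (w', a') := by
    intro w' a' h
    simp only [Prod.mk.injEq, Sum.inr.injEq] at h
    rw [h.1, h.2]
  rw [hb]
  rcases f.eq_u_or_eq_v hX' y with rfl | rfl
  · rcases quarter_cases f.i b with rfl | rfl | rfl | rfl
    · rw [f.side₁] at hb'
      exact absurd (inj hb') hv.2
    · rw [f.side₂] at hb'
      exact absurd (inj hb') hv.1
    · exact Or.inl rfl
    · exact Or.inr (Or.inl rfl)
  · rcases quarter_cases f.j b with rfl | rfl | rfl | rfl
    · rw [f.side₂'] at hb'
      exact absurd (inj hb') hu.2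
    · rw [f.side₁'] at hb'
      exact absurd (inj hb') hu.1
    · exact Or.inr (Or.inr (Or.inl rfl))
    · exact Or.inr (Or.inr (Or.inr rfl))

/-- The edge would close up the two faces opposite to the bigon. -/
theorem edge_u_two_ne (f : SecondMove D D') :
    D.edge (Sum.inr f.u, f.i + 2) ≠ (Sum.inr f.v, f.j + 3) := by
  intro h
  refine f.disc ?_
  have := (SameCycle.refl (faceWalk D.edge) (Sum.inr f.u, f.i + 2)).apply_right
  rwa [faceWalk_apply, h, turn_apply, (quarter_add f.j).2.2.2.2.2.2.1] at this

theorem edge_u_three_ne (f : SecondMove D D') :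
    D.edge (Sum.inr f.u, f.i + 3) ≠ (Sum.inr f.v, f.j + 2) := by
  intro h
  have h' : D.edge (Sum.inr f.v, f.j + 2) = (Sum.inr f.u, f.i + 3) := by rw [← h, D.edge_invol]
  refine f.disc (SameCycle.symm ?_)
  have := (SameCycle.refl (faceWalk D.edge) (Sum.inr f.v, f.j + 2)).apply_right
  rwa [faceWalk_apply, h', turn_apply, (quarter_add f.i).2.2.2.2.2.2.1] at this

/-- A bigon that contains all vertices of the knot is not a bigon between the knot and an edge of the
frame: otherwise the faces opposite to the bigon would coincide, since the rest of the knot would be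
an edge between its two corners. -/
theorem kind_ne_transit (f : SecondMove D D') (hX' : IsEmpty D'.X) : D.kind f.u ≠ .transit := by
  intro h
  have hv : D.kind f.v = .transit := f.same_kind ▸ h
  have ku : ∀ a, KnotDart D.vertexKind (Sum.inr f.u, a) ↔ Even a := fun a => by
    change (D.kind f.u).OnKnot a ↔ _
    rw [h]
    rfl
  have kv : ∀ a, KnotDart D.vertexKind (Sum.inr f.v, a) ↔ Even a := fun a => by
    change (D.kind f.v).OnKnot a ↔ _
    rw [hv]
    rfl
  have h1 := D.edge_knotDart (Sum.inr f.u, f.i)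
  have hne := f.ne
  have e : ∀ a : ZMod 4, (Even a ∨ Even (a + 1)) ∧ ¬ (Even a ∧ Even (a + 1)) ∧
      (Even (a + 2) ↔ Even a) ∧ (Even (a + 3) ↔ Even (a + 1)) := by
    simp only [Even]
    decide
  rw [f.side₁, kv, ku] at h1
  have h2 := D.edge_knotDart (Sum.inr f.u, f.i + 1)
  rw [f.side₂, kv, ku] at h2
  obtain ⟨i0, i1, i2, i3⟩ := e f.i
  obtain ⟨j0, j1, j2, j3⟩ := e f.j
  rcases i0 with hi | hi
  · have hk : KnotDart D.vertexKind (Sum.inr f.u, f.i + 2) := (ku _).2 (i2.2 hi)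
    have hk' := (D.edge_knotDart _).2 hk
    rcases f.edge_cases hX' hk (by simp [quarter_ne]) (by simp [hne]) with h | h | h | h
    · exact D.edge_ne _ h
    · rw [h, ku] at hk'
      exact i1 ⟨hi, i3.1 hk'⟩
    · rw [h, kv] at hk'
      exact j1 ⟨j2.1 hk', h1.2 hi⟩
    · exact f.edge_u_two_ne h
  · have hk : KnotDart D.vertexKind (Sum.inr f.u, f.i + 3) := (ku _).2 (i3.2 hi)
    have hk' := (D.edge_knotDart _).2 hk
    rcases f.edge_cases hX' hk (by simp [quarter_ne]) (by simp [hne]) with h | h | h | h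
    · rw [h, ku] at hk'
      exact i1 ⟨i2.1 hk', hi⟩
    · exact D.edge_ne _ h
    · exact f.edge_u_three_ne h
    · rw [h, kv] at hk'
      exact j1 ⟨h2.2 hi, j3.1 hk'⟩

theorem forall_kind_ne_transit (f : SecondMove D D') (hX' : IsEmpty D'.X) (x : D.X) :
    D.kind x ≠ .transit := by
  rcases f.eq_u_or_eq_v hX' x with rfl | rfl
  · exact f.kind_ne_transit hX'
  · exact f.same_kind ▸ f.kind_ne_transit hX'

/-- If no vertex is left, then there is a loop at each of the two crossings: this is the only diagram
with two crossings where the faces opposite to the bigon are different. -/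
theorem edge_u_two (f : SecondMove D D') (hX' : IsEmpty D'.X) :
    D.edge (Sum.inr f.u, f.i + 2) = (Sum.inr f.u, f.i + 3) := by
  have hne := f.ne
  have hk := fun a => knotDart_of_ne_transit (f.kind_ne_transit hX') a
  rcases f.edge_cases hX' (hk (f.i + 2)) (by simp [quarter_ne]) (by simp [hne]) with h | h | h | h
  · exact absurd h (D.edge_ne _)
  · exact h
  · exfalso
    rcases f.edge_cases hX' (hk (f.i + 3)) (by simp [quarter_ne]) (by simp [hne])
      with h' | h' | h' | h'
    · have := D.edge_invol (Sum.inr f.u, f.i + 3)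
      rw [h', h] at this
      simp [hne.symm] at this
    · exact absurd h' (D.edge_ne _)
    · exact f.edge_u_three_ne h'
    · -- the face opposite to the bigon at `u` is the one at `v`
      refine f.disc ?_
      have s : ∀ {a b c : Dart (T.V ⊕ D.X)}, D.edge a = b → turn (-1) b = c →
          (faceWalk D.edge).SameCycle a c := by
        rintro a _ _ rfl rfl
        exact (SameCycle.refl _ _).apply_right
      have s1 := s h (c := (Sum.inr f.v, f.j + 1))
        (by rw [turn_apply, (quarter_add f.j).2.2.2.2.2.1])
      have s2 := s f.side₁' (c := (Sum.inr f.u, f.i + 3))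
        (by rw [turn_apply, (quarter_add f.i).2.2.2.1])
      have s3 := s h' (c := (Sum.inr f.v, f.j + 2))
        (by rw [turn_apply, (quarter_add f.j).2.2.2.2.2.2.1])
      exact s1.trans (s2.trans s3)
  · exact absurd h f.edge_u_two_ne

theorem edge_v_two (f : SecondMove D D') (hX' : IsEmpty D'.X) :
    D.edge (Sum.inr f.v, f.j + 2) = (Sum.inr f.v, f.j + 3) := by
  have hne := f.ne
  have h2 := f.edge_u_two hX'
  have h3 : D.edge (Sum.inr f.u, f.i + 3) = (Sum.inr f.u, f.i + 2) := by rw [← h2, D.edge_invol]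
  have hk := knotDart_of_ne_transit (f.forall_kind_ne_transit hX' f.v)
  have hi := D.edge_invol (Sum.inr f.v, f.j + 2)
  rcases f.edge_cases hX' (hk (f.j + 2)) (by simp [hne.symm]) (by simp [quarter_ne])
    with h | h | h | h
  · rw [h, h2] at hi
    simp [hne] at hi
  · rw [h, h3] at hi
    simp [hne] at hi
  · exact absurd h (D.edge_ne _)
  · exact h

theorem oddKink_iff (hψ : IsWeakParity D₀ ψ) (f : SecondMove D D') {c : Dart (T.V ⊕ D.X)}
    (hc : KnotDart D.vertexKind c) {s' : Option (Dart (T.V ⊕ D'.X))} (hs' : D'.IsSite s')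
    (he : ErasesTo (D.kinkEdge i (some c)) (D'.kinkEdge i s') (Sum.map id (Sum.map f.keep id)))
    (hu : c ≠ (Sum.inr f.u, f.i) ∧ c ≠ (Sum.inr f.u, f.i + 1))
    (hv : c ≠ (Sum.inr f.v, f.j) ∧ c ≠ (Sum.inr f.v, f.j + 1)) :
    OddKink ψ D i (some c) ↔ OddKink ψ D' i s' :=
  ⟨fun h => ⟨hs', h.2.elementary hψ (.second (f.kink i hc hs' he hu hv)) rfl rfl⟩,
    fun h => ⟨hc, h.2.elementary hψ (.symm (.second (f.kink i hc hs' he hu hv))) rfl rfl⟩⟩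

theorem hasOddKink_iff (hψ : IsWeakParity D₀ ψ) (f : SecondMove D D') :
    HasOddKink ψ D i ↔ HasOddKink ψ D' i := by
  rcases isEmpty_or_nonempty D'.X with hX' | hX'
  · have hne := f.ne
    have h2 := f.edge_u_two hX'
    have h3 : D.edge (Sum.inr f.u, f.i + 3) = (Sum.inr f.u, f.i + 2) := by
      rw [← h2, D.edge_invol]
    have h2' := f.edge_v_two hX'
    have h3' : D.edge (Sum.inr f.v, f.j + 3) = (Sum.inr f.v, f.j + 2) := by
      rw [← h2', D.edge_invol]
    have ht := f.forall_kind_ne_transit hX'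
    have hk := knotDart_of_ne_transit (ht f.u)
    obtain ⟨i12, i22, i32, -⟩ := quarter_add f.i
    obtain ⟨j12, j22, j32, -⟩ := quarter_add f.j
    have hS := oldDart_mem_of_isEmpty (D := D) (keep := f.keep) hX'
    -- the edges that are not next to the kink
    have ek : ∀ {c a b : Dart (T.V ⊕ D.X)}, D.edge a = b → c ≠ a → c ≠ b →
        D.kinkEdge i (some c) (oldDart Unit a) = oldDart Unit b := by
      rintro c a _ rfl h h'
      exact D.kinkEdge_oldDart i (by simpa using h) (by simpa using h')
    refine hasOddKink_iff_of_isEmpty hψ hX' (hk (f.i + 2)) h2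
      (f.oddKink_iff hψ (hk (f.i + 2)) (s' := none) hX' ?_ (by simp [quarter_ne]) (by simp [hne]))
      (f.oddKink_iff hψ (hk (f.i + 3)) (s' := none) hX' ?_ (by simp [quarter_ne]) (by simp [hne]))
    · refine kinkEdge_erasesTo_none (b := (Sum.inr f.u, f.i)) i hX' f.erases ht (hk _) ?_ rfl
      rw [h2, turn_apply, i32]
      refine .cross_of_eq (ek f.side₂ (by simp [quarter_ne]) (by simp [hne])) (hS _ _) ?_
      rw [turn_oldDart, turn_apply]
      refine .cross_of_eq (ek h2' (by simp [hne]) (by simp [hne])) (hS _ _) ?_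
      rw [turn_oldDart, turn_apply, j32]
      exact .of_eq (ek f.side₁' (by simp [hne]) (by simp [quarter_ne]))
    · refine kinkEdge_erasesTo_none (b := (Sum.inr f.u, f.i + 1)) i hX' f.erases ht (hk _) ?_
        (by rw [turn_apply, i12])
      rw [h3, turn_apply, i22]
      refine .cross_of_eq (ek f.side₁ (by simp [quarter_ne]) (by simp [hne])) (hS _ _) ?_
      rw [turn_oldDart, turn_apply, j12]
      refine .cross_of_eq (ek h3' (by simp [hne]) (by simp [hne])) (hS _ _) ?_
      rw [turn_oldDart, turn_apply, j22]
      exact .of_eq (ek f.side₂' (by simp [hne]) (by simp [quarter_ne]))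
  · refine hasOddKink_iff_of_nonempty hψ f.kind_eq hX' fun c hc => ?_
    exact f.oddKink_iff hψ (knotDart_keep f.kind_eq hc) (s' := some c) hc
      (kinkEdge_erasesTo_kinkEdge i f.keep_inj f.erases c)
      ⟨ne_keep_of_notMem f.u_notMem _ c, ne_keep_of_notMem f.u_notMem _ c⟩
      ⟨ne_keep_of_notMem f.v_notMem _ c, ne_keep_of_notMem f.v_notMem _ c⟩

end SecondMove

theorem Elementary.hasOddKink_iff (hψ : IsWeakParity D₀ ψ) {R : D.X → D'.X → Prop}
    (h : Elementary D D' R) : HasOddKink ψ D i ↔ HasOddKink ψ D' i := by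
  induction h with
  | isotopy f => exact f.hasOddKink_iff hψ
  | first f => exact f.hasOddKink_iff hψ
  | second f => exact f.hasOddKink_iff hψ
  | third f => exact f.hasOddKink_iff hψ
  | symm _ ih => exact ih.symm

theorem DiagramOf.hasOddKink_iff (hψ : IsWeakParity D₀ ψ) (D : DiagramOf D₀) :
    HasOddKink ψ D₀ i ↔ HasOddKink ψ D.1 i := by
  obtain ⟨D, h⟩ := D
  induction h with
  | refl => rfl
  | tail _ h ih =>
    obtain ⟨R, h⟩ := h
    exact ih.trans (h.hasOddKink_iff hψ)

end Diagram

/-! ### Every loop is a kink -/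

namespace Diagram

variable {T : KnotTheory} {D₀ : Diagram T} {ψ : ∀ D : DiagramOf D₀, D.1.Crossing → ZMod 2}
  {D D' : Diagram T}

namespace FirstMove

theorem mem_compl_range_iff (f : FirstMove D D') (w : T.V ⊕ D.X) :
    w ∈ (Set.range (Sum.map id f.keep : T.V ⊕ D'.X → T.V ⊕ D.X))ᶜ ↔ w = Sum.inr f.u := by
  rcases w with v | x
  · simp
  · have : x ∈ Set.range f.keep ↔ x ≠ f.u := by simp [f.range_keep]
    simp only [Set.mem_compl_iff, Set.mem_range, Sum.exists, Sum.map_inl, id_eq, reduceCtorEq,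
      exists_false, Sum.map_inr, Sum.inr.injEq, false_or]
    rw [← Set.mem_range, this, not_not]

/-- The vertices of the diagram without the loop and the crossing of the loop. -/
noncomputable def vertexEquiv (f : FirstMove D D') : D'.X ⊕ Unit ≃ D.X :=
  Equiv.ofBijective (Sum.elim f.keep fun _ => f.u) <| by
    constructor
    · rintro (x | x) (y | y) h
      · exact congrArg Sum.inl (f.keep_inj h)
      · exact absurd ⟨x, h⟩ f.u_notMem
      · exact absurd ⟨y, h.symm⟩ f.u_notMem
      · rfl
    · intro x
      by_cases h : x = f.u
      · exact ⟨Sum.inr (), h.symm⟩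
      · have : x ∈ Set.range f.keep := by rw [f.range_keep]; exact h
        obtain ⟨y, rfl⟩ := this
        exact ⟨Sum.inl y, rfl⟩

/-- The darts of the diagram with a kink, as darts of the diagram with the loop. -/
noncomputable def kinkDartMap (f : FirstMove D D') (d : Dart (T.V ⊕ (D'.X ⊕ Unit))) :
    Dart (T.V ⊕ D.X) := (Sum.map id f.vertexEquiv d.1, d.2)

theorem kinkDartMap_oldDart (f : FirstMove D D') (d : Dart (T.V ⊕ D'.X)) :
    f.kinkDartMap (oldDart Unit d) = (Sum.map id f.keep d.1, d.2) := by
  rcases d with ⟨v | x, a⟩ <;> rfl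

theorem kinkDartMap_kinkDart (f : FirstMove D D') (a : ZMod 4) :
    f.kinkDartMap (D'.kinkDart a) = (Sum.inr f.u, a) := rfl

/-- If the edges correspond to each other, the diagram with a kink is isotopic to the diagram with the
loop. -/
noncomputable def kinkIsotopy (f : FirstMove D D') {s} (hs : D'.IsSite s)
    (hu : D.kind f.u = .classical)
    (h : ∀ d, D.edge (f.kinkDartMap d) = f.kinkDartMap (D'.kinkEdge f.i s d)) :
    Isotopy (D'.kink f.i hs) D where
  toEquiv := f.vertexEquiv
  shift _ := 0
  kind_eq := by
    rintro (x | x)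
    · exact f.kind_eq x
    · exact hu
  shift_frame _ := rfl
  shift_transit _ _ := ⟨0, rfl⟩
  shift_classical _ _ _ := ⟨0, rfl⟩
  edge_eq := by
    rintro d _ rfl
    have h' : ∀ d : Dart (T.V ⊕ (D'.X ⊕ Unit)),
        ((Sum.map id f.vertexEquiv d.1, d.2 + 0) : Dart (T.V ⊕ D.X)) = f.kinkDartMap d :=
      fun d => by rw [add_zero]; rfl
    exact (congrArg D.edge (h' d)).trans ((h d).trans (h' _).symm)

theorem kinkDartMap_edge_of_isEmpty (f : FirstMove D D') (hX' : IsEmpty D'.X) :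
    ∀ d, D.edge (f.kinkDartMap d) = f.kinkDartMap (D'.kinkEdge f.i none d) := by
  have h2 := f.edge_two hX'
  have h3 : D.edge (Sum.inr f.u, f.i + 3) = (Sum.inr f.u, f.i + 2) := by rw [← h2, D.edge_invol]
  have h23 : ∀ i : ZMod 4, 2 * i + 1 - (i + 3) = i + 2 := by decide
  have e3 : D'.kinkEdge f.i none (D'.kinkDart (f.i + 3)) = D'.kinkDart (f.i + 2) :=
    D'.kinkEdge_kinkDart f.i none (a := f.i + 3) (f.i + 2) (by simp [quarter_ne]) (h23 f.i)
  have e2 : D'.kinkEdge f.i none (D'.kinkDart (f.i + 2)) = D'.kinkDart (f.i + 3) := by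
    rw [← e3, kinkEdge_invol]
  refine dart_cases (fun d => ?_) ?_
  · rw [D'.kinkEdge_oldDart f.i (by simp) (by simp), kinkDartMap_oldDart, kinkDartMap_oldDart]
    refine (erasesTo_iff.1 f.erases d).eq_of_notMem ?_
    rw [mem_compl_range_iff]
    intro hu
    have hk : KnotDart D.vertexKind (D.edge (Sum.map id f.keep d.1, d.2)) := by
      have := knotDart_of_ne_transit f.kind_ne_transit (D.edge (Sum.map id f.keep d.1, d.2)).2
      rwa [← hu] at this
    rw [edge_knotDart] at hk
    rcases d with ⟨v | x, a⟩
    · exact hk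
    · exact hX'.elim x
  · rintro ⟨⟨⟩, a⟩
    rcases quarter_cases f.i a with h | h | h | h
    · subst h
      rw [kinkEdge_zero, kinkDartMap_kinkDart, kinkDartMap_kinkDart, f.loop]
    · subst h
      rw [kinkEdge_one, kinkDartMap_kinkDart, kinkDartMap_kinkDart, f.loop']
    · subst h
      rw [e2, kinkDartMap_kinkDart, kinkDartMap_kinkDart, h2]
    · subst h
      rw [e3, kinkDartMap_kinkDart, kinkDartMap_kinkDart, h3]

/-- The crossing of a loop is connected with the rest of the diagram, since the knot has one
component. -/
theorem edge_three_ne (f : FirstMove D D') (hX' : Nonempty D'.X) :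
    (D.edge (Sum.inr f.u, f.i + 3)).1 ≠ Sum.inr f.u := by
  intro h
  obtain ⟨b, hb⟩ : ∃ b, D.edge (Sum.inr f.u, f.i + 3) = (Sum.inr f.u, b) := ⟨_, Prod.ext h rfl⟩
  have hb' : D.edge (Sum.inr f.u, b) = (Sum.inr f.u, f.i + 3) := by rw [← hb, D.edge_invol]
  have h3 : D.edge (Sum.inr f.u, f.i + 3) = (Sum.inr f.u, f.i + 2) := by
    rcases quarter_cases f.i b with rfl | rfl | rfl | rfl
    · rw [f.loop] at hb'
      simp [quarter_ne] at hb'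
    · rw [f.loop'] at hb'
      simp [quarter_ne] at hb'
    · exact hb
    · exact absurd hb (D.edge_ne _)
  have h2 : D.edge (Sum.inr f.u, f.i + 2) = (Sum.inr f.u, f.i + 3) := by rw [← h3, D.edge_invol]
  have hu : ∀ a, (D.edge (Sum.inr f.u, a)).1 = Sum.inr f.u := by
    intro a
    rcases quarter_cases f.i a with rfl | rfl | rfl | rfl
    exacts [by rw [f.loop], by rw [f.loop'], by rw [h2], by rw [h3]]
  have hinv : ∀ d : Dart (T.V ⊕ D.X),
      ((straightWalk D.edge d).1 = Sum.inr f.u) = (d.1 = Sum.inr f.u) := by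
    intro d
    refine propext ⟨fun h => ?_, fun h => ?_⟩
    · have := hu (D.edge d).2
      rw [← (show (D.edge d).1 = Sum.inr f.u from h), Prod.mk.eta, D.edge_invol] at this
      exact this.trans h
    · have := hu d.2
      rw [← h, Prod.mk.eta] at this
      exact this.trans h
  obtain ⟨x⟩ := hX'
  have hx : f.keep x ≠ f.u := fun h => f.u_notMem ⟨x, h⟩
  rcases D.unicursal _ _ (D.knotDart_zero f.u) (D.knotDart_zero (f.keep x)) with h | h <;>
  · have := SameCycle.map_eq (φ := fun d : Dart (T.V ⊕ D.X) => d.1 = Sum.inr f.u) hinv h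
    simp [hx] at this

/-- The kink belongs before the dart `c` at which the strand through the loop arrives. -/
theorem kinkDartMap_edge_of_nonempty (f : FirstMove D D') {c : Dart (T.V ⊕ D'.X)}
    (hc : D.edge (Sum.inr f.u, f.i + 3) = (Sum.map id f.keep c.1, c.2)) :
    ∀ d, D.edge (f.kinkDartMap d) = f.kinkDartMap (D'.kinkEdge f.i (some c) d) := by
  obtain ⟨i12, i22, i32, -⟩ := quarter_add f.i
  have hS : ∀ a, ((Sum.inr f.u, a) : Dart (T.V ⊕ D.X)).1 ∈
      (Set.range (Sum.map id f.keep : T.V ⊕ D'.X → T.V ⊕ D.X))ᶜ :=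
    fun a => (f.mem_compl_range_iff _).2 rfl
  have hne : ∀ (d : Dart (T.V ⊕ D'.X)) (a : ZMod 4),
      (Sum.map id f.keep d.1, d.2) ≠ ((Sum.inr f.u, a) : Dart (T.V ⊕ D.X)) :=
    fun d a => ne_keep_of_notMem f.u_notMem a d
  have hnS : ∀ d : Dart (T.V ⊕ D'.X), Sum.map id f.keep d.1 ∉
      (Set.range (Sum.map id f.keep : T.V ⊕ D'.X → T.V ⊕ D.X))ᶜ := fun d h => h ⟨_, rfl⟩
  have h3 : D.edge (Sum.map id f.keep c.1, c.2) = (Sum.inr f.u, f.i + 3) := by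
    rw [← hc, D.edge_invol]
  -- the thread that starts with `c` runs through the loop
  have h2 : D.edge (Sum.inr f.u, f.i + 2) =
      (Sum.map id f.keep (D'.edge c).1, (D'.edge c).2) := by
    have t := (erasesTo_iff.1 f.erases c).tail (hnS _) h3 (hS _)
    rw [turn_apply, i32] at t
    have t := t.tail (hnS _) f.loop' (hS _)
    refine t.eq_of_notMem ?_
    rw [mem_compl_range_iff]
    intro h
    have h2 := f.edge_two_of_fst h
    have := D.edge_invol (Sum.inr f.u, f.i + 2)
    rw [h2, hc] at this
    exact hne _ _ this
  have h2' : D.edge (Sum.map id f.keep (D'.edge c).1, (D'.edge c).2) =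
      (Sum.inr f.u, f.i + 2) := by
    rw [← h2, D.edge_invol]
  have hinj : ∀ d d' : Dart (T.V ⊕ D'.X),
      ((Sum.map id f.keep d.1, d.2) : Dart (T.V ⊕ D.X)) = (Sum.map id f.keep d'.1, d'.2) →
        d = d' := by
    rintro ⟨w, a⟩ ⟨w', a'⟩ h
    obtain ⟨h1, h2⟩ := Prod.ext_iff.1 h
    exact Prod.ext ((Sum.map_injective.2 ⟨Function.injective_id, f.keep_inj⟩) h1) h2
  refine dart_cases (fun d => ?_) ?_
  · by_cases h : d = c
    · subst h
      rw [kinkEdge_self, kinkDartMap_oldDart, kinkDartMap_kinkDart, h3]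
    by_cases h' : d = D'.edge c
    · subst h'
      have e := D'.kinkEdge_invol f.i (some c) (D'.kinkDart (f.i + 2))
      rw [kinkEdge_two] at e
      rw [e, kinkDartMap_oldDart, kinkDartMap_kinkDart, h2']
    rw [D'.kinkEdge_oldDart f.i (by simpa using fun e => h e.symm)
      (by rintro ⟨rfl⟩; exact h' (D'.edge_invol d).symm), kinkDartMap_oldDart, kinkDartMap_oldDart]
    refine (erasesTo_iff.1 f.erases d).eq_of_notMem ?_
    rw [mem_compl_range_iff]
    intro hu
    obtain ⟨b, hb⟩ : ∃ b, D.edge (Sum.map id f.keep d.1, d.2) = (Sum.inr f.u, b) :=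
      ⟨_, Prod.ext hu rfl⟩
    have hb' : D.edge (Sum.inr f.u, b) = (Sum.map id f.keep d.1, d.2) := by
      rw [← hb, D.edge_invol]
    rcases quarter_cases f.i b with rfl | rfl | rfl | rfl
    · rw [f.loop] at hb'
      exact hne _ _ hb'.symm
    · rw [f.loop'] at hb'
      exact hne _ _ hb'.symm
    · rw [h2] at hb'
      exact h' (hinj _ _ hb').symm
    · rw [hc] at hb'
      exact h (hinj _ _ hb').symm
  · rintro ⟨⟨⟩, a⟩
    rcases quarter_cases f.i a with h | h | h | h
    · subst h
      rw [kinkEdge_zero, kinkDartMap_kinkDart, kinkDartMap_kinkDart, f.loop]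
    · subst h
      rw [kinkEdge_one, kinkDartMap_kinkDart, kinkDartMap_kinkDart, f.loop']
    · subst h
      rw [kinkEdge_two, kinkDartMap_kinkDart, kinkDartMap_oldDart, h2]
    · subst h
      rw [kinkEdge_three, kinkDartMap_kinkDart, kinkDartMap_oldDart, hc]

/-- A diagram with a loop is isotopic to the diagram without the loop with a kink inserted. -/
theorem exists_kinkIsotopy (f : FirstMove D D') (hu : D.kind f.u = .classical) :
    ∃ (s : _) (hs : D'.IsSite s) (g : Isotopy (D'.kink f.i hs) D),
      g.toEquiv (Sum.inr ()) = f.u := by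
  rcases isEmpty_or_nonempty D'.X with hX' | hX'
  · exact ⟨none, hX', f.kinkIsotopy (s := none) hX' hu (f.kinkDartMap_edge_of_isEmpty hX'), rfl⟩
  · have h := f.edge_three_ne hX'
    rw [Ne, ← f.mem_compl_range_iff, Set.notMem_compl_iff] at h
    obtain ⟨w, hw⟩ := h
    have hc : D.edge (Sum.inr f.u, f.i + 3) =
        (Sum.map id f.keep w, (D.edge (Sum.inr f.u, f.i + 3)).2) := Prod.ext hw.symm rfl
    have hk : KnotDart D'.vertexKind (w, (D.edge (Sum.inr f.u, f.i + 3)).2) := by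
      have h1 := (D.edge_knotDart (Sum.inr f.u, f.i + 3)).2
        (knotDart_of_ne_transit f.kind_ne_transit _)
      rw [hc] at h1
      rcases w with v | x
      · exact h1
      · change (D'.kind x).OnKnot _
        rw [← f.kind_eq]
        exact h1
    exact ⟨some _, hk, f.kinkIsotopy (s := some _) hk hu (f.kinkDartMap_edge_of_nonempty hc), rfl⟩

theorem hasOddKink (hψ : IsWeakParity D₀ ψ) (f : FirstMove D D') (h : OddAt ψ D f.u) :
    HasOddKink ψ D' f.i := by
  obtain ⟨s, hs, g, hg⟩ := f.exists_kinkIsotopy h.2.1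
  exact ⟨s, hs, h.elementary hψ (.symm (.isotopy g)) hg rfl⟩

end FirstMove

end Diagram

theorem mainTheorem6 (T : KnotTheory) (D₀ : Diagram T) (hD₀ : D₀.OnSurface)
    (ψ : ∀ D : Diagram.DiagramOf D₀, D.1.Crossing → ZMod 2)
    (hψ : Diagram.IsWeakParity D₀ ψ) (hnontriv : ¬ Diagram.IsTrivialParity D₀ ψ)
    (D D' : Diagram.DiagramOf D₀) (f : Diagram.FirstMove D.1 D'.1)
    (u : D.1.Crossing) (hu : u.1 = f.u) :
    ψ D u = 0 := by
  by_contra h0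
  have h01 : ∀ a : ZMod 2, a ≠ 0 → a = 1 := by decide
  have h1 : Diagram.OddAt ψ D.1 f.u := ⟨D.2, hu ▸ u.2, by
    rw [← h01 _ h0]
    congr 1
    exact Subtype.ext hu.symm⟩
  refine hnontriv fun E v => ?_
  have hE : Diagram.HasOddKink ψ E.1 f.i :=
    (E.hasOddKink_iff hψ).1 ((D'.hasOddKink_iff hψ).2 (f.hasOddKink hψ h1))
  obtain ⟨s, hs⟩ := hE
  exact (hs.oddAt hψ v.2).2.2
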